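/- **Setting.** Let $d\ge 1$, let $\Theta\subseteq\mathbb{R}^d$ be convex and open, and let $\{P_\theta:\theta\in\Theta\}$ be probability distributions on a measurable space $\mathcal{X}$ such that each $P_\theta$ has a density $f(\cdot;\theta)>0$ with respect to a common base measure $\nu$. Let $R$ be a twice differentiable regularizer, and suppose that for every $x\in\mathcal{X}$ the function $\theta\mapsto\mathcal{L}(\theta;x)=-\log f(x;\theta)+R(\theta)$ is twice continuously differentiable on $\Theta$. Fix $\sigma>0$ and linear constraints $A\theta\le b$, where $A$ has rows $A_1,\dots,A_c\in\mathbb{R}^d$ ($c\ge 0$). Put $\mathcal{L}(\theta;x,w)=\mathcal{L}(\theta;x)+\sigma w^\top\theta$, and let $\hat\theta:\mathcal{X}\times\mathbb{R}^d\to\Theta$ be any measurable function (the output of a solver for minimizing $\mathcal{L}(\theta;x,w)$ over $\theta\in\Theta$, $A\theta\le b$). Let $\hat g(x,w)=\nabla_\theta\mathcal{L}(\hat\theta(x,w);x,w)$, let $\mathcal{A}(\theta)=\{i: A_i^\top\theta=b_i\}$ be the active set, and let $U_{\mathcal{A}(\theta)}$ be a matrix whose columns form an orthonormal basis of the orthogonal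 complement of $\mathrm{span}\{A_i:i\in\mathcal{A}(\theta)\}$. A point $\theta\in\Theta$ is a *strict second-order stationary point* (SSOSP) for $(x,w)$ if $A\theta\le b$; $\nabla_\theta\mathcal{L}(\theta;x,w)+\sum_i\lambda_iA_i=0$ for some $\lambda_i\ge0$ with $\lambda_i=0$ for $i\notin\mathcal{A}(\theta)$; and $U_{\mathcal{A}(\theta)}^\top\nabla^2_\theta\mathcal{L}(\theta;x,w)U_{\mathcal{A}(\theta)}\succ0$. For $\theta\in\Theta$ and $g\in\mathbb{R}^d$ let $\mathcal{X}_{\theta,g}$ be the set of $x$ such that, for some $w$, $\theta=\hat\theta(x,w)$ is an SSOSP for $(x,w)$ and $g=\nabla_\theta\mathcal{L}(\theta;x,w)$, and let $p_\theta(\cdot\mid\theta,g)$ be the probability density with respect to $\nu$ proportional to $$f(x;\theta)\,\exp\Big\{-\frac{\|g-\nabla_\theta\mathcal{L}(\theta;x)\|^2}{2\sigma^2/d}\Big\}\det\big(U_{\mathcal{A}(\theta)}^\top\nabla^2_\theta\mathcal{L}(\theta;x)U_{\mathcal{A}(\theta)}\big)\mathbf{1}\{x\in\mathcal{X}_{\theta,g}\},$$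 whenever this function has a positive and finite integral. Let $\tilde P_M(\cdot;x,\theta,g)$ be a Markov kernel into $\mathcal{X}^M$ such that, for all such $(\theta,g)$: if $X\sim p_\theta(\cdot\mid\theta,g)$ and $(\tilde X^{(1)},\dots,\tilde X^{(M)})\mid X\sim\tilde P_M(\cdot;X,\theta,g)$, then $(X,\tilde X^{(1)},\dots,\tilde X^{(M)})$ is exchangeable. The *constrained aCSS procedure* draws $X\sim P_{\theta_0}$ and, independently, $W\sim\mathcal{N}(0,\frac1d\mathbf{I}_d)$; if $\hat\theta(X,W)$ is not an SSOSP for $(X,W)$, it sets $\tilde X^{(1)}=\dots=\tilde X^{(M)}=X$; otherwise it draws $(\tilde X^{(1)},\dots,\tilde X^{(M)})\mid(X,\hat\theta,\hat g)\sim\tilde P_M(\cdot;X,\hat\theta,\hat g)$. For fixed $v_1,\dots,v_p\in\mathbb{R}^d$ let $\|w\|_{v,0}$ be the least $|S|$, $S\subseteq\{1,\dots,p\}$, with $w\in\mathrm{span}\{v_i\}_{i\in S}$ ($+\infty$ if there is none), and let $h_v(k)=\mathbb{E}_{Z\sim\mathcal{N}(0,\mathbf{I}_d)}\big[\max_{|S|\le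 k}\|\mathcal{P}_{v_S}Z\|^2\big]$, where $\mathcal{P}_{v_S}$ is the orthogonal projection to $\mathrm{span}\{v_i\}_{i\in S}$. Let $d_{\mathrm{exch}}$ of a random vector be the infimum of the total variation distances between its law and exchangeable laws, and let $\mathrm{pval}_T=\frac{1}{M+1}\big(1+\sum_{m=1}^M\mathbf{1}\{T(\tilde X^{(m)})\ge T(X)\}\big)$. **Theorem.** Let $\theta_0\in\Theta$, $r\ge0$, $\epsilon,\delta,\tilde\delta\in\mathbb{R}$ and $k\in\mathbb{N}$ (all of which may depend on $\theta_0$). Write $\mathbb{B}(\theta_0,r)$ for the closed ball, $H(\theta;x)=-\nabla^2_\theta\log f(x;\theta)$ and $H(\theta)=\mathbb{E}_{\theta_0}[H(\theta;X)]$. With $(X,W)\sim P_{\theta_0}\times\mathcal{N}(0,\frac1d\mathbf{I}_d)$, assume: 1. with probability at least $1-\delta$, $\hat\theta(X,W)$ is an SSOSP for $(X,W)$ and $\|\hat\theta(X,W)-\theta_0\|\le r$; 2. $H(\theta)$ exists for all $\theta\in\mathbb{B}(\theta_0,r)\cap\Theta$, and $$\mathbb{E}_{\theta_0}\Big[\sup_{\theta\in\mathbb{B}(\theta_0,r)\cap\Theta}r^2\big(\lambda_{\max}(H(\theta)-H(\theta;X))\big)_+\Big]\le\epsilon,\qquad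 \log\mathbb{E}_{\theta_0}\Big[\exp\Big\{\sup_{\theta\in\mathbb{B}(\theta_0,r)\cap\Theta}r^2\big(\lambda_{\max}(H(\theta;X)-H(\theta))\big)_+\Big\}\Big]\le\epsilon;$$ 3. $\mathbb{P}\{\|\hat\theta(X,W)-\theta_0\|_{v,0}\le k\}\ge1-\tilde\delta$. Then the copies generated by the constrained aCSS procedure satisfy $$d_{\mathrm{exch}}(X,\tilde X^{(1)},\dots,\tilde X^{(M)})\le 3\sigma r\sqrt{\frac{h_v(k)}{d}}+\epsilon+\delta+\tilde\delta,$$ and for every measurable test statistic $T:\mathcal{X}\to\mathbb{R}$ and every $\alpha\in[0,1]$, $$\mathbb{P}\big(\mathrm{pval}_T(X,\tilde X^{(1)},\dots,\tilde X^{(M)})\le\alpha\big)\le\alpha+3\sigma r\sqrt{\frac{h_v(k)}{d}}+\epsilon+\delta+\tilde\delta.$$ -/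

import Mathlib

open MeasureTheory ProbabilityTheory
open scoped ENNReal Matrix

noncomputable section

namespace ACSS

/-! ### Linear algebra and calculus -/

/-- `ℝ^d` with the Euclidean norm. -/
abbrev Vec (d : ℕ) : Type := EuclideanSpace ℝ (Fin d)

/-- The Hessian matrix of `F` at `θ`: its `(i, j)` entry is the second partial derivative
of `F` in the coordinate directions `i` and `j`. -/
def hessian {d : ℕ} (F : Vec d → ℝ) (θ : Vec d) : Matrix (Fin d) (Fin d) ℝ :=
  Matrix.of fun i j =>
    fderiv ℝ (fderiv ℝ F) θ (EuclideanSpace.single i 1) (EuclideanSpace.single j 1)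

/-- The largest eigenvalue of a (symmetric) real matrix. -/
def lambdaMax {d : ℕ} (M : Matrix (Fin d) (Fin d) ℝ) : ℝ := sSup (spectrum ℝ M)

/-- A matrix whose columns are an orthonormal basis of the subspace `V` of `ℝ^d`. -/
def orthoBasisMatrix {d : ℕ} (V : Submodule ℝ (Vec d)) :
    Matrix (Fin d) (Fin (Module.finrank ℝ V)) ℝ :=
  Matrix.of fun i j => (stdOrthonormalBasis ℝ V j : Vec d) i

/-! ### Sparsity relative to a family of vectors -/

/-- `‖w‖_{v,0}`: the least number of vectors `v i` whose span contains `w`, and `⊤` if `w` is not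
in the span of all of them. -/
def sparsity {d p : ℕ} (v : Fin p → Vec d) (w : Vec d) : ℕ∞ :=
  ⨅ (I : Finset (Fin p)) (_ : w ∈ Submodule.span ℝ (v '' (I : Set (Fin p)))), (I.card : ℕ∞)

/-- `h_v(k)`: the expectation, over a standard Gaussian vector `z` in `ℝ^d`, of the largest
squared norm of a projection of `z` to the span of at most `k` of the vectors `v i`. -/
def effDim {d p : ℕ} (v : Fin p → Vec d) (k : ℕ) : ℝ :=
  ∫ z, (⨆ I : {I : Finset (Fin p) // I.card ≤ k},
    ‖(Submodule.span ℝ (v '' (I.1 : Set (Fin p)))).starProjection z‖ ^ 2) ∂(stdGaussian (Vec d))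

/-! ### Exchangeability -/

/-- The law `μ` of a random vector of length `n` is exchangeable. -/
def Exchangeable {𝒳 : Type*} [MeasurableSpace 𝒳] {n : ℕ} (μ : Measure (Fin n → 𝒳)) : Prop :=
  ∀ π : Equiv.Perm (Fin n), μ.map (fun y => y ∘ π) = μ

/-- Total variation distance between two (probability) measures. -/
def dTV {𝒴 : Type*} [MeasurableSpace 𝒴] (μ ν : Measure 𝒴) : ℝ :=
  sSup {t : ℝ | ∃ B : Set 𝒴, MeasurableSet B ∧ t = |μ.real B - ν.real B|}

/-- Distance to exchangeability of the law `μ` of a random vector of length `n`: the infimum of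
its total variation distances to exchangeable probability laws. -/
def dExch {𝒳 : Type*} [MeasurableSpace 𝒳] {n : ℕ} (μ : Measure (Fin n → 𝒳)) : ℝ :=
  sInf {t : ℝ | ∃ ν : Measure (Fin n → 𝒳),
    IsProbabilityMeasure ν ∧ Exchangeable ν ∧ t = dTV μ ν}

/-- The p-value of the test statistic `T` for the data `x` and the copies `y 1, …, y M`. -/
def pval {𝒳 : Type*} {M : ℕ} (T : 𝒳 → ℝ) (x : 𝒳) (y : Fin M → 𝒳) : ℝ :=
  (1 / ((M : ℝ) + 1)) * (1 + ∑ m : Fin M, if T x ≤ T (y m) then (1 : ℝ) else 0)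

/-- The law `N(0, (1/d) I_d)` of the perturbation noise: the law of `z / √d` for a standard
Gaussian vector `z` in `ℝ^d`. -/
def noise (d : ℕ) : Measure (Vec d) :=
  (stdGaussian (Vec d)).map fun z => (Real.sqrt d)⁻¹ • z

/-! ### The statistical problem -/

/-- The data of a constrained aCSS problem: a family of densities `f (·; θ)` with respect to the
base measure `ν`, indexed by the parameter set `Θ ⊆ ℝ^d`; a regularizer `R`; a noise level `σ > 0`;
the linear constraints `A θ ≤ b`; and a solver `θ̂(x, w)`, which is any measurable map into `Θ`. -/
structure Setup (𝒳 : Type*) [MeasurableSpace 𝒳] (d c : ℕ) where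
  Θ : Set (Vec d)
  ν : Measure 𝒳
  f : 𝒳 → Vec d → ℝ
  R : Vec d → ℝ
  σ : ℝ
  A : Matrix (Fin c) (Fin d) ℝ
  b : Fin c → ℝ
  thetaHat : 𝒳 → Vec d → Vec d
  σ_pos : 0 < σ
  measurable_thetaHat : Measurable (fun q : 𝒳 × Vec d => thetaHat q.1 q.2)
  thetaHat_mem : ∀ x w, thetaHat x w ∈ Θ

namespace Setup

variable {𝒳 : Type*} [MeasurableSpace 𝒳] {d c : ℕ} (S : Setup 𝒳 d c)

/-- The distribution `P_θ`, with density `f (·; θ)` with respect to `ν`. -/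
def P (θ : Vec d) : Measure 𝒳 := S.ν.withDensity fun x => ENNReal.ofReal (S.f x θ)

/-- The objective without noise, `L(θ; x) = - log f(x; θ) + R(θ)`. -/
def L (x : 𝒳) (θ : Vec d) : ℝ := - Real.log (S.f x θ) + S.R θ

/-- The perturbed objective, `L(θ; x, w) = - log f(x; θ) + R(θ) + σ wᵀ θ`. -/
def Lw (x : 𝒳) (w : Vec d) (θ : Vec d) : ℝ := S.L x θ + S.σ * inner ℝ w θ

/-- The regularity conditions on the parametric family and on the regularizer. -/
structure Regular : Prop where
  convex : Convex ℝ S.Θ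
  isOpen : IsOpen S.Θ
  measurable_f : ∀ θ ∈ S.Θ, Measurable fun x => S.f x θ
  f_pos : ∀ x, ∀ θ ∈ S.Θ, 0 < S.f x θ
  isProbabilityMeasure_P : ∀ θ ∈ S.Θ, IsProbabilityMeasure (S.P θ)
  differentiable_R : ∀ θ ∈ S.Θ, DifferentiableAt ℝ S.R θ ∧ DifferentiableAt ℝ (fderiv ℝ S.R) θ
  contDiffOn_L : ∀ x, ContDiffOn ℝ 2 (S.L x) S.Θ

/-- The gradient `ĝ(x, w)` of the perturbed objective at `θ̂(x, w)`. -/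
def gHat (x : 𝒳) (w : Vec d) : Vec d := gradient (S.Lw x w) (S.thetaHat x w)

/-- The `i`th row of the constraint matrix, as a vector of `ℝ^d`. -/
def row (i : Fin c) : Vec d := WithLp.toLp 2 (S.A i)

/-- The set of active constraints at `θ`. -/
def active (θ : Vec d) : Set (Fin c) := {i | inner ℝ (S.row i) θ = S.b i}

/-- The matrix `U` whose columns form an orthonormal basis of the orthogonal complement of the
span of the rows of `A` that are active at `θ`. -/
def U (θ : Vec d) :
    Matrix (Fin d) (Fin (Module.finrank ℝ (Submodule.span ℝ (S.row '' S.active θ))ᗮ)) ℝ :=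
  orthoBasisMatrix (Submodule.span ℝ (S.row '' S.active θ))ᗮ

/-- `θ` is a strict second-order stationary point of the minimization of `L(·; x, w)` over the
`θ ∈ Θ` with `A θ ≤ b`. -/
structure IsSSOSP (x : 𝒳) (w : Vec d) (θ : Vec d) : Prop where
  mem : θ ∈ S.Θ
  feasible : ∀ i, inner ℝ (S.row i) θ ≤ S.b i
  kkt : ∃ lam : Fin c → ℝ, (∀ i, 0 ≤ lam i) ∧ (∀ i, i ∉ S.active θ → lam i = 0) ∧
    gradient (S.Lw x w) θ + ∑ i, lam i • S.row i = 0
  second_order : ((S.U θ)ᵀ * hessian (S.Lw x w) θ * S.U θ).PosDef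

/-- The set `𝒳_{θ, g}` of the `x` for which some `w` has `θ = θ̂(x, w)`, an SSOSP, and
`g = ∇ L(θ; x, w)`. -/
def support (θ g : Vec d) : Set 𝒳 :=
  {x | ∃ w : Vec d, θ = S.thetaHat x w ∧ S.IsSSOSP x w θ ∧ g = gradient (S.Lw x w) θ}

open Classical in
/-- The unnormalized plug-in conditional density
`f(x; θ) exp(-‖g - ∇L(θ; x)‖² / (2σ²/d)) det(Uᵀ ∇²L(θ; x) U) 1{x ∈ 𝒳_{θ, g}}`. -/
def unnormDensity (θ g : Vec d) (x : 𝒳) : ℝ :=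
  if x ∈ S.support θ g then
    S.f x θ * Real.exp (-(‖g - gradient (S.L x) θ‖ ^ 2 / (2 * S.σ ^ 2 / d))) *
      ((S.U θ)ᵀ * hessian (S.L x) θ * S.U θ).det
  else 0

/-- The unnormalized plug-in conditional distribution. -/
def unnormLaw (θ g : Vec d) : Measure 𝒳 :=
  S.ν.withDensity fun x => ENNReal.ofReal (S.unnormDensity θ g x)

/-- The unnormalized plug-in conditional density can be normalized: its integral is positive and
finite. -/
def Normalizable (θ g : Vec d) : Prop :=
  S.unnormLaw θ g Set.univ ≠ 0 ∧ S.unnormLaw θ g Set.univ ≠ ∞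

/-- The plug-in conditional distribution `p_θ(· | θ, g)`. -/
def condLaw (θ g : Vec d) : Measure 𝒳 := (S.unnormLaw θ g Set.univ)⁻¹ • S.unnormLaw θ g

/-- The exchangeability requirement on the sampling mechanism `P̃_M(·; x, θ, g)` for the copies:
if `X` is drawn from `p_θ(· | θ, g)` and the copies given `X` from `P̃_M(·; X, θ, g)`, then
`(X, X̃¹, …, X̃ᴹ)` is exchangeable. -/
def IsValidSampler {M : ℕ} (Pt : Kernel (𝒳 × Vec d × Vec d) (Fin M → 𝒳)) : Prop :=
  ∀ θ ∈ S.Θ, ∀ g : Vec d, S.Normalizable θ g →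
    Exchangeable (((S.condLaw θ g) ⊗ₘ
      (Pt.comap (fun x : 𝒳 => (x, θ, g)) (by fun_prop))).map
        (fun q => (Fin.cons q.1 q.2 : Fin (M + 1) → 𝒳)))

/-- `(X, W, X̃)` is an outcome of the constrained aCSS algorithm at the true parameter `θ₀`, with
sampling mechanism `Pt`: `X ∼ P_{θ₀}` and `W ∼ N(0, (1/d) I_d)` are independent; where
`θ̂(X, W)` is not an SSOSP, all copies are equal to `X`; and on the event that it is one, the
conditional distribution of the copies given `(X, θ̂, ĝ)` is `Pt (X, θ̂, ĝ)`. -/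
structure IsRun {M : ℕ} (Pt : Kernel (𝒳 × Vec d × Vec d) (Fin M → 𝒳)) (θ₀ : Vec d)
    {Ω : Type*} [MeasurableSpace Ω] (Pr : Measure Ω)
    (X : Ω → 𝒳) (W : Ω → Vec d) (Xt : Ω → Fin M → 𝒳) : Prop where
  measurable_X : Measurable X
  measurable_W : Measurable W
  measurable_Xt : Measurable Xt
  law_XW : Pr.map (fun ω => (X ω, W ω)) = (S.P θ₀).prod (noise d)
  copies_of_not_ssosp : ∀ᵐ ω ∂Pr, ¬ S.IsSSOSP (X ω) (W ω) (S.thetaHat (X ω) (W ω)) →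
    ∀ m, Xt ω m = X ω
  copies_of_ssosp : HasCondDistrib Xt
    (fun ω => (X ω, S.thetaHat (X ω) (W ω), S.gHat (X ω) (W ω))) Pt
    (Pr.restrict {ω | S.IsSSOSP (X ω) (W ω) (S.thetaHat (X ω) (W ω))})

/-- With probability at least `1 - δ` under `P_{θ₀} × N(0, (1/d) I_d)`, the solver returns an SSOSP
within distance `r` of `θ₀`. -/
def AccurateSSOSP (θ₀ : Vec d) (r δ : ℝ) : Prop :=
  1 - δ ≤ ((S.P θ₀).prod (noise d)).real
    {q | S.IsSSOSP q.1 q.2 (S.thetaHat q.1 q.2) ∧ ‖S.thetaHat q.1 q.2 - θ₀‖ ≤ r}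

/-- `H(θ; x)`, the Hessian in `θ` of `- log f(x; θ)`. -/
def H (x : 𝒳) (θ : Vec d) : Matrix (Fin d) (Fin d) ℝ :=
  hessian (fun t => - Real.log (S.f x t)) θ

/-- `H(θ)`, the entrywise expectation of `H(θ; X)` under `X ∼ P_{θ₀}`. -/
def Hbar (θ₀ θ : Vec d) : Matrix (Fin d) (Fin d) ℝ :=
  Matrix.of fun i j => ∫ x, S.H x θ i j ∂(S.P θ₀)

/-- The supremum over `θ ∈ B(θ₀, r) ∩ Θ` of `r² (λ_max(H(θ) - H(θ; x)))₊`, possibly infinite. -/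
def lowerDev (θ₀ : Vec d) (r : ℝ) (x : 𝒳) : ℝ≥0∞ :=
  ⨆ θ ∈ Metric.closedBall θ₀ r ∩ S.Θ,
    ENNReal.ofReal (r ^ 2 * max (lambdaMax (S.Hbar θ₀ θ - S.H x θ)) 0)

/-- The supremum over `θ ∈ B(θ₀, r) ∩ Θ` of `r² (λ_max(H(θ; x) - H(θ)))₊`, possibly infinite. -/
def upperDev (θ₀ : Vec d) (r : ℝ) (x : 𝒳) : ℝ≥0∞ :=
  ⨆ θ ∈ Metric.closedBall θ₀ r ∩ S.Θ,
    ENNReal.ofReal (r ^ 2 * max (lambdaMax (S.H x θ - S.Hbar θ₀ θ)) 0)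

/-- The Hessian conditions: near `θ₀` the expected Hessian exists, and the Hessian concentrates
around it. -/
structure HessianConcentration (θ₀ : Vec d) (r ε : ℝ) : Prop where
  integrable : ∀ θ ∈ Metric.closedBall θ₀ r ∩ S.Θ, ∀ i j,
    Integrable (fun x => S.H x θ i j) (S.P θ₀)
  lower : ∫⁻ x, S.lowerDev θ₀ r x ∂(S.P θ₀) ≤ ENNReal.ofReal ε
  upper : ENNReal.log (∫⁻ x, EReal.exp (S.upperDev θ₀ r x : EReal) ∂(S.P θ₀)) ≤ (ε : EReal)

end Setup

end ACSS

end

open ACSS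

noncomputable section

namespace ACSS

open Filter Topology

/-! ### Gaussian measures -/

/-! On the event that the solver returns an SSOSP, the noise can be read off from the data and the
output: `w = σ⁻¹ (g - ∇L(θ; x))`. Fix `x` and an active set `I`. Then `θ` ranges over an affine
space orthogonal to the active rows and the KKT condition puts `g` in their span, so `(θ, g)` has
exactly `d` free coordinates, and the map from these coordinates to `w` has Jacobian `σ⁻ᵈ |det (Uᵀ
∇²L U)|`. Hence the joint law of data, solution and gradient has a density `j`, equal to `f(x; θ₀)`
times a factor free of the likelihood (`lintegral_ssosp`, `setLIntegral_ssosp_eq`). Replacing `f(x;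
θ₀)` by `f(x; θ)` in `j`, and rescaling for each `(θ, g)` so that the marginal of `(θ, g)` is kept,
gives a law under which the data given `(θ, g)` follow `p_θ(· | θ, g)`. Data and copies are then a
mixture of exchangeable vectors, and it remains to bound the cost of the replacement.

The replacement is a tilt by `e^u` with `u = log f(x; θ) - log f(x; θ₀)`. A Taylor expansion at `θ`
writes `u` as a function of `(θ, g)` alone, plus `σ wᵀ(θ - θ₀)`, plus a second-order remainder.
Since `θ - θ₀` is sparse of norm at most `r`, the linear term is at most `σ r Y(w)` with `Y =
sparseNorm v k`; the remainder varies with `x` by at most half the Hessian deviations. So, up to a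
constant depending on `(θ, g)`, `-β ≤ u ≤ α` with `β = σ r Y + low / 2` and `α = σ r Y + up / 2`
(`exists_log_ratio_bound`).

By `1 - y ≤ -log y`, the tilt loses at most `β + log E[e^α | θ, g]` of the density
(`exists_tilted_density`). With `τ = σ r √(h_v(k) / d)`, independence of data and noise gives an
average of at most `τ + ε / 2` for the first term and `2 τ + ε / 2` for the second: `3 τ + ε` in
all. The exponential moment of `Y` comes from a dimension-free Maurey–Pisier bound
(`IsUnitSupportFunction.integral_exp_le`); it is needed only for `3 τ ≤ 1`, as otherwise the claim
is trivial. Failure of accuracy or of sparsity costs `δ + δt`. -/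

theorem exists_noise_eq_withDensity {d : ℕ} (hd : 0 < d) :
    ∃ κ : ℝ, 0 < κ ∧ noise d = (volume : Measure (Vec d)).withDensity
      fun w => ENNReal.ofReal (κ * Real.exp (-(d / 2 * ‖w‖ ^ 2))) := by
  have hd' : (0 : ℝ) < d := by exact_mod_cast hd
  have hb : (0 : ℝ) < d / 2 := by positivity
  have key : ∀ t : Vec d, ∫ v : Vec d, Complex.exp (-((d / 2 : ℝ) : ℂ) * ‖v‖ ^ 2
      + Complex.I * inner ℝ t v) = ((Real.pi / (d / 2)) ^ ((d : ℝ) / 2) : ℝ) *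
        Complex.exp (-‖t‖ ^ 2 / (2 * d)) := by
    intro t
    rw [GaussianFourier.integral_cexp_neg_mul_sq_norm_add (by simpa using hb)]
    congr 1
    · rw [Complex.ofReal_cpow (by positivity)]
      simp
    · congr 1
      simp
      field_simp
      norm_num
  set N : ℝ := (Real.pi / (d / 2)) ^ ((d : ℝ) / 2) with hN
  have hNpos : 0 < N := by positivity
  have hint : Integrable (fun v : Vec d => Real.exp (-(d / 2 * ‖v‖ ^ 2))) := by
    have := GaussianFourier.integrable_cexp_neg_mul_sq_norm_add (V := Vec d)
      (b := ((d / 2 : ℝ) : ℂ)) (by simpa using hb) 0 0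
    refine this.re.congr (ae_of_all _ fun v => ?_)
    have : (-((d / 2 : ℝ) : ℂ) * (‖v‖ : ℂ) ^ 2 + 0 * ((inner ℝ (0 : Vec d) v : ℝ) : ℂ))
        = ((-(d / 2 * ‖v‖ ^ 2) : ℝ) : ℂ) := by push_cast; ring
    simp only [RCLike.re_to_complex]
    rw [this, Complex.exp_ofReal_re]
  refine ⟨N⁻¹, by positivity, ?_⟩
  have hmeas : Measurable fun v : Vec d => ENNReal.ofReal (N⁻¹ * Real.exp (-(d / 2 * ‖v‖ ^ 2))) := by
    fun_prop
  have : IsProbabilityMeasure (noise d) :=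
    Measure.isProbabilityMeasure_map (Measurable.aemeasurable (by fun_prop))
  have : IsFiniteMeasure ((volume : Measure (Vec d)).withDensity
      fun w => ENNReal.ofReal (N⁻¹ * Real.exp (-(d / 2 * ‖w‖ ^ 2)))) := by
    refine isFiniteMeasure_withDensity_ofReal ?_
    exact (hint.const_mul _).2
  -- Both measures are finite, so characteristic functions decide. `key` is the Fourier transform of
  -- the unnormalised Gaussian, and `N` is its value at `t = 0`.
  refine Measure.ext_of_charFun ?_
  ext t
  rw [noise, charFun_map_smul, charFun_stdGaussian, charFun_apply,
    integral_withDensity_eq_integral_toReal_smul hmeas (by simp)]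
  have h1 : ∀ v : Vec d, (ENNReal.ofReal (N⁻¹ * Real.exp (-(d / 2 * ‖v‖ ^ 2)))).toReal •
      Complex.exp (inner ℝ v t * Complex.I) = (N⁻¹ : ℂ) *
        Complex.exp (-((d / 2 : ℝ) : ℂ) * ‖v‖ ^ 2 + Complex.I * inner ℝ t v) := by
    intro v
    rw [ENNReal.toReal_ofReal (by positivity), Complex.exp_add, Complex.real_smul,
      real_inner_comm]
    push_cast
    rw [mul_assoc, mul_comm Complex.I]
    congr 3
    ring
  simp_rw [h1]
  rw [integral_const_mul, key]
  have hNC : (N : ℂ) ≠ 0 := by exact_mod_cast hNpos.ne'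
  rw [inv_mul_cancel_left₀ hNC]
  congr 1
  have h2 : ‖(Real.sqrt d)⁻¹ • t‖ ^ 2 = ‖t‖ ^ 2 / d := by
    rw [norm_smul, mul_pow]
    simp only [norm_inv, Real.norm_eq_abs, inv_pow, sq_abs, Real.sq_sqrt hd'.le]
    field_simp
  rw [← Complex.ofReal_pow, h2]
  push_cast
  field_simp

instance isProbabilityMeasure_noise (d : ℕ) : IsProbabilityMeasure (noise d) :=
  Measure.isProbabilityMeasure_map (Measurable.aemeasurable (by fun_prop))

/-! ### Exponential moments of Gaussian support functions -/

section Concentration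

variable {d : ℕ}

/-- By Fernique some `exp (C ‖z‖²)` is integrable, and completing the square bounds `c ‖z‖` by `C
‖z‖² + c² / (4 C)`. -/
theorem integrable_exp_mul_norm (c : ℝ) :
    Integrable (fun z : Vec d => Real.exp (c * ‖z‖)) (stdGaussian (Vec d)) := by
  obtain ⟨C, hC, hi⟩ := IsGaussian.exists_integrable_exp_sq (stdGaussian (Vec d))
  refine (hi.const_mul (Real.exp (c ^ 2 / (4 * C)))).mono' (by fun_prop) (ae_of_all _ fun z => ?_)
  rw [Real.norm_eq_abs, abs_of_pos (Real.exp_pos _), ← Real.exp_add, Real.exp_le_exp]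
  have : c ^ 2 / (4 * C) + C * ‖z‖ ^ 2 - c * ‖z‖ = (c - 2 * C * ‖z‖) ^ 2 / (4 * C) := by
    field_simp; ring
  have h2 : 0 ≤ (c - 2 * C * ‖z‖) ^ 2 / (4 * C) := by positivity
  linarith

theorem lintegral_exp_inner_stdGaussian (u : Vec d) :
    ∫⁻ z, ENNReal.ofReal (Real.exp (inner ℝ u z)) ∂(stdGaussian (Vec d)) =
      ENNReal.ofReal (Real.exp (‖u‖ ^ 2 / 2)) := by
  have hmap : (stdGaussian (Vec d)).map (fun z => inner ℝ u z) =
      gaussianReal 0 (‖u‖ ^ 2).toNNReal := by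
    have h := IsGaussian.map_eq_gaussianReal (μ := stdGaussian (Vec d)) (innerSL ℝ u)
    rw [variance_dual_stdGaussian, integral_strongDual_stdGaussian] at h
    simpa using h
  have h1 := mgf_gaussianReal hmap 1
  have hint : Integrable (fun z : Vec d => Real.exp (inner ℝ u z)) (stdGaussian (Vec d)) := by
    refine (integrable_exp_mul_norm ‖u‖).mono' (by fun_prop) (ae_of_all _ fun z => ?_)
    rw [Real.norm_eq_abs, abs_of_pos (Real.exp_pos _), Real.exp_le_exp]
    exact real_inner_le_norm u z
  rw [← ofReal_integral_eq_lintegral_ofReal hint (ae_of_all _ fun z => (Real.exp_pos _).le)]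
  congr 1
  simpa [mgf] using h1

/-- A support function of a subset of the unit ball of `ℝ^d`, described by its subgradients. -/
structure IsUnitSupportFunction (F : Vec d → ℝ) : Prop where
  measurable : Measurable F
  nonneg : ∀ z, 0 ≤ F z
  le_norm : ∀ z, F z ≤ ‖z‖
  exists_subgradient : ∀ z, ∃ u : Vec d, ‖u‖ ≤ 1 ∧ inner ℝ u z = F z ∧ ∀ z', inner ℝ u z' ≤ F z'

variable {F : Vec d → ℝ}

theorem IsUnitSupportFunction.integrable (hF : IsUnitSupportFunction F) :
    Integrable F (stdGaussian (Vec d)) :=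
  IsGaussian.integrable_id.norm.mono' hF.measurable.aestronglyMeasurable
    (ae_of_all _ fun z => by
      rw [Real.norm_eq_abs, abs_of_nonneg (hF.nonneg z)]; exact hF.le_norm z)

theorem IsUnitSupportFunction.integrable_exp (hF : IsUnitSupportFunction F) (c : ℝ) :
    Integrable (fun z => Real.exp (c * F z)) (stdGaussian (Vec d)) := by
  have := hF.measurable
  refine (integrable_exp_mul_norm |c|).mono' (by fun_prop) (ae_of_all _ fun z => ?_)
  rw [Real.norm_eq_abs, abs_of_pos (Real.exp_pos _), Real.exp_le_exp]
  calc c * F z ≤ |c| * F z := mul_le_mul_of_nonneg_right (le_abs_self c) (hF.nonneg z)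
    _ ≤ |c| * ‖z‖ := mul_le_mul_of_nonneg_left (hF.le_norm z) (abs_nonneg c)

theorem map_rotation_stdGaussian (t : ℝ) :
    ((stdGaussian (Vec d)).prod (stdGaussian (Vec d))).map (ContinuousLinearMap.rotation t) =
      (stdGaussian (Vec d)).prod (stdGaussian (Vec d)) :=
  IsGaussian.map_rotation_eq_self_of_forall_strongDual_eq_zero
    integral_strongDual_stdGaussian t

/-- A subgradient `u` at `z` gives `F (cos η z + sin η z') ≥ cos η F z + sin η ⟪u, z'⟫`, so for
fixed `z` the exponent is at most an affine function of the Gaussian `z'`, integrated exactly. As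
`z` is fixed in the inner integral, `u` need not depend measurably on it. -/
theorem IsUnitSupportFunction.lintegral_exp_rotation_step (hF : IsUnitSupportFunction F)
    {c η : ℝ} (hc : 0 ≤ c) :
    ∫⁻ q, ENNReal.ofReal (Real.exp (c * (F q.1 - F (Real.cos η • q.1 + Real.sin η • q.2))))
      ∂((stdGaussian (Vec d)).prod (stdGaussian (Vec d))) ≤
    ENNReal.ofReal (Real.exp ((c * Real.sin η) ^ 2 / 2)) *
      ∫⁻ z, ENNReal.ofReal (Real.exp (c * (1 - Real.cos η) * F z)) ∂(stdGaussian (Vec d)) := by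
  have hFm := hF.measurable
  rw [lintegral_prod _ (by fun_prop), ← lintegral_const_mul _ (by fun_prop)]
  refine lintegral_mono fun z => ?_
  obtain ⟨u, hu1, huz, hu⟩ := hF.exists_subgradient z
  have h1 : ∀ z', Real.exp (c * (F z - F (Real.cos η • z + Real.sin η • z'))) ≤
      Real.exp (c * (1 - Real.cos η) * F z) *
        Real.exp (inner ℝ (-(c * Real.sin η) • u) z') := by
    intro z'
    rw [← Real.exp_add, Real.exp_le_exp]
    have := hu (Real.cos η • z + Real.sin η • z')
    rw [inner_add_right, inner_smul_right, inner_smul_right, huz] at this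
    rw [inner_smul_left]
    simp only [conj_trivial]
    nlinarith
  calc ∫⁻ z', ENNReal.ofReal (Real.exp (c * (F z - F (Real.cos η • z + Real.sin η • z'))))
        ∂(stdGaussian (Vec d))
      ≤ ∫⁻ z', ENNReal.ofReal (Real.exp (c * (1 - Real.cos η) * F z)) *
        ENNReal.ofReal (Real.exp (inner ℝ (-(c * Real.sin η) • u) z')) ∂(stdGaussian (Vec d)) := by
        refine lintegral_mono fun z' => ?_
        rw [← ENNReal.ofReal_mul (Real.exp_pos _).le]
        exact ENNReal.ofReal_le_ofReal (h1 z')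
    _ = ENNReal.ofReal (Real.exp (c * (1 - Real.cos η) * F z)) *
        ENNReal.ofReal (Real.exp (‖-(c * Real.sin η) • u‖ ^ 2 / 2)) := by
        rw [lintegral_const_mul _ (by fun_prop), lintegral_exp_inner_stdGaussian]
    _ ≤ _ := by
        rw [mul_comm]
        have h2 : ‖-(c * Real.sin η) • u‖ ^ 2 ≤ (c * Real.sin η) ^ 2 := by
          rw [norm_smul, mul_pow, Real.norm_eq_abs, sq_abs, neg_sq]
          have : ‖u‖ ^ 2 ≤ 1 := pow_le_one₀ (norm_nonneg _) hu1
          nlinarith [sq_nonneg (c * Real.sin η)]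
        exact mul_le_mul' (ENNReal.ofReal_le_ofReal (Real.exp_le_exp.2 (by linarith))) le_rfl

/-- A quarter turn carries the first Gaussian to the second. Cutting it into `n` rotations by `η`
telescopes `F q.1 - F q.2` into `n` increments, which by rotation invariance all have the law of
`D`; convexity of `exp` then reduces the sum to a single increment with parameter `c n`. -/
theorem IsUnitSupportFunction.lintegral_exp_sub_le (hF : IsUnitSupportFunction F)
    {c : ℝ} (hc : 0 ≤ c) {n : ℕ} (hn : 0 < n) :
    ∫⁻ q, ENNReal.ofReal (Real.exp (c * (F q.1 - F q.2)))
      ∂((stdGaussian (Vec d)).prod (stdGaussian (Vec d))) ≤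
    ENNReal.ofReal (Real.exp ((c * n * Real.sin (Real.pi / 2 / n)) ^ 2 / 2)) *
      ∫⁻ z, ENNReal.ofReal (Real.exp (c * n * (1 - Real.cos (Real.pi / 2 / n)) * F z))
        ∂(stdGaussian (Vec d)) := by
  have hFm := hF.measurable
  have hn' : (0 : ℝ) < n := by exact_mod_cast hn
  set η : ℝ := Real.pi / 2 / n with hη
  set γ := (stdGaussian (Vec d)).prod (stdGaussian (Vec d))
  set D : Vec d × Vec d → ℝ :=
    fun q => F q.1 - F (Real.cos η • q.1 + Real.sin η • q.2) with hD
  have hDm : Measurable D := by fun_prop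
  have hrot : ∀ j : ℕ, ∀ q : Vec d × Vec d, D (ContinuousLinearMap.rotation (j * η) q) =
      F (Real.cos (j * η) • q.1 + Real.sin (j * η) • q.2) -
      F (Real.cos ((j + 1 : ℕ) * η) • q.1 + Real.sin ((j + 1 : ℕ) * η) • q.2) := by
    intro j q
    simp only [hD, ContinuousLinearMap.rotation_apply]
    congr 2
    have e1 : ((j + 1 : ℕ) : ℝ) * η = j * η + η := by push_cast; ring
    rw [e1, Real.cos_add, Real.sin_add]
    module
  have htel : ∀ q : Vec d × Vec d, F q.1 - F q.2 =
      ∑ j ∈ Finset.range n, D (ContinuousLinearMap.rotation (j * η) q) := by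
    intro q
    simp_rw [hrot]
    rw [Finset.sum_range_sub'
      (fun j : ℕ => F (Real.cos (j * η) • q.1 + Real.sin (j * η) • q.2))]
    have e2 : (n : ℝ) * η = Real.pi / 2 := by rw [hη]; field_simp
    simp [e2]
  have hconv : ∀ q : Vec d × Vec d, Real.exp (c * (F q.1 - F q.2)) ≤
      ∑ j ∈ Finset.range n,
        (1 / (n : ℝ)) * Real.exp (c * n * D (ContinuousLinearMap.rotation (j * η) q)) := by
    intro q
    have h := convexOn_exp.map_sum_le (t := Finset.range n) (w := fun _ => 1 / (n : ℝ))
      (p := fun j => c * n * D (ContinuousLinearMap.rotation (j * η) q))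
      (fun _ _ => by positivity) (by simp [hn'.ne']) (fun _ _ => Set.mem_univ _)
    simp only [smul_eq_mul] at h
    refine le_trans (le_of_eq ?_) h
    rw [htel, Finset.mul_sum]
    congr 1
    refine Finset.sum_congr rfl fun j _ => ?_
    field_simp
  have hstep := hF.lintegral_exp_rotation_step (c := c * n) (η := η) (by positivity)
  refine le_trans ?_ hstep
  calc ∫⁻ q, ENNReal.ofReal (Real.exp (c * (F q.1 - F q.2))) ∂γ
      ≤ ∫⁻ q, ∑ j ∈ Finset.range n, ENNReal.ofReal (1 / (n : ℝ)) * ENNReal.ofReal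
          (Real.exp (c * n * D (ContinuousLinearMap.rotation (j * η) q))) ∂γ := by
        refine lintegral_mono fun q => ?_
        refine (ENNReal.ofReal_le_ofReal (hconv q)).trans (le_of_eq ?_)
        rw [ENNReal.ofReal_sum_of_nonneg (fun _ _ => by positivity)]
        refine Finset.sum_congr rfl fun j _ => ?_
        rw [ENNReal.ofReal_mul (by positivity)]
    _ = ∑ j ∈ Finset.range n, ENNReal.ofReal (1 / (n : ℝ)) *
          ∫⁻ q, ENNReal.ofReal (Real.exp (c * n * D q)) ∂γ := by
        rw [lintegral_finsetSum _ (fun j _ => by fun_prop)]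
        refine Finset.sum_congr rfl fun j _ => ?_
        rw [lintegral_const_mul _ (by fun_prop)]
        congr 1
        conv_rhs => rw [show γ = γ.map (ContinuousLinearMap.rotation (j * η)) from
          (map_rotation_stdGaussian _).symm]
        rw [lintegral_map (by fun_prop) (by fun_prop)]
    _ = ∫⁻ q, ENNReal.ofReal (Real.exp (c * n * D q)) ∂γ := by
        rw [Finset.sum_const, Finset.card_range, nsmul_eq_mul, ← mul_assoc]
        rw [← ENNReal.ofReal_natCast n, ← ENNReal.ofReal_mul hn'.le]
        rw [mul_one_div_cancel hn'.ne', ENNReal.ofReal_one, one_mul]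

/-- The Maurey–Pisier bound on the exponential moments of a support function. -/
theorem IsUnitSupportFunction.integral_exp_le (hF : IsUnitSupportFunction F) {c : ℝ} (hc : 0 ≤ c) :
    ∫ z, Real.exp (c * F z) ∂(stdGaussian (Vec d)) ≤
      Real.exp (c * ∫ z, F z ∂(stdGaussian (Vec d)) + (c * (Real.pi / 2)) ^ 2 / 2) := by
  have hFm := hF.measurable
  set γ := stdGaussian (Vec d)
  set m := ∫ z, F z ∂γ
  have hconv : ∀ t : ℝ, ∫⁻ z, ENNReal.ofReal (Real.exp (t * F z)) ∂γ =
      ENNReal.ofReal (∫ z, Real.exp (t * F z) ∂γ) := fun t =>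
    (ofReal_integral_eq_lintegral_ofReal (hF.integrable_exp t)
      (ae_of_all _ fun z => (Real.exp_pos _).le)).symm
  -- Jensen in the second copy turns the bound for the symmetrised difference `F q.1 - F q.2` into
  -- one for `F - m`.
  have hjensen : Real.exp (-c * m) ≤ ∫ z, Real.exp (-c * F z) ∂γ := by
    have := convexOn_exp.map_integral_le (μ := γ) (f := fun z => -c * F z)
      Real.continuous_exp.continuousOn isClosed_univ (by simp)
      (hF.integrable.const_mul _) (hF.integrable_exp _)
    rwa [integral_const_mul] at this
  have hn : ∀ n : ℕ, 0 < n → (∫ z, Real.exp (c * F z) ∂γ) * Real.exp (-c * m) ≤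
      Real.exp ((c * (Real.pi / 2)) ^ 2 / 2) * ∫ z, Real.exp (2 * c / n * F z) ∂γ := by
    intro n hn
    have hn' : (0 : ℝ) < n := by exact_mod_cast hn
    have h := hF.lintegral_exp_sub_le hc hn
    have e : ∫⁻ q, ENNReal.ofReal (Real.exp (c * (F q.1 - F q.2))) ∂(γ.prod γ) =
        ENNReal.ofReal ((∫ z, Real.exp (c * F z) ∂γ) * ∫ z, Real.exp (-c * F z) ∂γ) := by
      rw [ENNReal.ofReal_mul (integral_nonneg fun z => (Real.exp_pos _).le), ← hconv, ← hconv,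
        ← lintegral_prod_mul (by fun_prop) (by fun_prop)]
      refine lintegral_congr fun q => ?_
      rw [← ENNReal.ofReal_mul (Real.exp_pos _).le, ← Real.exp_add]
      congr 2; ring
    rw [e, hconv, ← ENNReal.ofReal_mul (Real.exp_pos _).le, ENNReal.ofReal_le_ofReal_iff
      (mul_nonneg (Real.exp_pos _).le (integral_nonneg fun z => (Real.exp_pos _).le))] at h
    have hη0 : 0 ≤ Real.pi / 2 / n := by positivity
    calc (∫ z, Real.exp (c * F z) ∂γ) * Real.exp (-c * m)
        ≤ (∫ z, Real.exp (c * F z) ∂γ) * ∫ z, Real.exp (-c * F z) ∂γ := by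
          gcongr
      _ ≤ _ := h
      _ ≤ _ := by
          -- The crude `π ≤ 4` suffices: `n (1 - cos (π / (2 n))) ≤ π² / (8 n) ≤ 2 / n`, which
          -- vanishes in the limit.
          have hpi2 : Real.pi ^ 2 ≤ 16 := by nlinarith [Real.pi_pos, Real.pi_le_four]
          gcongr ?_ * ?_
          · rw [Real.exp_le_exp]
            have hs0 : 0 ≤ Real.sin (Real.pi / 2 / n) := by
              refine Real.sin_nonneg_of_nonneg_of_le_pi hη0 ?_
              rw [div_le_iff₀ hn']
              have : (1 : ℝ) ≤ n := by exact_mod_cast hn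
              nlinarith [Real.pi_pos]
            have : c * n * Real.sin (Real.pi / 2 / n) ≤ c * (Real.pi / 2) := by
              have := Real.sin_le hη0
              calc c * n * Real.sin (Real.pi / 2 / n) ≤ c * n * (Real.pi / 2 / n) := by gcongr
                _ = c * (Real.pi / 2) := by field_simp
            gcongr
          · refine integral_mono (hF.integrable_exp _) (hF.integrable_exp _) fun z => ?_
            simp only [Real.exp_le_exp]
            refine mul_le_mul_of_nonneg_right ?_ (hF.nonneg z)
            have := Real.one_sub_sq_div_two_le_cos (x := Real.pi / 2 / n)
            calc c * n * (1 - Real.cos (Real.pi / 2 / n)) ≤ c * n * ((Real.pi / 2 / n) ^ 2 / 2) := by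
                  gcongr; linarith
              _ = Real.pi ^ 2 / 8 * (c / n) := by field_simp; ring
              _ ≤ 2 * (c / n) := by gcongr; linarith
              _ = 2 * c / n := by ring
  -- As the number of rotations grows, the leftover factor tends to `1`, dominated by `exp (2 c F)`.
  -- At `n = 0` the quotient is `0`, so the domination holds there too.
  have hlim : Tendsto (fun n : ℕ => Real.exp ((c * (Real.pi / 2)) ^ 2 / 2) *
      ∫ z, Real.exp (2 * c / n * F z) ∂γ) atTop
      (𝓝 (Real.exp ((c * (Real.pi / 2)) ^ 2 / 2) * ∫ _z, (1 : ℝ) ∂γ)) := by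
    refine Tendsto.const_mul _ ?_
    refine tendsto_integral_of_dominated_convergence (fun z => Real.exp (2 * c * F z))
      (fun n => by fun_prop) (hF.integrable_exp _) (fun n => ae_of_all _ fun z => ?_)
      (ae_of_all _ fun z => ?_)
    · rw [Real.norm_eq_abs, abs_of_pos (Real.exp_pos _), Real.exp_le_exp]
      refine mul_le_mul_of_nonneg_right ?_ (hF.nonneg z)
      rcases Nat.eq_zero_or_pos n with rfl | hn
      · simp; positivity
      · exact div_le_self (by positivity) (by exact_mod_cast hn)
    · have h0 : Tendsto (fun n : ℕ => 2 * c / n * F z) atTop (𝓝 0) := by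
        simpa using (tendsto_const_div_atTop_nhds_zero_nat (2 * c)).mul_const (F z)
      simpa [Function.comp_def] using (Real.continuous_exp.tendsto 0).comp h0
  have hle := ge_of_tendsto hlim (eventually_atTop.2 ⟨1, fun n h => hn n h⟩)
  simp only [integral_const, probReal_univ, smul_eq_mul, mul_one] at hle
  have := mul_le_mul_of_nonneg_right hle (Real.exp_pos (c * m)).le
  rw [mul_assoc, ← Real.exp_add, ← Real.exp_add] at this
  simpa [add_comm] using this

end Concentration

/-! ### The sparse projection norm and its Gaussian moments -/

section SparseNorm

variable {d p : ℕ}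

/-- The largest norm of a projection of `z` to the span of at most `k` of the vectors `v i`. -/
def sparseNorm (v : Fin p → Vec d) (k : ℕ) (z : Vec d) : ℝ :=
  ⨆ I : {I : Finset (Fin p) // I.card ≤ k},
    ‖(Submodule.span ℝ (v '' (I.1 : Set (Fin p)))).starProjection z‖

variable (v : Fin p → Vec d) (k : ℕ)

instance nonempty_card_le : Nonempty {I : Finset (Fin p) // I.card ≤ k} := ⟨⟨∅, by simp⟩⟩

theorem norm_starProjection_le_sparseNorm (I : {I : Finset (Fin p) // I.card ≤ k}) (z : Vec d) :
    ‖(Submodule.span ℝ (v '' (I.1 : Set (Fin p)))).starProjection z‖ ≤ sparseNorm v k z :=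
  le_ciSup (f := fun I : {I : Finset (Fin p) // I.card ≤ k} =>
    ‖(Submodule.span ℝ (v '' (I.1 : Set (Fin p)))).starProjection z‖)
    (Set.finite_range _).bddAbove I

theorem exists_sparseNorm_eq (z : Vec d) : ∃ I : {I : Finset (Fin p) // I.card ≤ k},
    sparseNorm v k z = ‖(Submodule.span ℝ (v '' (I.1 : Set (Fin p)))).starProjection z‖ := by
  obtain ⟨I, hI⟩ := exists_eq_ciSup_of_finite (f := fun I : {I : Finset (Fin p) // I.card ≤ k} =>
    ‖(Submodule.span ℝ (v '' (I.1 : Set (Fin p)))).starProjection z‖)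
  exact ⟨I, hI.symm⟩

theorem sparseNorm_nonneg (z : Vec d) : 0 ≤ sparseNorm v k z := by
  obtain ⟨I, hI⟩ := exists_sparseNorm_eq v k z
  rw [hI]; exact norm_nonneg _

/-- The norm of the projection to `V` is the maximum of `⟪u, z⟫` over the unit ball of `V`, so this
is the support function of a finite union of such balls. A subgradient at `z` is the normalised
projection of `z` to a maximising span, or `0` if that projection vanishes. -/
theorem isUnitSupportFunction_sparseNorm : IsUnitSupportFunction (sparseNorm v k) where
  measurable := by
    unfold sparseNorm
    exact Measurable.iSup fun I => by fun_prop
  nonneg := sparseNorm_nonneg v k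
  le_norm z := ciSup_le fun I => Submodule.norm_starProjection_apply_le _ z
  exists_subgradient z := by
    obtain ⟨I, hI⟩ := exists_sparseNorm_eq v k z
    set V := Submodule.span ℝ (v '' (I.1 : Set (Fin p)))
    rcases eq_or_ne (V.starProjection z) 0 with h0 | h0
    · refine ⟨0, by simp, by simp [hI, h0], fun z' => by simpa using sparseNorm_nonneg v k z'⟩
    · have hn : ‖V.starProjection z‖ ≠ 0 := norm_ne_zero_iff.2 h0
      have hu : ‖(‖V.starProjection z‖⁻¹ • V.starProjection z)‖ = 1 := by
        rw [norm_smul, norm_inv, norm_norm, inv_mul_cancel₀ hn]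
      have hmem : ‖V.starProjection z‖⁻¹ • V.starProjection z ∈ V :=
        V.smul_mem _ (Submodule.starProjection_apply_mem V z)
      have hproj : ∀ z', inner ℝ (‖V.starProjection z‖⁻¹ • V.starProjection z) z' =
          inner ℝ (‖V.starProjection z‖⁻¹ • V.starProjection z) (V.starProjection z') := by
        intro z'
        rw [← Submodule.inner_starProjection_left_eq_right,
          Submodule.starProjection_eq_self_iff.2 hmem]
      refine ⟨‖V.starProjection z‖⁻¹ • V.starProjection z, hu.le, ?_, fun z' => ?_⟩
      · rw [hproj, inner_smul_left, real_inner_self_eq_norm_sq, hI]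
        simp only [conj_trivial]
        field_simp
      · rw [hproj]
        refine (real_inner_le_norm _ _).trans ?_
        rw [hu, one_mul]
        exact norm_starProjection_le_sparseNorm v k I z'

theorem sparseNorm_sq (z : Vec d) : sparseNorm v k z ^ 2 =
    ⨆ I : {I : Finset (Fin p) // I.card ≤ k},
      ‖(Submodule.span ℝ (v '' (I.1 : Set (Fin p)))).starProjection z‖ ^ 2 := by
  refine le_antisymm ?_ (ciSup_le fun I => ?_)
  · obtain ⟨I, hI⟩ := exists_sparseNorm_eq v k z
    rw [hI]
    exact le_ciSup (f := fun I : {I : Finset (Fin p) // I.card ≤ k} =>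
      ‖(Submodule.span ℝ (v '' (I.1 : Set (Fin p)))).starProjection z‖ ^ 2)
      (Set.finite_range _).bddAbove I
  · exact pow_le_pow_left₀ (norm_nonneg _) (norm_starProjection_le_sparseNorm v k I z) 2

theorem effDim_eq : effDim v k = ∫ z, sparseNorm v k z ^ 2 ∂(stdGaussian (Vec d)) := by
  simp_rw [sparseNorm_sq]; rfl

theorem integrable_sq_norm_stdGaussian :
    Integrable (fun z : Vec d => ‖z‖ ^ 2) (stdGaussian (Vec d)) :=
  IsGaussian.memLp_two_id.integrable_norm_pow (by norm_num)

theorem integrable_sparseNorm_sq :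
    Integrable (fun z => sparseNorm v k z ^ 2) (stdGaussian (Vec d)) := by
  have h := isUnitSupportFunction_sparseNorm v k
  refine integrable_sq_norm_stdGaussian.mono'
    (h.measurable.pow_const 2).aestronglyMeasurable (ae_of_all _ fun z => ?_)
  rw [Real.norm_eq_abs, abs_of_nonneg (by positivity)]
  exact pow_le_pow_left₀ (h.nonneg z) (h.le_norm z) 2

theorem effDim_nonneg : 0 ≤ effDim v k := by
  rw [effDim_eq]; exact integral_nonneg fun z => by positivity

theorem integral_sparseNorm_le :
    ∫ z, sparseNorm v k z ∂(stdGaussian (Vec d)) ≤ Real.sqrt (effDim v k) := by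
  refine Real.le_sqrt_of_sq_le ?_
  rw [effDim_eq]
  exact (convexOn_pow 2).map_integral_le (μ := stdGaussian (Vec d)) (f := sparseNorm v k)
    (by fun_prop) isClosed_Ici (ae_of_all _ fun z => sparseNorm_nonneg v k z)
    (isUnitSupportFunction_sparseNorm v k).integrable (integrable_sparseNorm_sq v k)

theorem integral_inner_sq_stdGaussian {u : Vec d} (hu : ‖u‖ = 1) :
    ∫ z, (inner ℝ u z : ℝ) ^ 2 ∂(stdGaussian (Vec d)) = 1 := by
  have h := variance_dual_stdGaussian (E := Vec d) (innerSL ℝ u)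
  rw [variance_eq_integral (by fun_prop), integral_strongDual_stdGaussian] at h
  simpa [hu] using h

/-- A single unit vector `u` of an admissible span already contributes `E⟪u, z⟫² = 1`. This is what
absorbs the variance term `s²` of Maurey–Pisier into `s √h`. -/
theorem one_le_effDim {I : {I : Finset (Fin p) // I.card ≤ k}}
    (hI : Submodule.span ℝ (v '' (I.1 : Set (Fin p))) ≠ ⊥) : 1 ≤ effDim v k := by
  obtain ⟨x, hx, hx0⟩ := Submodule.exists_mem_ne_zero_of_ne_bot hI
  set V := Submodule.span ℝ (v '' (I.1 : Set (Fin p)))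
  have hu : ‖(‖x‖⁻¹ • x)‖ = 1 := by
    rw [norm_smul, norm_inv, norm_norm, inv_mul_cancel₀ (norm_ne_zero_iff.2 hx0)]
  have hmem : ‖x‖⁻¹ • x ∈ V := V.smul_mem _ hx
  rw [← integral_inner_sq_stdGaussian hu, effDim_eq]
  refine integral_mono_of_nonneg (ae_of_all _ fun z => by positivity)
    (integrable_sparseNorm_sq v k) (ae_of_all _ fun z => ?_)
  simp only
  rw [← sq_abs]
  refine pow_le_pow_left₀ (abs_nonneg _) ?_ 2
  calc |inner ℝ (‖x‖⁻¹ • x) z| = |inner ℝ (‖x‖⁻¹ • x) (V.starProjection z)| := by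
        rw [← Submodule.inner_starProjection_left_eq_right,
          Submodule.starProjection_eq_self_iff.2 hmem]
    _ ≤ ‖(‖x‖⁻¹ • x)‖ * ‖V.starProjection z‖ := abs_real_inner_le_norm _ _
    _ ≤ sparseNorm v k z := by
        rw [hu, one_mul]; exact norm_starProjection_le_sparseNorm v k I z

/-- If every admissible span is trivial the norm is zero. Otherwise, with `a = s √h` and `h ≥ 1`,
the Maurey–Pisier exponent is at most `a + 2 s² ≤ a + 2 a²`, and `3 a ≤ 1` brings it below `2 a`. -/
theorem integral_exp_sparseNorm_le {s : ℝ} (hs : 0 ≤ s)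
    (hsmall : 3 * (s * Real.sqrt (effDim v k)) ≤ 1) :
    ∫ z, Real.exp (s * sparseNorm v k z) ∂(stdGaussian (Vec d)) ≤
      Real.exp (2 * (s * Real.sqrt (effDim v k))) := by
  by_cases h : ∀ I : {I : Finset (Fin p) // I.card ≤ k},
      Submodule.span ℝ (v '' (I.1 : Set (Fin p))) = ⊥
  · have h0 : ∀ z, sparseNorm v k z = 0 := by
      intro z
      obtain ⟨I, hI⟩ := exists_sparseNorm_eq v k z
      rw [hI, h I]
      simp
    simp only [h0, mul_zero, Real.exp_zero, integral_const, probReal_univ, smul_eq_mul, mul_one]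
    exact Real.one_le_exp (by positivity)
  · push Not at h
    obtain ⟨I, hI⟩ := h
    have h1 := one_le_effDim v k hI
    have h2 : 1 ≤ Real.sqrt (effDim v k) := Real.one_le_sqrt.2 h1
    refine ((isUnitSupportFunction_sparseNorm v k).integral_exp_le hs).trans ?_
    rw [Real.exp_le_exp]
    have h3 := mul_le_mul_of_nonneg_left (integral_sparseNorm_le v k) hs
    have h4 : s ≤ s * Real.sqrt (effDim v k) := le_mul_of_one_le_right hs h2
    have hpi2 : (Real.pi / 2) ^ 2 ≤ 4 := by nlinarith [Real.pi_pos, Real.pi_le_four]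
    have h5 : (s * (Real.pi / 2)) ^ 2 ≤ 4 * s ^ 2 := by
      rw [mul_pow]; nlinarith [sq_nonneg s]
    nlinarith

theorem sparsity_le_iff {x : Vec d} : sparsity v x ≤ (k : ℕ∞) ↔
    ∃ I : Finset (Fin p), I.card ≤ k ∧ x ∈ Submodule.span ℝ (v '' (I : Set (Fin p))) := by
  refine ⟨fun hx => ?_, fun ⟨I, hc, hI⟩ => (iInf₂_le I hI).trans (by exact_mod_cast hc)⟩
  by_contra! hcon
  -- Cardinalities are integers: if no set of size at most `k` works, the infimum is at least `k +
  -- 1`.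
  have : ((k + 1 : ℕ) : ℕ∞) ≤ sparsity v x := by
    refine le_iInf₂ fun I hI => ?_
    by_contra! hlt
    have hlt' : I.card < k + 1 := by exact_mod_cast hlt
    exact hcon I (by omega) hI
  have := this.trans hx
  norm_cast at this
  omega

/-- Only the projection of `w` to the small span containing `x` is seen by the inner product; the
rest is Cauchy–Schwarz. -/
theorem abs_inner_le_sparseNorm_mul {w x : Vec d} (hx : sparsity v x ≤ (k : ℕ∞)) :
    |inner ℝ w x| ≤ sparseNorm v k w * ‖x‖ := by
  obtain ⟨I, hc, hI⟩ := (sparsity_le_iff v k).1 hx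
  rw [← Submodule.starProjection_eq_self_iff.2 hI, ← Submodule.inner_starProjection_left_eq_right,
    Submodule.starProjection_eq_self_iff.2 hI]
  refine (abs_real_inner_le_norm _ _).trans ?_
  gcongr
  exact norm_starProjection_le_sparseNorm v k ⟨I, hc⟩ w

theorem sparseNorm_smul (t : ℝ) (z : Vec d) : sparseNorm v k (t • z) = |t| * sparseNorm v k z := by
  simp only [sparseNorm, map_smul, norm_smul, Real.norm_eq_abs]
  rw [Real.mul_iSup_of_nonneg (abs_nonneg t)]

theorem measurableSet_sparsity_le (θ₀ : Vec d) :
    MeasurableSet {θ : Vec d | sparsity v (θ - θ₀) ≤ (k : ℕ∞)} := by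
  simp_rw [sparsity_le_iff, Set.ofPred_exists]
  refine MeasurableSet.iUnion fun I => (MeasurableSet.const _).inter ?_
  have := (Submodule.closed_of_finiteDimensional
    (Submodule.span ℝ (v '' (I : Set (Fin p))))).measurableSet
  exact this.preimage (f := fun θ : Vec d => θ - θ₀) (by fun_prop)

end SparseNorm

/-! ### Exchangeable laws -/

open Classical in
theorem pval_eq_card {𝒳 : Type*} {M : ℕ} (T : 𝒳 → ℝ) (y : Fin (M + 1) → 𝒳) :
    pval T (y 0) (fun m => y m.succ) =
      ((Finset.univ.filter fun i => T (y 0) ≤ T (y i)).card : ℝ) / ((M : ℝ) + 1) := by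
  rw [pval, Finset.card_filter, Fin.sum_univ_succ]
  simp
  ring

-- Among the counted indices take one, `j`, with the least `a j`. All counted indices `i` satisfy `a
-- j ≤ a i`, so there are no more of them than the rank of `j`, which is at most `t`. Ties only
-- enlarge ranks.
open Classical in
theorem card_small_rank_le {ι : Type*} [Fintype ι] (a : ι → ℝ) {t : ℝ} (ht : 0 ≤ t) :
    ((Finset.univ.filter fun j =>
      ((Finset.univ.filter fun i => a j ≤ a i).card : ℝ) ≤ t).card : ℝ) ≤ t := by
  set s := Finset.univ.filter fun j => ((Finset.univ.filter fun i => a j ≤ a i).card : ℝ) ≤ t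
    with hs
  rcases s.eq_empty_or_nonempty with h | h
  · simpa [h] using ht
  · obtain ⟨j, hj, hmin⟩ := s.exists_min_image a h
    have hj' : ((Finset.univ.filter fun i => a j ≤ a i).card : ℝ) ≤ t := by
      simpa [hs] using hj
    refine le_trans ?_ hj'
    exact_mod_cast Finset.card_le_card fun i hi => by simpa using hmin i hi

section Exchangeable

variable {𝒳 : Type*} [MeasurableSpace 𝒳] {n M : ℕ}

theorem measurable_comp_perm (π : Equiv.Perm (Fin n)) :
    Measurable fun y : Fin n → 𝒳 => y ∘ π :=
  measurable_pi_lambda _ fun i => measurable_pi_apply (π i)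

theorem measurable_cons :
    Measurable fun q : 𝒳 × (Fin M → 𝒳) => (Fin.cons q.1 q.2 : Fin (M + 1) → 𝒳) := by
  refine measurable_pi_lambda _ fun i => ?_
  refine Fin.cases ?_ (fun j => ?_) i
  · simpa using measurable_fst
  · simpa [Function.comp_def] using (measurable_pi_apply j).comp
      (measurable_snd : Measurable (Prod.snd : 𝒳 × (Fin M → 𝒳) → _))

theorem Exchangeable.measure_preimage {μ : Measure (Fin n → 𝒳)} (h : Exchangeable μ)
    (π : Equiv.Perm (Fin n)) {B : Set (Fin n → 𝒳)} (hB : MeasurableSet B) :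
    μ ((fun y => y ∘ π) ⁻¹' B) = μ B := by
  rw [← Measure.map_apply (measurable_comp_perm π) hB, h π]

theorem exchangeable_of_measure_preimage {μ : Measure (Fin n → 𝒳)}
    (h : ∀ (π : Equiv.Perm (Fin n)) (B : Set (Fin n → 𝒳)), MeasurableSet B →
      μ ((fun y => y ∘ π) ⁻¹' B) = μ B) : Exchangeable μ := fun π =>
  Measure.ext fun B hB => by rw [Measure.map_apply (measurable_comp_perm π) hB, h π B hB]

theorem Exchangeable.add {μ ν : Measure (Fin n → 𝒳)} (hμ : Exchangeable μ)
    (hν : Exchangeable ν) : Exchangeable (μ + ν) := fun π => by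
  rw [Measure.map_add _ _ (measurable_comp_perm π), hμ π, hν π]

theorem Exchangeable.smul {μ : Measure (Fin n → 𝒳)} (hμ : Exchangeable μ) (c : ℝ≥0∞) :
    Exchangeable (c • μ) := fun π => by
  rw [Measure.map_smul, hμ π]

theorem exchangeable_map_const {Ω : Type*} [MeasurableSpace Ω] (μ : Measure Ω) {X : Ω → 𝒳}
    (hX : Measurable X) : Exchangeable (μ.map fun ω (_ : Fin n) => X ω) := fun π => by
  rw [Measure.map_map (measurable_comp_perm π) (measurable_pi_lambda _ fun _ => hX)]
  rfl

/-- A mixture of exchangeable laws is exchangeable. -/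
theorem exchangeable_mixture {𝒯 : Type*} [MeasurableSpace 𝒯] (ν : Measure 𝒳) [SFinite ν]
    (Λ : Measure 𝒯) [SFinite Λ] {k : 𝒳 × 𝒯 → ℝ≥0∞} (hk : Measurable k)
    (Pt : Kernel (𝒳 × 𝒯) (Fin M → 𝒳)) [IsMarkovKernel Pt]
    (h : ∀ᵐ t ∂Λ, Exchangeable (((ν.withDensity fun x => k (x, t)) ⊗ₘ
      (Pt.comap (fun x : 𝒳 => (x, t)) (by fun_prop))).map
        fun q => (Fin.cons q.1 q.2 : Fin (M + 1) → 𝒳))) :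
    Exchangeable ((((ν.prod Λ).withDensity k) ⊗ₘ Pt).map
      fun q => (Fin.cons q.1.1 q.2 : Fin (M + 1) → 𝒳)) := by
  have hc : Measurable fun q : (𝒳 × 𝒯) × (Fin M → 𝒳) =>
      (Fin.cons q.1.1 q.2 : Fin (M + 1) → 𝒳) :=
    measurable_cons.comp (by fun_prop : Measurable fun q : (𝒳 × 𝒯) × (Fin M → 𝒳) => (q.1.1, q.2))
  -- Tonelli with `t` outermost: the mass of `B` is the integral over `t` of its masses under the
  -- slices, each of which is invariant under permutations.
  have key : ∀ B : Set (Fin (M + 1) → 𝒳), MeasurableSet B →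
      ((((ν.prod Λ).withDensity k) ⊗ₘ Pt).map
        fun q => (Fin.cons q.1.1 q.2 : Fin (M + 1) → 𝒳)) B =
      ∫⁻ t, (((ν.withDensity fun x => k (x, t)) ⊗ₘ
      (Pt.comap (fun x : 𝒳 => (x, t)) (by fun_prop))).map
        fun q => (Fin.cons q.1 q.2 : Fin (M + 1) → 𝒳)) B ∂Λ := by
    intro B hB
    rw [Measure.map_apply hc hB, Measure.compProd_apply (hc hB),
      lintegral_withDensity_eq_lintegral_mul _ hk (Kernel.measurable_kernel_prodMk_left (hc hB)),
      lintegral_prod_symm' _ (hk.mul (Kernel.measurable_kernel_prodMk_left (hc hB)))]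
    refine lintegral_congr fun t => ?_
    rw [Measure.map_apply measurable_cons hB, Measure.compProd_apply (measurable_cons hB),
      lintegral_withDensity_eq_lintegral_mul _ (by fun_prop)
        (Kernel.measurable_kernel_prodMk_left (measurable_cons hB))]
    rfl
  refine exchangeable_of_measure_preimage fun π B hB => ?_
  rw [key _ (measurable_comp_perm π hB), key _ hB]
  refine lintegral_congr_ae ?_
  filter_upwards [h] with t ht
  exact ht.measure_preimage π hB

/-- For probability measures a one-sided bound on all measurable sets is two-sided: apply it to the
complement. -/
theorem dExch_le {μ ν : Measure (Fin n → 𝒳)} [IsProbabilityMeasure μ] [IsProbabilityMeasure ν]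
    (hν : Exchangeable ν) {c : ℝ} (h : ∀ B, MeasurableSet B → μ.real B ≤ ν.real B + c) :
    dExch μ ≤ c := by
  have hbdd : BddBelow {t : ℝ | ∃ ν : Measure (Fin n → 𝒳),
      IsProbabilityMeasure ν ∧ Exchangeable ν ∧ t = dTV μ ν} := by
    refine ⟨0, ?_⟩
    rintro t ⟨ν, -, -, rfl⟩
    refine Real.sSup_nonneg ?_
    rintro t ⟨B, -, rfl⟩
    exact abs_nonneg _
  refine (csInf_le hbdd ⟨ν, inferInstance, hν, rfl⟩).trans ?_
  refine csSup_le ⟨_, ∅, MeasurableSet.empty, rfl⟩ ?_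
  rintro t ⟨B, hB, rfl⟩
  have h1 := h B hB
  have h2 := h Bᶜ hB.compl
  rw [probReal_compl_eq_one_sub hB, probReal_compl_eq_one_sub hB] at h2
  rw [abs_le]
  constructor <;> linarith

/-- Exchangeability gives each of the `M + 1` coordinates the same probability of having rank at
most `α (M + 1)`, and at most `α (M + 1)` coordinates can have such a rank at once. -/
theorem Exchangeable.measureReal_pval_le {μ : Measure (Fin (M + 1) → 𝒳)} [IsProbabilityMeasure μ]
    (hμ : Exchangeable μ) {T : 𝒳 → ℝ} (hT : Measurable T) {α : ℝ} (hα : 0 ≤ α) :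
    MeasurableSet {y : Fin (M + 1) → 𝒳 | pval T (y 0) (fun m => y m.succ) ≤ α} ∧
    μ.real {y | pval T (y 0) (fun m => y m.succ) ≤ α} ≤ α := by
  classical
  have hM : (0 : ℝ) < (M : ℝ) + 1 := by positivity
  set R : Fin (M + 1) → (Fin (M + 1) → 𝒳) → ℝ := fun j y =>
    ((Finset.univ.filter fun i => T (y j) ≤ T (y i)).card : ℝ) with hR
  have hRm : ∀ j, Measurable (R j) := by
    intro j
    have : R j = fun y => ∑ i, Set.indicator {y : Fin (M + 1) → 𝒳 | T (y j) ≤ T (y i)}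
        (fun _ => (1 : ℝ)) y := by
      ext y
      simp only [hR, Finset.card_filter, Set.indicator_apply, Set.mem_ofPred_eq]
      push_cast
      rfl
    rw [this]
    refine Finset.measurable_fun_sum _ fun i _ => measurable_const.indicator ?_
    exact measurableSet_le (hT.comp (measurable_pi_apply j)) (hT.comp (measurable_pi_apply i))
  set E : Fin (M + 1) → Set (Fin (M + 1) → 𝒳) := fun j => {y | R j y ≤ α * (M + 1)} with hE
  have hEm : ∀ j, MeasurableSet (E j) := fun j => measurableSet_le (hRm j) measurable_const
  have hE0 : {y : Fin (M + 1) → 𝒳 | pval T (y 0) (fun m => y m.succ) ≤ α} = E 0 := by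
    ext y
    simp only [Set.mem_ofPred_eq, hE, pval_eq_card, div_le_iff₀ hM]
    rfl
  have hswap : ∀ j, μ.real (E j) = μ.real (E 0) := by
    intro j
    have h1 := hμ.measure_preimage (Equiv.swap 0 j) (hEm 0)
    have h2 : (fun y : Fin (M + 1) → 𝒳 => y ∘ Equiv.swap 0 j) ⁻¹' E 0 = E j := by
      ext y
      simp only [Set.mem_preimage, hE, Set.mem_ofPred_eq, hR, Function.comp_apply,
        Equiv.swap_apply_left]
      have : (Finset.univ.filter fun i => T (y j) ≤ T (y (Equiv.swap 0 j i))).card =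
          (Finset.univ.filter fun i => T (y j) ≤ T (y i)).card :=
        Finset.card_bij (fun i _ => Equiv.swap 0 j i) (by simp) (by simp) fun b hb =>
          ⟨Equiv.swap 0 j b, by simpa using hb, by simp⟩
      rw [this]
    rw [h2] at h1
    simp [Measure.real, h1]
  rw [hE0]
  refine ⟨hEm 0, ?_⟩
  have hsum : ∑ j, μ.real (E j) ≤ α * (M + 1) := by
    have h1 : ∀ j, μ.real (E j) = ∫ y, (E j).indicator (fun _ => (1 : ℝ)) y ∂μ := by
      intro j
      rw [integral_indicator (hEm j)]
      simp
    simp_rw [h1]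
    rw [← integral_finsetSum _ fun j _ => (integrable_const (1 : ℝ)).indicator (hEm j)]
    calc ∫ y, ∑ j, (E j).indicator (fun _ => (1 : ℝ)) y ∂μ ≤ ∫ _y, α * (M + 1) ∂μ := by
          refine integral_mono (integrable_finsetSum _ fun j _ =>
            (integrable_const (1 : ℝ)).indicator (hEm j)) (integrable_const _) fun y => ?_
          have := card_small_rank_le (fun i => T (y i)) (t := α * (M + 1)) (by positivity)
          refine le_trans (le_of_eq ?_) this
          rw [Finset.card_filter]
          push_cast
          simp only [Set.indicator_apply, hE, hR, Set.mem_ofPred_eq]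
      _ = α * (M + 1) := by simp
  simp_rw [hswap] at hsum
  rw [Finset.sum_const, Finset.card_univ, Fintype.card_fin, nsmul_eq_mul] at hsum
  push_cast at hsum
  nlinarith

/-- A law which exceeds an exchangeable law by at most `c` is `c`-close to exchangeability, and its
p-values are valid up to `c`. -/
theorem dExch_le_and_pval_le {Ω : Type*} [MeasurableSpace Ω] (Pr : Measure Ω)
    [IsProbabilityMeasure Pr] {X : Ω → 𝒳} {Xt : Ω → Fin M → 𝒳} (hX : Measurable X)
    (hXt : Measurable Xt) {ν : Measure (Fin (M + 1) → 𝒳)} [IsProbabilityMeasure ν]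
    (hν : Exchangeable ν) {c : ℝ} (hc : ∀ B, MeasurableSet B →
      (Pr.map fun ω => (Fin.cons (X ω) (Xt ω) : Fin (M + 1) → 𝒳)).real B ≤ ν.real B + c) :
    dExch (Pr.map fun ω => (Fin.cons (X ω) (Xt ω) : Fin (M + 1) → 𝒳)) ≤ c ∧
      ∀ T : 𝒳 → ℝ, Measurable T → ∀ α ∈ Set.Icc (0 : ℝ) 1,
        Pr.real {ω | pval T (X ω) (Xt ω) ≤ α} ≤ α + c := by
  have hm : Measurable fun ω => (Fin.cons (X ω) (Xt ω) : Fin (M + 1) → 𝒳) :=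
    measurable_cons.comp (hX.prodMk hXt)
  have := Measure.isProbabilityMeasure_map (μ := Pr) hm.aemeasurable
  refine ⟨dExch_le hν hc, fun T hT α hα => ?_⟩
  obtain ⟨h1, h2⟩ := hν.measureReal_pval_le hT hα.1
  have h3 := hc _ h1
  rw [map_measureReal_apply hm h1] at h3
  refine le_trans h3 (by linarith)

end Exchangeable

/-! ### Total variation bounds for exponential tilts -/

section Tilt

variable {𝒳 𝒯 : Type*} [MeasurableSpace 𝒳] [MeasurableSpace 𝒯]

/-- The inequality `log y ≤ y - 1` at `y = e^u / z` gives `1 ≤ e^u / z + log z - u`, and `log z - u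
≤ β + log m`. Then `log m` is replaced by its tangent line at `K`, which is affine in `m` and so can
later be averaged without Jensen. -/
theorem one_le_tilt_real {u c β z m K : ℝ} (hz : 0 < z) (hm : 0 < m)
    (hzm : z ≤ Real.exp c * m) (hK : 0 < K) (hl : -β ≤ u - c) :
    1 ≤ Real.exp u / z + β + (Real.log K + m / K - 1) := by
  have h1 := Real.log_le_sub_one_of_pos (x := Real.exp u / z) (by positivity)
  rw [Real.log_div (Real.exp_pos _).ne' hz.ne', Real.log_exp] at h1
  have h2 : Real.log z ≤ c + Real.log m := by
    have := Real.log_le_log hz hzm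
    rwa [Real.log_mul (Real.exp_pos _).ne' hm.ne', Real.log_exp] at this
  have h3 := Real.log_le_sub_one_of_pos (x := m / K) (by positivity)
  rw [Real.log_div hm.ne' hK.ne'] at h3
  linarith

/-- The density of the normalised exponential tilt `e^u` of a finite measure exceeds
`1 - β - log E[e^α]`, when `u` is within `[c - β, c + α]`. -/
theorem one_le_tilt_add (η : Measure 𝒳) (h0 : η Set.univ ≠ 0) (hfin : η Set.univ ≠ ∞)
    {u α β : 𝒳 → ℝ} (hu : Measurable u) (hα : ∀ x, 0 ≤ α x)
    {c : ℝ} (h : ∀ᵐ x ∂η, -β x ≤ u x - c ∧ u x - c ≤ α x) {E : ℝ≥0∞}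
    (hE : ∫⁻ x, ENNReal.ofReal (Real.exp (α x)) ∂η = E) (hEfin : E ≠ ∞) {K : ℝ} (hK : 1 ≤ K)
    {Z : ℝ≥0∞} (hZ : ∫⁻ x, ENNReal.ofReal (Real.exp (u x)) ∂η = Z) :
    Z ≠ 0 ∧ Z ≠ ∞ ∧ 0 ≤ Real.log K + (E / η Set.univ).toReal / K - 1 ∧
      ∀ᵐ x ∂η, 1 ≤ ENNReal.ofReal (Real.exp (u x)) * (η Set.univ / Z) + ENNReal.ofReal (β x) +
        ENNReal.ofReal (Real.log K + (E / η Set.univ).toReal / K - 1) := by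
  have hZ0 : Z ≠ 0 := by
    rw [← hZ]
    intro hz
    rw [lintegral_eq_zero_iff (by fun_prop)] at hz
    apply h0
    rw [Measure.measure_univ_eq_zero, ← ae_eq_bot, ← Filter.eventually_false_iff_eq_bot]
    filter_upwards [hz] with x hx
    exact absurd (ENNReal.ofReal_eq_zero.1 hx) (not_le.2 (Real.exp_pos _))
  have hZE : Z ≤ ENNReal.ofReal (Real.exp c) * E := by
    rw [← hZ, ← hE, ← lintegral_const_mul' _ _ ENNReal.ofReal_ne_top]
    refine lintegral_mono_ae ?_
    filter_upwards [h] with x hx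
    rw [← ENNReal.ofReal_mul (Real.exp_pos _).le, ← Real.exp_add]
    exact ENNReal.ofReal_le_ofReal (Real.exp_le_exp.2 (by linarith [hx.2]))
  have hZfin : Z ≠ ∞ := ne_top_of_le_ne_top (ENNReal.mul_ne_top ENNReal.ofReal_ne_top hEfin) hZE
  have hEuniv : η Set.univ ≤ E := by
    rw [← hE, ← lintegral_one]
    refine lintegral_mono fun x => ?_
    rw [← ENNReal.ofReal_one]
    exact ENNReal.ofReal_le_ofReal (Real.one_le_exp (hα x))
  have hm1 : 1 ≤ (E / η Set.univ).toReal := by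
    rw [← ENNReal.toReal_one]
    refine ENNReal.toReal_mono (ENNReal.div_ne_top hEfin h0) ?_
    rw [ENNReal.le_div_iff_mul_le (Or.inl h0) (Or.inl hfin), one_mul]
    exact hEuniv
  have hz : 0 < (Z / η Set.univ).toReal :=
    ENNReal.toReal_pos (by simp [hZ0, hfin]) (ENNReal.div_ne_top hZfin h0)
  have hzm : (Z / η Set.univ).toReal ≤ Real.exp c * (E / η Set.univ).toReal := by
    rw [← ENNReal.toReal_ofReal (Real.exp_pos c).le, ← ENNReal.toReal_mul, ← mul_div_assoc]
    exact ENNReal.toReal_mono (ENNReal.div_ne_top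
      (ENNReal.mul_ne_top ENNReal.ofReal_ne_top hEfin) h0) (ENNReal.div_le_div_right hZE _)
  refine ⟨hZ0, hZfin, ?_, ?_⟩
  · have h3 := Real.log_le_sub_one_of_pos (x := (E / η Set.univ).toReal / K) (by positivity)
    rw [Real.log_div (by positivity) (by positivity)] at h3
    linarith [Real.log_nonneg hm1]
  · filter_upwards [h] with x hx
    have h1 := one_le_tilt_real (K := K) hz (by linarith) hzm (by linarith) hx.1
    have h2 : Real.exp (u x) / (Z / η Set.univ).toReal =
        (ENNReal.ofReal (Real.exp (u x)) * (η Set.univ / Z)).toReal := by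
      rw [ENNReal.toReal_mul, ENNReal.toReal_ofReal (Real.exp_pos _).le, ENNReal.toReal_div,
        ENNReal.toReal_div]
      field_simp
    rw [h2] at h1
    rw [← ENNReal.ofReal_one]
    refine (ENNReal.ofReal_le_ofReal h1).trans ?_
    refine ENNReal.ofReal_add_le.trans (add_le_add (ENNReal.ofReal_add_le.trans
      (add_le_add ?_ le_rfl)) le_rfl)
    exact ENNReal.ofReal_toReal_le

/-- Each slice of `j` is tilted by `e^u` and rescaled to its former mass, which keeps the marginal
in `t`. Since `j` may have mass below one, `hαK` counts the missing mass as if `α` were zero there.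
-/
theorem exists_tilted_density (ν : Measure 𝒳) [SFinite ν] (Λ : Measure 𝒯) [SFinite Λ]
    {j : 𝒳 × 𝒯 → ℝ≥0∞} (hj : Measurable j) {u α β : 𝒳 × 𝒯 → ℝ} (hu : Measurable u)
    (hα : Measurable α) (hβ : Measurable β) (hα0 : ∀ q, 0 ≤ α q)
    (h : ∀ t, ∃ c, ∀ᵐ x ∂ν, j (x, t) ≠ 0 → -β (x, t) ≤ u (x, t) - c ∧ u (x, t) - c ≤ α (x, t))
    (hj1 : ∫⁻ q, j q ∂(ν.prod Λ) ≤ 1) {K : ℝ} (hK : 1 ≤ K)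
    (hαK : ∫⁻ q, ENNReal.ofReal (Real.exp (α q)) * j q ∂(ν.prod Λ) +
      (1 - ∫⁻ q, j q ∂(ν.prod Λ)) ≤ ENNReal.ofReal K) :
    ∃ k : 𝒳 × 𝒯 → ℝ≥0∞, Measurable k ∧
      (∀ᵐ t ∂Λ, (∀ᵐ x ∂ν, k (x, t) = 0) ∨
        ∃ C : ℝ≥0∞, (∀ x, k (x, t) = C * (j (x, t) * ENNReal.ofReal (Real.exp (u (x, t))))) ∧
          ∫⁻ x, j (x, t) * ENNReal.ofReal (Real.exp (u (x, t))) ∂ν ≠ 0 ∧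
          ∫⁻ x, j (x, t) * ENNReal.ofReal (Real.exp (u (x, t))) ∂ν ≠ ∞) ∧
      ∫⁻ q, k q ∂(ν.prod Λ) = ∫⁻ q, j q ∂(ν.prod Λ) ∧
      ∀ φ : 𝒳 × 𝒯 → ℝ≥0∞, Measurable φ → (∀ q, φ q ≤ 1) →
        ∫⁻ q, j q * φ q ∂(ν.prod Λ) ≤ ∫⁻ q, k q * φ q ∂(ν.prod Λ) +
          (∫⁻ q, ENNReal.ofReal (β q) * j q ∂(ν.prod Λ) + ENNReal.ofReal (Real.log K)) := by
  have hexpu : Measurable fun q => j q * ENNReal.ofReal (Real.exp (u q)) := by fun_prop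
  have hexpα : Measurable fun q => ENNReal.ofReal (Real.exp (α q)) * j q := by fun_prop
  set Z₀ : 𝒯 → ℝ≥0∞ := fun t => ∫⁻ x, j (x, t) ∂ν with hZ₀
  set Z : 𝒯 → ℝ≥0∞ := fun t => ∫⁻ x, j (x, t) * ENNReal.ofReal (Real.exp (u (x, t))) ∂ν with hZ
  set E : 𝒯 → ℝ≥0∞ := fun t => ∫⁻ x, ENNReal.ofReal (Real.exp (α (x, t))) * j (x, t) ∂ν with hE
  have hZ₀m : Measurable Z₀ := hj.lintegral_prod_left'
  have hZm : Measurable Z := hexpu.lintegral_prod_left'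
  have hEm : Measurable E := hexpα.lintegral_prod_left'
  have hjsum : ∫⁻ q, j q ∂(ν.prod Λ) = ∫⁻ t, Z₀ t ∂Λ := lintegral_prod_symm' _ hj
  have hEsum : ∫⁻ q, ENNReal.ofReal (Real.exp (α q)) * j q ∂(ν.prod Λ) = ∫⁻ t, E t ∂Λ :=
    lintegral_prod_symm' _ hexpα
  have hZ₀fin : ∀ᵐ t ∂Λ, Z₀ t ≠ ∞ := by
    have : ∫⁻ t, Z₀ t ∂Λ ≠ ∞ := ne_top_of_le_ne_top ENNReal.one_ne_top (hjsum ▸ hj1)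
    exact (ae_lt_top hZ₀m this).mono fun t ht => ht.ne
  have hEfin : ∀ᵐ t ∂Λ, E t ≠ ∞ := by
    have : ∫⁻ t, E t ∂Λ ≠ ∞ := by
      rw [← hEsum]
      exact ne_top_of_le_ne_top ENNReal.ofReal_ne_top (le_self_add.trans hαK)
    exact (ae_lt_top hEm this).mono fun t ht => ht.ne
  -- The loss due to the normalising constant of the slice: the tangent line at `K` to `log`, taken
  -- at the conditional mean of `e^α`.
  set ℓ : 𝒯 → ℝ≥0∞ := fun t =>
    ENNReal.ofReal (Real.log K + (E t / Z₀ t).toReal / K - 1) with hℓ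
  have hℓm : Measurable ℓ := by fun_prop
  set k : 𝒳 × 𝒯 → ℝ≥0∞ := fun q =>
    Z₀ q.2 / Z q.2 * (j q * ENNReal.ofReal (Real.exp (u q))) with hk
  have hkm : Measurable k := by fun_prop
  have hzero : ∀ t, Z₀ t = 0 → ∀ᵐ x ∂ν, j (x, t) = 0 := fun t ht =>
    (lintegral_eq_zero_iff (by fun_prop)).1 ht
  -- A slice of mass zero cannot be normalised; there `k` vanishes by its factor `Z₀` and `j`
  -- vanishes almost everywhere, so nothing is lost.
  have hmain : ∀ᵐ t ∂Λ, Z₀ t = 0 ∨ (Z₀ t ≠ 0 ∧ Z t ≠ 0 ∧ Z t ≠ ∞ ∧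
      0 ≤ Real.log K + (E t / Z₀ t).toReal / K - 1 ∧
      ∀ᵐ x ∂ν, j (x, t) ≤ k (x, t) + ENNReal.ofReal (β (x, t)) * j (x, t) + ℓ t * j (x, t)) := by
    filter_upwards [hZ₀fin, hEfin] with t h1 h2
    rcases eq_or_ne (Z₀ t) 0 with h0 | h0
    · exact Or.inl h0
    right
    obtain ⟨c, hc⟩ := h t
    set η : Measure 𝒳 := ν.withDensity fun x => j (x, t) with hη
    have hjt : Measurable fun x => j (x, t) := by fun_prop
    have hηuniv : η Set.univ = Z₀ t := by
      rw [hη, withDensity_apply _ MeasurableSet.univ, Measure.restrict_univ]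
    have := one_le_tilt_add η (u := fun x => u (x, t)) (α := fun x => α (x, t))
      (β := fun x => β (x, t)) (c := c) (E := E t) (Z := Z t) (by rwa [hηuniv]) (by rwa [hηuniv])
      (by fun_prop) (fun x => hα0 _) ((ae_withDensity_iff hjt).2 hc)
      (by
        rw [hη, lintegral_withDensity_eq_lintegral_mul _ hjt (by fun_prop)]
        exact lintegral_congr fun x => mul_comm _ _) h2 hK
      (by rw [hη, lintegral_withDensity_eq_lintegral_mul _ hjt (by fun_prop)]; rfl)
    rw [hηuniv] at this
    refine ⟨h0, this.1, this.2.1, this.2.2.1, ?_⟩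
    filter_upwards [(ae_withDensity_iff hjt).1 this.2.2.2] with x hx
    rcases eq_or_ne (j (x, t)) 0 with hj0 | hj0
    · simp [hj0]
    · have := mul_le_mul_left (hx hj0) (j (x, t))
      rw [one_mul, add_mul, add_mul] at this
      refine this.trans (le_of_eq ?_)
      simp only [hk, hℓ]
      ring
  have hksum : ∀ᵐ t ∂Λ, ∫⁻ x, k (x, t) ∂ν = Z₀ t := by
    filter_upwards [hmain] with t ht
    rcases ht with h0 | ⟨h0, h1, h2, -, -⟩
    · simp [hk, h0]
    · simp only [hk]
      rw [lintegral_const_mul _ (by fun_prop)]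
      exact ENNReal.div_mul_cancel h1 h2
  refine ⟨k, hkm, ?_, ?_, ?_⟩
  · filter_upwards [hmain] with t ht
    rcases ht with h0 | ⟨h0, h1, h2, -, -⟩
    · left
      exact ae_of_all _ fun x => by simp [hk, h0]
    · right
      exact ⟨Z₀ t / Z t, fun x => rfl, h1, h2⟩
  · rw [hjsum, lintegral_prod_symm' _ hkm]
    exact lintegral_congr_ae hksum
  · intro φ hφ hφ1
    -- With `ρ` the mass of `j`, the average is at most `ρ log K + (K - (1 - ρ)) / K - ρ = ρ log K +
    -- (1 - ρ)(1 - 1 / K)`, and `1 - 1 / K ≤ log K`.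
    have hℓint : ∫⁻ t, ℓ t * Z₀ t ∂Λ ≤ ENNReal.ofReal (Real.log K) := by
      set ρ := ∫⁻ t, Z₀ t ∂Λ with hρ
      have hρ1 : ρ ≤ 1 := hjsum ▸ hj1
      have hK0 : 0 < K := by linarith
      -- Adding `Z₀` to both sides avoids truncated subtraction.
      have h1 : ∫⁻ t, (ℓ t * Z₀ t + Z₀ t) ∂Λ ≤
          ∫⁻ t, (ENNReal.ofReal (Real.log K) * Z₀ t + ENNReal.ofReal K⁻¹ * E t) ∂Λ := by
        refine lintegral_mono_ae ?_
        filter_upwards [hmain, hZ₀fin, hEfin] with t ht hf1 hf2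
        rcases ht with h0 | ⟨h0, -, -, hnn, -⟩
        · simp [h0]
        · have e1 : ℓ t + 1 = ENNReal.ofReal (Real.log K) +
              ENNReal.ofReal K⁻¹ * (E t / Z₀ t) := by
            rw [hℓ, ← ENNReal.ofReal_one, ← ENNReal.ofReal_add hnn zero_le_one, sub_add_cancel,
              ENNReal.ofReal_add (Real.log_nonneg hK) (by positivity), div_eq_inv_mul _ K,
              ENNReal.ofReal_mul (by positivity),
              ENNReal.ofReal_toReal (ENNReal.div_ne_top hf2 h0)]
          calc ℓ t * Z₀ t + Z₀ t = (ℓ t + 1) * Z₀ t := by ring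
            _ = ENNReal.ofReal (Real.log K) * Z₀ t + ENNReal.ofReal K⁻¹ * (E t / Z₀ t * Z₀ t) := by
                rw [e1]; ring
            _ ≤ _ := by rw [ENNReal.div_mul_cancel h0 hf1]
      rw [lintegral_add_left (by fun_prop), lintegral_add_left (by fun_prop),
        lintegral_const_mul _ hZ₀m, lintegral_const_mul _ hEm] at h1
      rw [hEsum, hjsum] at hαK
      have hρfin : ρ ≠ ∞ := ne_top_of_le_ne_top ENNReal.one_ne_top hρ1
      have hEKfin : ∫⁻ t, E t ∂Λ ≠ ∞ :=
        ne_top_of_le_ne_top ENNReal.ofReal_ne_top (le_self_add.trans hαK)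
      have hLfin : ∫⁻ t, ℓ t * Z₀ t ∂Λ ≠ ∞ := by
        refine ne_top_of_le_ne_top ?_ (le_self_add.trans h1)
        exact ENNReal.add_ne_top.2 ⟨ENNReal.mul_ne_top ENNReal.ofReal_ne_top hρfin,
          ENNReal.mul_ne_top ENNReal.ofReal_ne_top hEKfin⟩
      have h2 := ENNReal.toReal_mono (ENNReal.add_ne_top.2
        ⟨ENNReal.mul_ne_top ENNReal.ofReal_ne_top hρfin,
          ENNReal.mul_ne_top ENNReal.ofReal_ne_top hEKfin⟩) h1
      have h3 := ENNReal.toReal_mono ENNReal.ofReal_ne_top hαK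
      rw [ENNReal.toReal_add hLfin hρfin, ENNReal.toReal_add
        (ENNReal.mul_ne_top ENNReal.ofReal_ne_top hρfin)
        (ENNReal.mul_ne_top ENNReal.ofReal_ne_top hEKfin), ENNReal.toReal_mul, ENNReal.toReal_mul,
        ENNReal.toReal_ofReal (Real.log_nonneg hK), ENNReal.toReal_ofReal (by positivity)] at h2
      rw [ENNReal.toReal_add hEKfin (by simp), ENNReal.toReal_ofReal hK0.le,
        ENNReal.toReal_sub_of_le hρ1 ENNReal.one_ne_top, ENNReal.toReal_one] at h3
      have h4 : ρ.toReal ≤ 1 := by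
        simpa using ENNReal.toReal_mono ENNReal.one_ne_top hρ1
      rw [← ENNReal.ofReal_toReal hLfin]
      refine ENNReal.ofReal_le_ofReal ?_
      have h5 := Real.one_sub_inv_le_log_of_pos hK0
      have h6 : K⁻¹ * (∫⁻ t, E t ∂Λ).toReal ≤ 1 - K⁻¹ * (1 - ρ.toReal) := by
        have := mul_le_mul_of_nonneg_left h3 (inv_nonneg.2 hK0.le)
        rw [mul_add, inv_mul_cancel₀ hK0.ne'] at this
        linarith
      nlinarith
    have hβm : Measurable fun q => ENNReal.ofReal (β q) * j q := by fun_prop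
    have hjφ : Measurable fun q => j q * φ q := hj.mul hφ
    have hkφ : Measurable fun q => k q * φ q := hkm.mul hφ
    rw [lintegral_prod_symm' _ hjφ, lintegral_prod_symm' _ hkφ, lintegral_prod_symm' _ hβm]
    calc ∫⁻ t, ∫⁻ x, j (x, t) * φ (x, t) ∂ν ∂Λ
        ≤ ∫⁻ t, (∫⁻ x, k (x, t) * φ (x, t) ∂ν +
            (∫⁻ x, ENNReal.ofReal (β (x, t)) * j (x, t) ∂ν + ℓ t * Z₀ t)) ∂Λ := by
          refine lintegral_mono_ae ?_
          filter_upwards [hmain] with t ht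
          rcases ht with h0 | ⟨-, -, -, -, hx⟩
          · have : ∫⁻ x, j (x, t) * φ (x, t) ∂ν = 0 := by
              rw [lintegral_eq_zero_iff (by fun_prop)]
              filter_upwards [hzero t h0] with x hx
              simp [hx]
            rw [this]; exact zero_le
          · rw [hZ₀, ← lintegral_const_mul _ (by fun_prop), ← lintegral_add_left (by fun_prop),
              ← lintegral_add_left (by fun_prop)]
            refine lintegral_mono_ae ?_
            filter_upwards [hx] with x hx
            calc j (x, t) * φ (x, t) ≤ (k (x, t) + ENNReal.ofReal (β (x, t)) * j (x, t) +
                  ℓ t * j (x, t)) * φ (x, t) := by gcongr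
              _ = k (x, t) * φ (x, t) + (ENNReal.ofReal (β (x, t)) * j (x, t) +
                  ℓ t * j (x, t)) * φ (x, t) := by ring
              _ ≤ _ := by
                  gcongr
                  exact mul_le_of_le_one_right' (hφ1 _)
      _ ≤ _ := by
          have m1 : Measurable fun t => ∫⁻ x, k (x, t) * φ (x, t) ∂ν :=
            (hkm.mul hφ).lintegral_prod_left'
          have m2 : Measurable fun t => ∫⁻ x, ENNReal.ofReal (β (x, t)) * j (x, t) ∂ν :=
            hβm.lintegral_prod_left'
          rw [lintegral_add_left m1, lintegral_add_left m2]
          gcongr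

end Tilt

/-! ### Measurability of derivatives with respect to a parameter -/

section ParamMeasurability

variable {𝒳 : Type*} [MeasurableSpace 𝒳] {d : ℕ} {Θ : Set (Vec d)}

/-- Joint measurability of a function of `(x, θ)` for `θ` in `Θ`. -/
def MeasurableParamOn (G : 𝒳 → Vec d → ℝ) (Θ : Set (Vec d)) : Prop :=
  Measurable fun q : 𝒳 × Vec d => Θ.indicator (G q.1) q.2

theorem measurableParamOn_of_continuousOn {G : 𝒳 → Vec d → ℝ} (hΘ : MeasurableSet Θ)
    (hm : ∀ θ ∈ Θ, Measurable fun x => G x θ) (hc : ∀ x, ContinuousOn (G x) Θ) :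
    MeasurableParamOn G Θ := by
  classical
  rcases Θ.eq_empty_or_nonempty with rfl | ⟨θ₀, hθ₀⟩
  · simp [MeasurableParamOn]
  have h1 : Measurable (Function.uncurry fun (θ : Θ) (x : 𝒳) => G x θ) :=
    measurable_uncurry_of_continuous_of_measurable
      (fun x => continuousOn_iff_continuous_domRestrict.1 (hc x)) (fun θ => hm θ θ.2)
  -- Parameters outside `Θ` are sent to an arbitrary point of `Θ`; the indicator discards these
  -- values.
  set e : Vec d → Θ := fun θ => ⟨if θ ∈ Θ then θ else θ₀, by split_ifs <;> assumption⟩ with he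
  have hem : Measurable e :=
    Measurable.subtype_mk (Measurable.ite hΘ measurable_id measurable_const)
  have h2 : Measurable fun q : 𝒳 × Vec d => G q.1 (e q.2) :=
    h1.comp ((hem.comp measurable_snd).prodMk measurable_fst)
  have h3 : (fun q : 𝒳 × Vec d => Θ.indicator (G q.1) q.2) =
      (Prod.snd ⁻¹' Θ).indicator fun q : 𝒳 × Vec d => G q.1 (e q.2) := by
    ext q
    by_cases hq : q.2 ∈ Θ
    · simp [Set.indicator, hq, he]
    · simp [Set.indicator, hq]
  rw [MeasurableParamOn, h3]
  exact h2.indicator (measurable_snd hΘ)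

theorem MeasurableParamOn.congr {G G' : 𝒳 → Vec d → ℝ} (h : MeasurableParamOn G Θ)
    (hG : ∀ x, ∀ θ ∈ Θ, G x θ = G' x θ) : MeasurableParamOn G' Θ := by
  have : (fun q : 𝒳 × Vec d => Θ.indicator (G' q.1) q.2) = fun q => Θ.indicator (G q.1) q.2 := by
    ext q
    by_cases hq : q.2 ∈ Θ
    · simp [Set.indicator, hq, hG]
    · simp [Set.indicator, hq]
  rw [MeasurableParamOn, this]
  exact h

/-- A directional derivative is the limit of difference quotients with step `1 / (n + 1)`. As `Θ` is
open, the displaced point is eventually in `Θ`, where the indicator agrees with `G`. -/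
theorem MeasurableParamOn.fderiv {G : 𝒳 → Vec d → ℝ} (h : MeasurableParamOn G Θ)
    (hΘ : IsOpen Θ) (hd : ∀ x, ∀ θ ∈ Θ, DifferentiableAt ℝ (G x) θ) (e : Vec d) :
    MeasurableParamOn (fun x θ => fderiv ℝ (G x) θ e) Θ := by
  set T : Set (𝒳 × Vec d) := Prod.snd ⁻¹' Θ
  have hT : MeasurableSet T := measurable_snd hΘ.measurableSet
  refine measurable_of_tendsto_metrizable (f := fun (n : ℕ) (q : 𝒳 × Vec d) => T.indicator
    (fun q => ((n : ℝ) + 1) * (Θ.indicator (G q.1) (q.2 + ((n : ℝ) + 1)⁻¹ • e) -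
      Θ.indicator (G q.1) q.2)) q) (fun n => ?_) ?_
  · refine Measurable.indicator ?_ hT
    have : Measurable fun q : 𝒳 × Vec d => Θ.indicator (G q.1) (q.2 + ((n : ℝ) + 1)⁻¹ • e) :=
      h.comp (by fun_prop :
        Measurable fun q : 𝒳 × Vec d => (q.1, q.2 + ((n : ℝ) + 1)⁻¹ • e))
    exact measurable_const.mul (this.sub h)
  · rw [tendsto_pi_nhds]
    rintro ⟨x, θ⟩
    by_cases hθ : θ ∈ Θ
    · have hmem : (x, θ) ∈ T := hθ
      simp only [Set.indicator_of_mem hmem, Set.indicator_of_mem hθ]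
      have hlim : Tendsto (fun n : ℕ => ((n : ℝ) + 1)⁻¹) atTop (𝓝 0) := by
        simpa [one_div] using tendsto_one_div_add_atTop_nhds_zero_nat (𝕜 := ℝ)
      have hder := (hd x θ hθ).hasFDerivAt.lim_real e |>.comp
        (tendsto_natCast_atTop_atTop.atTop_add (tendsto_const_nhds (x := (1 : ℝ))))
      refine hder.congr' ?_
      have hin : ∀ᶠ n : ℕ in atTop, θ + ((n : ℝ) + 1)⁻¹ • e ∈ Θ := by
        have : Tendsto (fun n : ℕ => θ + ((n : ℝ) + 1)⁻¹ • e) atTop (𝓝 θ) := by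
          simpa using tendsto_const_nhds.add (hlim.smul_const e)
        exact this.eventually (hΘ.mem_nhds hθ)
      filter_upwards [hin] with n hn
      simp [Set.indicator_of_mem hn]
    · have hmem : (x, θ) ∉ T := hθ
      simp [Set.indicator_of_notMem hmem, Set.indicator_of_notMem hθ]

theorem MeasurableParamOn.measurable_left {G : 𝒳 → Vec d → ℝ} (h : MeasurableParamOn G Θ)
    {θ : Vec d} (hθ : θ ∈ Θ) : Measurable fun x => G x θ := by
  have : Measurable fun x => Θ.indicator (G x) θ := h.comp (by fun_prop : Measurable fun x => (x, θ))
  simpa [Set.indicator_of_mem hθ] using this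

end ParamMeasurability

/-! ### Hessians -/

section Hessian

variable {d : ℕ}

theorem gradient_apply (F : Vec d → ℝ) (θ : Vec d) (i : Fin d) :
    gradient F θ i = fderiv ℝ F θ (EuclideanSpace.single i 1) := by
  rw [← inner_gradient_left, EuclideanSpace.inner_single_right]
  simp

theorem vec_eq_sum (v : Vec d) : v = ∑ i, v i • EuclideanSpace.single i (1 : ℝ) := by
  have := (EuclideanSpace.basisFun (Fin d) ℝ).sum_repr v
  simpa using this.symm

theorem fderiv_fderiv_apply_eq (F : Vec d → ℝ) (θ u v : Vec d) :
    fderiv ℝ (fderiv ℝ F) θ u v = u.ofLp ⬝ᵥ (hessian F θ *ᵥ v.ofLp) := by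
  conv_lhs => rw [vec_eq_sum u, vec_eq_sum v]
  simp only [map_sum, map_smul, sum_apply, smul_apply,
    smul_eq_mul, dotProduct, Matrix.mulVec, hessian, Matrix.of_apply, Finset.mul_sum]
  rw [Finset.sum_comm]
  refine Finset.sum_congr rfl fun i _ => Finset.sum_congr rfl fun j _ => ?_
  ring

theorem hessian_isHermitian {F : Vec d → ℝ} {θ : Vec d}
    (h1 : ∀ᶠ t in 𝓝 θ, DifferentiableAt ℝ F t) (h2 : DifferentiableAt ℝ (fderiv ℝ F) θ) :
    (hessian F θ).IsHermitian := by
  refine Matrix.IsHermitian.ext fun i j => ?_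
  simp only [hessian, Matrix.of_apply, star_trivial]
  exact second_derivative_symmetric_of_eventually (h1.mono fun t ht => ht.hasFDerivAt)
    h2.hasFDerivAt _ _

/-- Expand `v` in an orthonormal eigenbasis. The positive part is what allows `‖v‖` to be smaller
than `r`. -/
theorem le_lambdaMax_mul {A : Matrix (Fin d) (Fin d) ℝ} (hA : A.IsHermitian) {r : ℝ} {v : Vec d}
    (hv : ‖v‖ ≤ r) : v.ofLp ⬝ᵥ (A *ᵥ v.ofLp) ≤ r ^ 2 * max (lambdaMax A) 0 := by
  have hspec : ∀ i, hA.eigenvalues i ≤ lambdaMax A := fun i =>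
    le_csSup (Matrix.finite_real_spectrum (A := A)).bddAbove (hA.eigenvalues_mem_spectrum_real i)
  have key : v.ofLp ⬝ᵥ (A *ᵥ v.ofLp) = ∑ i, hA.eigenvalues i * (hA.eigenvectorBasis.repr v i) ^ 2 := by
    have hsum := hA.eigenvectorBasis.sum_repr v
    have e1 : v.ofLp ⬝ᵥ (A *ᵥ v.ofLp) = inner ℝ v (Matrix.toEuclideanLin A v) := by
      simp [PiLp.inner_apply, dotProduct, Matrix.toEuclideanLin, mul_comm]
    rw [e1]
    have e2 : Matrix.toEuclideanLin A v =
        ∑ i, (hA.eigenvalues i * hA.eigenvectorBasis.repr v i) • hA.eigenvectorBasis i := by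
      conv_lhs => rw [← hsum]
      rw [map_sum]
      refine Finset.sum_congr rfl fun i _ => ?_
      rw [map_smul]
      have : Matrix.toEuclideanLin A (hA.eigenvectorBasis i) =
          hA.eigenvalues i • hA.eigenvectorBasis i := by
        ext j
        simpa [Matrix.toEuclideanLin] using congrFun (hA.mulVec_eigenvectorBasis i) j
      rw [this, smul_smul, mul_comm]
    rw [e2, inner_sum]
    refine Finset.sum_congr rfl fun i _ => ?_
    rw [inner_smul_right, real_inner_comm, ← OrthonormalBasis.repr_apply_apply]
    ring
  have hnorm : ∑ i, (hA.eigenvectorBasis.repr v i) ^ 2 = ‖v‖ ^ 2 := by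
    rw [← LinearIsometryEquiv.norm_map hA.eigenvectorBasis.repr v, EuclideanSpace.norm_sq_eq]
    simp
  rw [key]
  calc ∑ i, hA.eigenvalues i * (hA.eigenvectorBasis.repr v i) ^ 2
      ≤ ∑ i, max (lambdaMax A) 0 * (hA.eigenvectorBasis.repr v i) ^ 2 := by
        refine Finset.sum_le_sum fun i _ => ?_
        exact mul_le_mul_of_nonneg_right ((hspec i).trans (le_max_left _ _)) (sq_nonneg _)
    _ = max (lambdaMax A) 0 * ‖v‖ ^ 2 := by rw [← Finset.mul_sum, hnorm]
    _ ≤ r ^ 2 * max (lambdaMax A) 0 := by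
        rw [mul_comm]
        gcongr

end Hessian

namespace Setup

variable {𝒳 : Type*} [MeasurableSpace 𝒳] {d c : ℕ} {S : Setup 𝒳 d c}

/-! ### Regularity of the objective -/

section Regularity

theorem Regular.contDiffAt_L (hreg : S.Regular) (x : 𝒳) {θ : Vec d} (hθ : θ ∈ S.Θ) :
    ContDiffAt ℝ 2 (S.L x) θ :=
  (hreg.contDiffOn_L x).contDiffAt (hreg.isOpen.mem_nhds hθ)

theorem Regular.differentiableAt_L (hreg : S.Regular) (x : 𝒳) {θ : Vec d} (hθ : θ ∈ S.Θ) :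
    DifferentiableAt ℝ (S.L x) θ :=
  (hreg.contDiffAt_L x hθ).differentiableAt (by norm_num)

theorem Regular.contDiffAt_fderiv_L (hreg : S.Regular) (x : 𝒳) {θ : Vec d} (hθ : θ ∈ S.Θ) :
    ContDiffAt ℝ 1 (fderiv ℝ (S.L x)) θ :=
  (hreg.contDiffAt_L x hθ).fderiv_right (by norm_num)

theorem Regular.differentiableAt_fderiv_L (hreg : S.Regular) (x : 𝒳) {θ : Vec d}
    (hθ : θ ∈ S.Θ) : DifferentiableAt ℝ (fderiv ℝ (S.L x)) θ :=
  (hreg.contDiffAt_fderiv_L x hθ).differentiableAt (by norm_num)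

theorem Regular.continuousAt_fderiv_fderiv_L (hreg : S.Regular) (x : 𝒳) {θ : Vec d}
    (hθ : θ ∈ S.Θ) : ContinuousAt (fderiv ℝ (fderiv ℝ (S.L x))) θ :=
  ((hreg.contDiffAt_fderiv_L x hθ).fderiv_right (m := 0) (by norm_num)).continuousAt

theorem Regular.eventually_differentiableAt_L (hreg : S.Regular) (x : 𝒳) {θ : Vec d}
    (hθ : θ ∈ S.Θ) : ∀ᶠ t in 𝓝 θ, DifferentiableAt ℝ (S.L x) t :=
  Filter.mem_of_superset (hreg.isOpen.mem_nhds hθ) fun _ ht => hreg.differentiableAt_L x ht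

theorem fderiv_Lw (hreg : S.Regular) (x : 𝒳) (w : Vec d) {θ : Vec d} (hθ : θ ∈ S.Θ) :
    fderiv ℝ (S.Lw x w) θ = fderiv ℝ (S.L x) θ + S.σ • innerSL ℝ w := by
  have h : HasFDerivAt (S.Lw x w) (fderiv ℝ (S.L x) θ + S.σ • innerSL ℝ w) θ :=
    (hreg.differentiableAt_L x hθ).hasFDerivAt.add ((innerSL ℝ w).hasFDerivAt.const_mul S.σ)
  exact h.fderiv

theorem gradient_Lw (hreg : S.Regular) (x : 𝒳) (w : Vec d) {θ : Vec d} (hθ : θ ∈ S.Θ) :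
    gradient (S.Lw x w) θ = gradient (S.L x) θ + S.σ • w := by
  ext i
  simp only [PiLp.add_apply, PiLp.smul_apply, gradient_apply, fderiv_Lw hreg x w hθ, add_apply,
    smul_apply, innerSL_apply_apply, EuclideanSpace.inner_single_right, conj_trivial, one_mul]

theorem hessian_Lw (hreg : S.Regular) (x : 𝒳) (w : Vec d) {θ : Vec d} (hθ : θ ∈ S.Θ) :
    hessian (S.Lw x w) θ = hessian (S.L x) θ := by
  have h : fderiv ℝ (S.Lw x w) =ᶠ[𝓝 θ] fun t => fderiv ℝ (S.L x) t + S.σ • innerSL ℝ w :=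
    Filter.eventuallyEq_of_mem (hreg.isOpen.mem_nhds hθ) fun t ht => fderiv_Lw hreg x w ht
  unfold hessian
  rw [h.fderiv_eq, fderiv_add_const]

theorem Regular.continuousOn_f (hreg : S.Regular) (x : 𝒳) : ContinuousOn (S.f x) S.Θ := by
  have h : ContinuousOn (fun θ => Real.exp (S.R θ - S.L x θ)) S.Θ := by
    refine Real.continuous_exp.comp_continuousOn (ContinuousOn.sub (fun θ hθ => ?_)
      (hreg.contDiffOn_L x).continuousOn)
    exact (hreg.differentiable_R θ hθ).1.continuousAt.continuousWithinAt
  refine h.congr fun θ hθ => ?_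
  simp [L, Real.exp_log (hreg.f_pos x θ hθ)]

theorem Regular.measurableParamOn_f (hreg : S.Regular) : MeasurableParamOn S.f S.Θ :=
  measurableParamOn_of_continuousOn hreg.isOpen.measurableSet hreg.measurable_f hreg.continuousOn_f

theorem Regular.measurableParamOn_L (hreg : S.Regular) : MeasurableParamOn S.L S.Θ :=
  measurableParamOn_of_continuousOn hreg.isOpen.measurableSet
    (fun θ hθ => ((Real.measurable_log.comp (hreg.measurable_f θ hθ)).neg).add_const _)
    fun x => (hreg.contDiffOn_L x).continuousOn

theorem Regular.measurableParamOn_fderiv_L (hreg : S.Regular) (e : Vec d) :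
    MeasurableParamOn (fun x θ => fderiv ℝ (S.L x) θ e) S.Θ :=
  hreg.measurableParamOn_L.fderiv hreg.isOpen (fun x _ hθ => hreg.differentiableAt_L x hθ) e

theorem Regular.measurableParamOn_fderiv_fderiv_L (hreg : S.Regular) (e e' : Vec d) :
    MeasurableParamOn (fun x θ => fderiv ℝ (fderiv ℝ (S.L x)) θ e e') S.Θ := by
  refine ((hreg.measurableParamOn_fderiv_L e').fderiv hreg.isOpen (fun x θ hθ =>
    (hreg.differentiableAt_fderiv_L x hθ).clm_apply (differentiableAt_const _)) e).congr
    fun x θ hθ => ?_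
  rw [fderiv_clm_apply (hreg.differentiableAt_fderiv_L x hθ) (differentiableAt_const _)]
  simp

/-- The gradient of the objective without noise, extended by zero outside `Θ`. -/
def gradL (S : Setup 𝒳 d c) (q : 𝒳 × Vec d) : Vec d :=
  S.Θ.indicator (gradient (S.L q.1)) q.2

/-- The Hessian of the objective without noise, extended by zero outside `Θ`. -/
def hessL (S : Setup 𝒳 d c) (q : 𝒳 × Vec d) : Matrix (Fin d) (Fin d) ℝ :=
  S.Θ.indicator (hessian (S.L q.1)) q.2

theorem gradL_of_mem (x : 𝒳) {θ : Vec d} (hθ : θ ∈ S.Θ) :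
    S.gradL (x, θ) = gradient (S.L x) θ := Set.indicator_of_mem hθ _

theorem hessL_of_mem (x : 𝒳) {θ : Vec d} (hθ : θ ∈ S.Θ) :
    S.hessL (x, θ) = hessian (S.L x) θ := Set.indicator_of_mem hθ _

theorem Regular.measurable_gradL (hreg : S.Regular) : Measurable S.gradL := by
  have h : Measurable fun q : 𝒳 × Vec d => (S.gradL q).ofLp := by
    refine measurable_pi_lambda _ fun i => ?_
    have h1 : Measurable fun q : 𝒳 × Vec d => S.Θ.indicator
        (fun θ => fderiv ℝ (S.L q.1) θ (EuclideanSpace.single i 1)) q.2 :=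
      hreg.measurableParamOn_fderiv_L (EuclideanSpace.single i 1)
    convert h1 using 2 with q
    by_cases hq : q.2 ∈ S.Θ
    · simp [gradL, Set.indicator_of_mem hq, gradient_apply]
    · simp [gradL, Set.indicator_of_notMem hq]
  exact (WithLp.measurable_toLp 2 (Fin d → ℝ)).comp h

theorem Regular.measurable_hessL (hreg : S.Regular) (i j : Fin d) :
    Measurable fun q => S.hessL q i j := by
  have h1 : Measurable fun q : 𝒳 × Vec d => S.Θ.indicator (fun θ => fderiv ℝ
      (fderiv ℝ (S.L q.1)) θ (EuclideanSpace.single i 1) (EuclideanSpace.single j 1)) q.2 :=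
    hreg.measurableParamOn_fderiv_fderiv_L _ _
  convert h1 using 2 with q
  by_cases hq : q.2 ∈ S.Θ
  · simp [hessL, Set.indicator_of_mem hq, hessian]
  · simp [hessL, Set.indicator_of_notMem hq]

end Regularity

/-! ### Active sets -/

section Active

variable (S)

/-- The span of the rows of the constraint matrix with index in `I`. -/
def rowSpan (I : Set (Fin c)) : Submodule ℝ (Vec d) := Submodule.span ℝ (S.row '' I)

/-- The reduced matrix `Uᵀ N U`, for an orthonormal basis `U` of the orthogonal complement of the
span of the rows with index in `I`. -/
def reduced (I : Set (Fin c)) (N : Matrix (Fin d) (Fin d) ℝ) :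
    Matrix (Fin (Module.finrank ℝ (S.rowSpan I)ᗮ)) (Fin (Module.finrank ℝ (S.rowSpan I)ᗮ)) ℝ :=
  (orthoBasisMatrix (S.rowSpan I)ᗮ)ᵀ * N * orthoBasisMatrix (S.rowSpan I)ᗮ

theorem measurableSet_active_eq (I : Set (Fin c)) : MeasurableSet {θ | S.active θ = I} := by
  have : {θ | S.active θ = I} = ⋂ i, {θ : Vec d | inner ℝ (S.row i) θ = S.b i ↔ i ∈ I} := by
    ext θ
    simp [Set.ext_iff, active]
  rw [this]
  refine MeasurableSet.iInter fun i => ?_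
  have h : MeasurableSet {θ : Vec d | inner ℝ (S.row i) θ = S.b i} :=
    measurableSet_eq_fun (by fun_prop) measurable_const
  by_cases hi : i ∈ I
  · simpa [hi] using h
  · simp only [hi, iff_false]
    exact h.compl

/-- The cone of the nonnegative combinations of the rows with index in `I`. -/
def rowCone (I : Set (Fin c)) : Set (Vec d) :=
  {g | ∃ lam : Fin c → ℝ, (∀ i, 0 ≤ lam i) ∧ (∀ i, i ∉ I → lam i = 0) ∧
    g + ∑ i, lam i • S.row i = 0}

/-- The cone is σ-compact: a countable union of images of compact boxes of multipliers. -/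
theorem measurableSet_rowCone (I : Set (Fin c)) : MeasurableSet (S.rowCone I) := by
  set K : ℕ → Set (Fin c → ℝ) := fun n =>
    (Set.univ.pi fun _ => Set.Icc 0 (n : ℝ)) ∩ {lam | ∀ i, i ∉ I → lam i = 0} with hK
  have hKc : ∀ n, IsCompact (K n) := fun n => by
    refine (isCompact_univ_pi fun _ => isCompact_Icc).inter_right ?_
    simp only [Set.ofPred_forall]
    exact isClosed_iInter fun i => isClosed_iInter fun _ =>
      isClosed_eq (continuous_apply i) continuous_const
  have h : S.rowCone I = ⋃ n, (fun lam : Fin c → ℝ => -∑ i, lam i • S.row i) '' K n := by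
    ext g
    simp only [rowCone, Set.mem_ofPred_eq, Set.mem_iUnion, Set.mem_image]
    constructor
    · rintro ⟨lam, h0, hI, hg⟩
      obtain ⟨n, hn⟩ := exists_nat_ge (∑ i, lam i)
      refine ⟨n, lam, ⟨fun i _ => ⟨h0 i, le_trans ?_ hn⟩, hI⟩, (eq_neg_of_add_eq_zero_left hg).symm⟩
      exact Finset.single_le_sum (fun i _ => h0 i) (Finset.mem_univ i)
    · rintro ⟨n, lam, ⟨h0, hI⟩, rfl⟩
      exact ⟨lam, fun i => (h0 i trivial).1, hI, by simp⟩
  rw [h]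
  exact MeasurableSet.iUnion fun n =>
    ((hKc n).image (by fun_prop)).isClosed.measurableSet

theorem rowCone_subset (I : Set (Fin c)) : S.rowCone I ⊆ S.rowSpan I := by
  rintro g ⟨lam, -, hI, hg⟩
  rw [eq_neg_of_add_eq_zero_left hg]
  refine (S.rowSpan I).neg_mem (Submodule.sum_mem _ fun i _ => ?_)
  by_cases hi : i ∈ I
  · exact Submodule.smul_mem _ _ (Submodule.subset_span ⟨i, hi, rfl⟩)
  · simp [hI i hi]

end Active

end Setup

/-- Positive definiteness is the closed condition of semidefiniteness together with the open
condition of a nonzero determinant. -/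
theorem measurableSet_posDef {β n : Type*} [MeasurableSpace β] [Fintype n] [DecidableEq n]
    {N : β → Matrix n n ℝ} (hN : ∀ i j, Measurable fun b => N b i j) :
    MeasurableSet {b | (N b).PosDef} := by
  have h1 : ∀ N : Matrix n n ℝ, N.PosDef ↔ N.PosSemidef ∧ N.det ≠ 0 := fun N =>
    ⟨fun h => ⟨h.posSemidef, h.det_pos.ne'⟩, fun ⟨h, hd⟩ =>
      h.posDef_iff_isUnit.2 ((Matrix.isUnit_iff_isUnit_det _).2 (isUnit_iff_ne_zero.2 hd))⟩
  have h2 : IsClosed {N : Matrix n n ℝ | N.PosSemidef} := by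
    have : {N : Matrix n n ℝ | N.PosSemidef} = {N | Nᵀ = N} ∩
        ⋂ v : n → ℝ, {N | 0 ≤ v ⬝ᵥ (N *ᵥ v)} := by
      ext N
      simp [Matrix.posSemidef_iff_dotProduct_mulVec, Matrix.IsHermitian,
        Matrix.conjTranspose_eq_transpose_of_trivial]
    rw [this]
    refine (isClosed_eq (by fun_prop) (by fun_prop)).inter (isClosed_iInter fun v => ?_)
    exact isClosed_le continuous_const (by fun_prop)
  have h3 : IsOpen {N : Matrix n n ℝ | N.det ≠ 0} :=
    isOpen_ne_fun (by fun_prop) continuous_const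
  have hm : Measurable fun b => (fun i j => N b i j : n → n → ℝ) :=
    measurable_pi_lambda _ fun i => measurable_pi_lambda _ fun j => hN i j
  have h4 : MeasurableSet {N : n → n → ℝ | (Matrix.of N).PosDef} := by
    simp_rw [h1]
    exact (h2.preimage (f := fun N : n → n → ℝ => (Matrix.of N : Matrix n n ℝ))
      continuous_id).measurableSet.inter (h3.preimage
      (f := fun N : n → n → ℝ => (Matrix.of N : Matrix n n ℝ)) continuous_id).measurableSet
  exact hm h4

/-! ### Determinants of block triangular maps -/

section Det

variable {d : ℕ}

theorem starProjection_eq_mulVec (V : Submodule ℝ (Vec d)) (y : Vec d) :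
    (V.starProjection y).ofLp = (orthoBasisMatrix V * (orthoBasisMatrix V)ᵀ) *ᵥ y.ofLp := by
  have h : V.starProjection y = ∑ j, inner ℝ (stdOrthonormalBasis ℝ V j : Vec d) y •
      (stdOrthonormalBasis ℝ V j : Vec d) := by
    rw [(stdOrthonormalBasis ℝ V).starProjection_eq_sum_rankOne]
    simp
  rw [h]
  ext i
  simp only [WithLp.ofLp_sum, WithLp.ofLp_smul, Finset.sum_apply, Pi.smul_apply, smul_eq_mul,
    ← Matrix.mulVec_mulVec]
  simp only [orthoBasisMatrix, Matrix.mulVec, dotProduct, Matrix.of_apply, Matrix.transpose_apply,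
    PiLp.inner_apply, RCLike.inner_apply, conj_trivial]
  refine Finset.sum_congr rfl fun j _ => ?_
  rw [mul_comm]
  congr 1
  exact Finset.sum_congr rfl fun l _ => mul_comm _ _

theorem orthoBasisMatrix_transpose_mul (V : Submodule ℝ (Vec d)) :
    (orthoBasisMatrix V)ᵀ * orthoBasisMatrix V = 1 := by
  ext i j
  have h := orthonormal_iff_ite.1 (stdOrthonormalBasis ℝ V).orthonormal i j
  rw [Submodule.coe_inner] at h
  simp only [PiLp.inner_apply, RCLike.inner_apply, conj_trivial] at h
  simp only [orthoBasisMatrix, Matrix.mul_apply, Matrix.transpose_apply, Matrix.of_apply,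
    Matrix.one_apply]
  rw [← h]
  exact Finset.sum_congr rfl fun l _ => mul_comm _ _

theorem det_eq_of_mulVec {T : Vec d →L[ℝ] Vec d} {N : Matrix (Fin d) (Fin d) ℝ}
    (hT : ∀ u, (T u).ofLp = N *ᵥ u.ofLp) : T.det = N.det := by
  rw [← LinearMap.det_toLin (EuclideanSpace.basisFun (Fin d) ℝ).toBasis N, ContinuousLinearMap.det]
  congr 1
  ext1 u
  ext i
  have := congrFun (hT u) i
  rw [ContinuousLinearMap.coe_coe, this]
  simp [Matrix.toLin_apply, Matrix.mulVec, dotProduct, Pi.single_apply]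

/-- The unscaled map is the identity on `V` and, modulo `V`, is `-Uᵀ N U` on `Vᗮ`: it is block
triangular. The identity `det (1 - A B) = det (1 - B A)` with `B = Uᵀ` and `Uᵀ U = 1` evaluates the
determinant without a basis adapted to the splitting. -/
theorem abs_det_starProjection_sub_comp (V : Submodule ℝ (Vec d)) {T : Vec d →L[ℝ] Vec d}
    {N : Matrix (Fin d) (Fin d) ℝ} (hT : ∀ u, (T u).ofLp = N *ᵥ u.ofLp) (s : ℝ) :
    |(s • (V.starProjection - T ∘L Vᗮ.starProjection)).det| =
      |s| ^ d * |((orthoBasisMatrix Vᗮ)ᵀ * N * orthoBasisMatrix Vᗮ).det| := by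
  set U := orthoBasisMatrix Vᗮ with hU
  have h1 : (s • (V.starProjection - T ∘L Vᗮ.starProjection)).det =
      (s • (1 - (U + N * U) * Uᵀ)).det := by
    refine det_eq_of_mulVec fun u => ?_
    have e1 : V.starProjection u = u - Vᗮ.starProjection u := by
      rw [Submodule.starProjection_orthogonal']
      simp
    rw [smul_apply, sub_apply, ContinuousLinearMap.comp_apply, WithLp.ofLp_smul, WithLp.ofLp_sub,
      hT, starProjection_eq_mulVec Vᗮ, e1, WithLp.ofLp_sub, starProjection_eq_mulVec Vᗮ]
    rw [Matrix.smul_mulVec, Matrix.sub_mulVec, Matrix.one_mulVec, Matrix.mulVec_mulVec,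
      Matrix.add_mul, Matrix.add_mulVec, ← hU, Matrix.mul_assoc, sub_sub]
  rw [h1, Matrix.det_smul, Matrix.det_one_sub_mul_comm, Matrix.mul_add,
    orthoBasisMatrix_transpose_mul, sub_add_cancel_left, Matrix.det_neg, abs_mul, abs_mul, abs_pow,
    abs_pow, abs_neg, abs_one, one_pow, one_mul, Fintype.card_fin, Matrix.mul_assoc]

end Det

/-- The size of the reduced Hessian depends on the active set, so its determinant is handled
separately on each piece where the active set is constant. -/
theorem measurable_of_countable_index {ι β γ : Type*} [MeasurableSpace β] [MeasurableSpace γ]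
    [Countable ι] {a : β → ι} (ha : ∀ i, MeasurableSet {b | a b = i}) {F : ι → β → γ}
    (hF : ∀ i, Measurable (F i)) : Measurable fun b => F (a b) b := by
  intro s hs
  have : (fun b => F (a b) b) ⁻¹' s = ⋃ i, {b | a b = i} ∩ F i ⁻¹' s := by
    ext b
    simp
  rw [this]
  exact MeasurableSet.iUnion fun i => (ha i).inter (hF i hs)

theorem measurable_det {β n : Type*} [MeasurableSpace β] [Fintype n] [DecidableEq n]
    {N : β → Matrix n n ℝ} (hN : ∀ i j, Measurable fun b => N b i j) :
    Measurable fun b => (N b).det := by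
  simp only [Matrix.det_apply']
  exact Finset.measurable_fun_sum _ fun π _ =>
    measurable_const.mul (Finset.measurable_fun_prod _ fun i _ => hN _ _)

namespace Setup

variable {𝒳 : Type*} [MeasurableSpace 𝒳] {d c : ℕ} {S : Setup 𝒳 d c}

/-! ### The weight of the conditional density -/

section Weight

variable (S)

/-- The noise vector for which the perturbed objective for `x` has gradient `g` at `θ`. -/
def noiseAt (q : 𝒳 × Vec d × Vec d) : Vec d := S.σ⁻¹ • (q.2.2 - S.gradL (q.1, q.2.1))

theorem measurable_noiseAt (hreg : S.Regular) : Measurable S.noiseAt := by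
  have h : Measurable fun q : 𝒳 × Vec d × Vec d => S.gradL (q.1, q.2.1) :=
    hreg.measurable_gradL.comp (measurable_fst.prodMk measurable_snd.fst)
  unfold noiseAt
  fun_prop

theorem gradient_Lw_eq_iff (hreg : S.Regular) (x : 𝒳) (w g : Vec d) {θ : Vec d} (hθ : θ ∈ S.Θ) :
    g = gradient (S.Lw x w) θ ↔ w = S.noiseAt (x, θ, g) := by
  have hσ := S.σ_pos.ne'
  rw [gradient_Lw hreg x w hθ, noiseAt, gradL_of_mem x hθ, eq_inv_smul_iff₀ hσ, eq_sub_iff_add_eq',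
    eq_comm]

theorem isSSOSP_iff (hreg : S.Regular) (x : 𝒳) (w θ : Vec d) :
    S.IsSSOSP x w θ ↔ θ ∈ S.Θ ∧ (∀ i, inner ℝ (S.row i) θ ≤ S.b i) ∧
      gradient (S.Lw x w) θ ∈ S.rowCone (S.active θ) ∧
      (S.reduced (S.active θ) (S.hessL (x, θ))).PosDef := by
  constructor
  · rintro ⟨h1, h2, h3, h4⟩
    refine ⟨h1, h2, h3, ?_⟩
    rw [hessian_Lw hreg x w h1] at h4
    rw [hessL_of_mem x h1]
    exact h4
  · rintro ⟨h1, h2, h3, h4⟩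
    refine ⟨h1, h2, h3, ?_⟩
    rw [hessian_Lw hreg x w h1]
    rw [hessL_of_mem x h1] at h4
    exact h4

/-- The gradient determines the noise, so `noiseAt` is the only candidate for `w`. Removing the
existential over `w` is what makes the support visibly measurable. -/
theorem mem_support_iff (hreg : S.Regular) (x : 𝒳) (θ g : Vec d) :
    x ∈ S.support θ g ↔ θ ∈ S.Θ ∧ θ = S.thetaHat x (S.noiseAt (x, θ, g)) ∧
      (∀ i, inner ℝ (S.row i) θ ≤ S.b i) ∧ g ∈ S.rowCone (S.active θ) ∧
      (S.reduced (S.active θ) (S.hessL (x, θ))).PosDef := by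
  constructor
  · rintro ⟨w, h1, h2, h3⟩
    have h4 := (S.isSSOSP_iff hreg x w θ).1 h2
    have hw := (S.gradient_Lw_eq_iff hreg x w g h4.1).1 h3
    exact ⟨h4.1, hw ▸ h1, h4.2.1, h3 ▸ h4.2.2.1, h4.2.2.2⟩
  · rintro ⟨h1, h2, h3, h4, h5⟩
    have hg := (S.gradient_Lw_eq_iff hreg x _ g h1).2 rfl
    refine ⟨S.noiseAt (x, θ, g), h2, (S.isSSOSP_iff hreg x _ θ).2 ⟨h1, h3, ?_, h5⟩, hg⟩
    rw [← hg]; exact h4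

theorem isSSOSP_thetaHat_iff (hreg : S.Regular) (x : 𝒳) (w : Vec d) :
    S.IsSSOSP x w (S.thetaHat x w) ↔ x ∈ S.support (S.thetaHat x w) (S.gHat x w) := by
  refine ⟨fun h => ⟨w, rfl, h, rfl⟩, ?_⟩
  rintro ⟨w', h1, h2, h3⟩
  have hw := (S.gradient_Lw_eq_iff hreg x w' _ (S.thetaHat_mem x w)).1 h3
  have hw' := (S.gradient_Lw_eq_iff hreg x w _ (S.thetaHat_mem x w)).1 rfl
  rw [← gHat, ← hw] at hw'
  subst hw'
  exact h2

theorem measurable_gHat (hreg : S.Regular) :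
    Measurable fun q : 𝒳 × Vec d => S.gHat q.1 q.2 := by
  have : (fun q : 𝒳 × Vec d => S.gHat q.1 q.2) = fun q =>
      S.gradL (q.1, S.thetaHat q.1 q.2) + S.σ • q.2 := by
    ext1 q
    rw [gHat, gradient_Lw hreg _ _ (S.thetaHat_mem _ _), gradL_of_mem _ (S.thetaHat_mem _ _)]
  have h : Measurable fun q : 𝒳 × Vec d => S.gradL (q.1, S.thetaHat q.1 q.2) :=
    hreg.measurable_gradL.comp (measurable_fst.prodMk S.measurable_thetaHat)
  rw [this]
  fun_prop

theorem measurable_reduced {β : Type*} [MeasurableSpace β] {N : β → Matrix (Fin d) (Fin d) ℝ}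
    (hN : ∀ i j, Measurable fun b => N b i j) (I : Set (Fin c)) (i j) :
    Measurable fun b => S.reduced I (N b) i j := by
  simp only [reduced, Matrix.mul_apply, Matrix.transpose_apply]
  exact Finset.measurable_fun_sum _ fun l _ => (Finset.measurable_fun_sum _ fun l' _ =>
    measurable_const.mul (hN _ _)).mul_const _

theorem measurableSet_support (hreg : S.Regular) :
    MeasurableSet {q : 𝒳 × Vec d × Vec d | q.1 ∈ S.support q.2.1 q.2.2} := by
  have h : {q : 𝒳 × Vec d × Vec d | q.1 ∈ S.support q.2.1 q.2.2} =
      {q | q.2.1 ∈ S.Θ} ∩ ({q | q.2.1 = S.thetaHat q.1 (S.noiseAt q)} ∩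
      ((⋂ i, {q | inner ℝ (S.row i) q.2.1 ≤ S.b i}) ∩
      ⋃ I, ({q | S.active q.2.1 = I} ∩ ({q | q.2.2 ∈ S.rowCone I} ∩
        {q | (S.reduced I (S.hessL (q.1, q.2.1))).PosDef})))) := by
    ext ⟨x, θ, g⟩
    simp [mem_support_iff S hreg]
  rw [h]
  refine (measurable_snd.fst hreg.isOpen.measurableSet).inter (MeasurableSet.inter ?_
    ((MeasurableSet.iInter fun i => ?_).inter (MeasurableSet.iUnion fun I => ?_)))
  · exact measurableSet_eq_fun measurable_snd.fst
      (S.measurable_thetaHat.comp (measurable_fst.prodMk (S.measurable_noiseAt hreg)))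
  · exact measurableSet_le (by fun_prop) measurable_const
  · refine (measurable_snd.fst (S.measurableSet_active_eq I)).inter
      ((measurable_snd.snd (S.measurableSet_rowCone I)).inter ?_)
    exact measurableSet_posDef (S.measurable_reduced (fun i j =>
      (hreg.measurable_hessL i j).comp (measurable_fst.prodMk measurable_snd.fst)) I)

theorem measurableSet_isSSOSP (hreg : S.Regular) :
    MeasurableSet {q : 𝒳 × Vec d | S.IsSSOSP q.1 q.2 (S.thetaHat q.1 q.2)} := by
  simp_rw [S.isSSOSP_thetaHat_iff hreg]
  exact (measurable_fst.prodMk (S.measurable_thetaHat.prodMk (S.measurable_gHat hreg)))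
    (S.measurableSet_support hreg)

open Classical in
/-- The factor of the conditional density of `x` given `(θ, g)` that does not involve the
likelihood. -/
def weight (q : 𝒳 × Vec d × Vec d) : ℝ :=
  if q.1 ∈ S.support q.2.1 q.2.2 then
    Real.exp (-(d / 2 * ‖S.noiseAt q‖ ^ 2)) * (S.reduced (S.active q.2.1) (S.hessL (q.1, q.2.1))).det
  else 0

theorem weight_pos (hreg : S.Regular) {q : 𝒳 × Vec d × Vec d}
    (hq : q.1 ∈ S.support q.2.1 q.2.2) : 0 < S.weight q := by
  rw [weight, if_pos hq]
  exact mul_pos (Real.exp_pos _) ((S.mem_support_iff hreg _ _ _).1 hq).2.2.2.2.det_pos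

theorem weight_nonneg (hreg : S.Regular) (q : 𝒳 × Vec d × Vec d) : 0 ≤ S.weight q := by
  by_cases hq : q.1 ∈ S.support q.2.1 q.2.2
  · exact (S.weight_pos hreg hq).le
  · rw [weight, if_neg hq]

theorem measurable_weight (hreg : S.Regular) : Measurable S.weight := by
  classical
  have hdet : Measurable fun q : 𝒳 × Vec d × Vec d =>
      (S.reduced (S.active q.2.1) (S.hessL (q.1, q.2.1))).det := by
    have hH : ∀ i j, Measurable fun q : 𝒳 × Vec d × Vec d => S.hessL (q.1, q.2.1) i j :=
      fun i j => (hreg.measurable_hessL i j).comp (measurable_fst.prodMk measurable_snd.fst)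
    have h2 : ∀ I, Measurable fun q : 𝒳 × Vec d × Vec d =>
        (S.reduced I (S.hessL (q.1, q.2.1))).det := fun I =>
      measurable_det (N := fun q : 𝒳 × Vec d × Vec d => S.reduced I (S.hessL (q.1, q.2.1)))
        (S.measurable_reduced hH I)
    exact measurable_of_countable_index (a := fun q : 𝒳 × Vec d × Vec d => S.active q.2.1)
      (fun I => measurable_snd.fst (S.measurableSet_active_eq I)) h2
  have hn := S.measurable_noiseAt hreg
  exact Measurable.ite (S.measurableSet_support hreg) (by fun_prop) measurable_const

theorem unnormDensity_eq (hreg : S.Regular) (θ g : Vec d) (x : 𝒳) :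
    S.unnormDensity θ g x = S.f x θ * S.weight (x, θ, g) := by
  have hσ := S.σ_pos
  by_cases hx : x ∈ S.support θ g
  · have hθ := ((S.mem_support_iff hreg _ _ _).1 hx).1
    rw [unnormDensity, weight, if_pos hx, if_pos hx, mul_assoc]
    simp only [noiseAt, gradL_of_mem x hθ, hessL_of_mem x hθ]
    congr 2
    rw [norm_smul, mul_pow, norm_inv, Real.norm_eq_abs, abs_of_pos hσ]
    congr 2
    field_simp
  · rw [unnormDensity, weight, if_neg hx, if_neg hx, mul_zero]

end Weight

end Setup

namespace Setup

variable {𝒳 : Type*} [MeasurableSpace 𝒳] {d c : ℕ} {S : Setup 𝒳 d c}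

/-! ### The joint law of the data and of the output of the solver -/

section ChangeOfVariables

variable (S)

open Classical in
/-- A point whose active set is `I`, if there is one. -/
def basePoint (I : Set (Fin c)) : Vec d :=
  if h : ∃ θ, S.active θ = I then h.choose else 0

/-- Coordinates of the pairs `(θ, g)` such that the active set of `θ` is `I` and `g` is in the span
of the active rows. -/
def coord (I : Set (Fin c)) (y : Vec d) : Vec d × Vec d :=
  (S.basePoint I + (S.rowSpan I)ᗮ.starProjection y, (S.rowSpan I).starProjection y)

theorem measurable_coord (I : Set (Fin c)) : Measurable (S.coord I) := by
  unfold coord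
  fun_prop

theorem coord_injective (I : Set (Fin c)) : Function.Injective (S.coord I) := by
  intro y y' h
  have h1 := congrArg Prod.fst h
  have h2 := congrArg Prod.snd h
  simp only [coord, add_right_inj] at h1 h2
  rw [← (S.rowSpan I).starProjection_add_starProjection_orthogonal y, h1, h2,
    (S.rowSpan I).starProjection_add_starProjection_orthogonal y']

/-- Two points with active set `I` differ by a vector orthogonal to the rows in `I`, so `θ -
basePoint I` and `g` are the two orthogonal components of one `y`. -/
theorem exists_coord_eq {I : Set (Fin c)} {θ g : Vec d} (hθ : S.active θ = I)
    (hg : g ∈ S.rowSpan I) : ∃ y, S.coord I y = (θ, g) := by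
  have hbase : S.active (S.basePoint I) = I := by
    have h : ∃ θ, S.active θ = I := ⟨θ, hθ⟩
    rw [basePoint, dif_pos h]
    exact h.choose_spec
  have horth : θ - S.basePoint I ∈ (S.rowSpan I)ᗮ := by
    rw [rowSpan, Submodule.mem_orthogonal']
    intro u hu
    induction hu using Submodule.span_induction with
    | mem u hu =>
      obtain ⟨i, hi, rfl⟩ := hu
      have h1 : inner ℝ (S.row i) θ = S.b i := by rw [← hθ] at hi; exact hi
      have h2 : inner ℝ (S.row i) (S.basePoint I) = S.b i := by rw [← hbase] at hi; exact hi
      rw [real_inner_comm, inner_sub_right, h1, h2, sub_self]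
    | zero => simp
    | add a b _ _ ha hb => rw [inner_add_right, ha, hb, add_zero]
    | smul t a _ ha => rw [inner_smul_right, ha, mul_zero]
  refine ⟨(θ - S.basePoint I) + g, ?_⟩
  simp only [coord, map_add]
  rw [Submodule.starProjection_eq_self_iff.2 horth, Submodule.starProjection_eq_self_iff.2 hg,
    Submodule.starProjection_orthogonal_apply_eq_zero hg,
    (Submodule.starProjection_apply_eq_zero_iff _).2 horth]
  simp

theorem exists_hasFDerivAt_gradL (hreg : S.Regular) (x : 𝒳) {θ : Vec d} (hθ : θ ∈ S.Θ) :
    ∃ T : Vec d →L[ℝ] Vec d, HasFDerivAt (fun t => S.gradL (x, t)) T θ ∧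
      ∀ u, (T u).ofLp = S.hessL (x, θ) *ᵥ u.ofLp := by
  set D := (InnerProductSpace.toDual ℝ (Vec d)).symm.toContinuousLinearEquiv.toContinuousLinearMap
    with hD
  -- Riesz representation turns the second derivative at `u` into `uᵀ H`; symmetry identifies it
  -- with `H u`.
  have hsymm : (hessian (S.L x) θ).IsHermitian :=
    hessian_isHermitian (hreg.eventually_differentiableAt_L x hθ)
      (hreg.differentiableAt_fderiv_L x hθ)
  refine ⟨D.comp (fderiv ℝ (fderiv ℝ (S.L x)) θ), ?_, fun u => ?_⟩
  · have h1 : HasFDerivAt (gradient (S.L x)) (D.comp (fderiv ℝ (fderiv ℝ (S.L x)) θ)) θ :=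
      D.hasFDerivAt.comp θ (hreg.differentiableAt_fderiv_L x hθ).hasFDerivAt
    exact h1.congr_of_eventuallyEq (Filter.eventuallyEq_of_mem (hreg.isOpen.mem_nhds hθ)
      fun t ht => gradL_of_mem x ht)
  · ext i
    have h2 : (D (fderiv ℝ (fderiv ℝ (S.L x)) θ u)) i =
        inner ℝ (D (fderiv ℝ (fderiv ℝ (S.L x)) θ u)) (EuclideanSpace.single i 1) := by
      simp [EuclideanSpace.inner_single_right]
    have h3 : inner ℝ (D (fderiv ℝ (fderiv ℝ (S.L x)) θ u)) (EuclideanSpace.single i 1) =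
        fderiv ℝ (fderiv ℝ (S.L x)) θ u (EuclideanSpace.single i 1) :=
      InnerProductSpace.toDual_symm_apply
    rw [ContinuousLinearMap.comp_apply, h2, h3, fderiv_fderiv_apply_eq, hessL_of_mem x hθ]
    rw [PiLp.ofLp_single, Matrix.mulVec_single_one]
    simp only [dotProduct, Matrix.mulVec, Matrix.col_apply]
    refine Finset.sum_congr rfl fun j _ => ?_
    rw [mul_comm, ← hsymm.apply i j, star_trivial]

theorem exists_hasFDerivAt_noiseAt_coord (hreg : S.Regular) (x : 𝒳) (I : Set (Fin c)) {y : Vec d}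
    (hθ : (S.coord I y).1 ∈ S.Θ) :
    ∃ T : Vec d →L[ℝ] Vec d, HasFDerivAt (fun t => S.noiseAt (x, S.coord I t)) T y ∧
      |T.det| = S.σ⁻¹ ^ d * |(S.reduced I (S.hessL (x, (S.coord I y).1))).det| := by
  obtain ⟨T, hT, hTN⟩ := S.exists_hasFDerivAt_gradL hreg x hθ
  refine ⟨S.σ⁻¹ • ((S.rowSpan I).starProjection - T ∘L (S.rowSpan I)ᗮ.starProjection), ?_, ?_⟩
  · have h1 : HasFDerivAt (fun t => (S.coord I t).1) ((S.rowSpan I)ᗮ.starProjection) y :=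
      ((S.rowSpan I)ᗮ.starProjection.hasFDerivAt).const_add _
    have h2 : HasFDerivAt (fun t => S.gradL (x, (S.coord I t).1))
        (T ∘L (S.rowSpan I)ᗮ.starProjection) y :=
      HasFDerivAt.comp (g := fun t => S.gradL (x, t)) y hT h1
    exact (((S.rowSpan I).starProjection.hasFDerivAt).sub h2).const_smul S.σ⁻¹
  · rw [abs_det_starProjection_sub_comp _ hTN, abs_of_pos (inv_pos.2 S.σ_pos)]
    rfl

/-- The reference measure for the joint law of the output of the solver and of its gradient: the sum
over the sets `I` of constraints of the Lebesgue measures on the `(θ, g)` with active set `I`. -/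
def strataMeasure : Measure (Vec d × Vec d) :=
  Measure.sum fun I : Set (Fin c) =>
    ((volume : Measure (Vec d)).restrict {y | S.active (S.coord I y).1 = I}).map (S.coord I)

instance sFinite_strataMeasure : SFinite S.strataMeasure := by
  unfold strataMeasure
  infer_instance

/-- For fixed `x`, the map `G` from coordinates to noise is a bijection of `E` onto `D`, with
inverse given by the solver and its gradient. The change of variables formula applies, and the
Jacobian of `G` is the determinant in `weight`. -/
theorem lintegral_ssosp_active (hreg : S.Regular) {κ : ℝ}
    (hnoise : noise d = (volume : Measure (Vec d)).withDensity
      fun w => ENNReal.ofReal (κ * Real.exp (-(d / 2 * ‖w‖ ^ 2))))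
    (x : 𝒳) (I : Set (Fin c)) {F : Vec d × Vec d → ℝ≥0∞} (hF : Measurable F) :
    ∫⁻ w in {w | S.IsSSOSP x w (S.thetaHat x w) ∧ S.active (S.thetaHat x w) = I},
      F (S.thetaHat x w, S.gHat x w) ∂(noise d) =
    ∫⁻ y in {y | S.active (S.coord I y).1 = I},
      ENNReal.ofReal (κ * S.σ⁻¹ ^ d * S.weight (x, S.coord I y)) * F (S.coord I y) := by
  have hσ := S.σ_pos
  have hcm := S.measurable_coord I
  set D := {w | S.IsSSOSP x w (S.thetaHat x w) ∧ S.active (S.thetaHat x w) = I} with hD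
  set A := {y | S.active (S.coord I y).1 = I} with hA
  set E := {y | S.active (S.coord I y).1 = I ∧ x ∈ S.support (S.coord I y).1 (S.coord I y).2}
    with hE
  set G : Vec d → Vec d := fun y => S.noiseAt (x, S.coord I y) with hG
  have hθm : Measurable fun w => S.thetaHat x w := S.measurable_thetaHat.comp
    (by fun_prop : Measurable fun w => (x, w))
  have hgm : Measurable fun w => S.gHat x w := by
    simpa only [Function.comp_def] using (S.measurable_gHat hreg).comp
      (measurable_prodMk_left (x := x))
  have hDm : MeasurableSet D := by
    have h1 : MeasurableSet {w | S.IsSSOSP x w (S.thetaHat x w)} :=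
      (by fun_prop : Measurable fun w => (x, w)) (S.measurableSet_isSSOSP hreg)
    have h2 : MeasurableSet {w | S.active (S.thetaHat x w) = I} :=
      hθm (S.measurableSet_active_eq I)
    exact h1.inter h2
  have hAm : MeasurableSet A := hcm.fst (S.measurableSet_active_eq I)
  have hEm : MeasurableSet E := by
    have h1 : Measurable fun y => (x, S.coord I y) := by fun_prop
    have h2 : MeasurableSet {y | x ∈ S.support (S.coord I y).1 (S.coord I y).2} :=
      h1 (S.measurableSet_support hreg)
    exact hAm.inter h2
  have hEspec : ∀ y ∈ E, S.thetaHat x (G y) = (S.coord I y).1 ∧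
      S.gHat x (G y) = (S.coord I y).2 := by
    rintro y ⟨-, hy⟩
    have h := (S.mem_support_iff hreg _ _ _).1 hy
    have h1 : (S.coord I y).1 = S.thetaHat x (G y) := h.2.1
    have h2 := (S.gradient_Lw_eq_iff hreg x (G y) (S.coord I y).2 h.1).2 rfl
    refine ⟨h1.symm, ?_⟩
    rw [gHat, ← h1, ← h2]
  have hinj : Set.InjOn G E := by
    intro y hy y' hy' h
    have h1 := hEspec y hy
    have h2 := hEspec y' hy'
    rw [h] at h1
    exact S.coord_injective I (Prod.ext (h1.1.symm.trans h2.1) (h1.2.symm.trans h2.2))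
  have himage : G '' E = D := by
    ext w
    constructor
    · rintro ⟨y, hy, rfl⟩
      have h1 := hEspec y hy
      refine ⟨?_, ?_⟩
      · rw [S.isSSOSP_thetaHat_iff hreg, h1.1, h1.2]
        exact hy.2
      · rw [h1.1]; exact hy.1
    · rintro ⟨h1, h2⟩
      have h3 := (S.isSSOSP_iff hreg x w _).1 h1
      have h4 : S.gHat x w ∈ S.rowSpan I := by
        have := S.rowCone_subset _ h3.2.2.1
        rwa [h2] at this
      obtain ⟨y, hy⟩ := S.exists_coord_eq h2 h4
      refine ⟨y, ⟨by rw [hy]; exact h2, ?_⟩, ?_⟩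
      · rw [hy]
        exact (S.isSSOSP_thetaHat_iff hreg x w).1 h1
      · simp only [hG, hy]
        exact ((S.gradient_Lw_eq_iff hreg x w _ h3.1).1 rfl).symm
  have hderiv : ∀ y ∈ E, ∃ T : Vec d →L[ℝ] Vec d, HasFDerivWithinAt G T E y ∧
      |T.det| = S.σ⁻¹ ^ d * |(S.reduced I (S.hessL (x, (S.coord I y).1))).det| := by
    rintro y ⟨-, hy⟩
    obtain ⟨T, hT, hdet⟩ := S.exists_hasFDerivAt_noiseAt_coord hreg x I
      ((S.mem_support_iff hreg _ _ _).1 hy).1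
    exact ⟨T, hT.hasFDerivWithinAt, hdet⟩
  choose! T hT hdet using hderiv
  have hpdf : Measurable fun w : Vec d =>
      ENNReal.ofReal (κ * Real.exp (-(d / 2 * ‖w‖ ^ 2))) := by fun_prop
  have hcomp : Measurable fun w => F (S.thetaHat x w, S.gHat x w) :=
    hF.comp (hθm.prodMk hgm)
  rw [hnoise, setLIntegral_withDensity_eq_setLIntegral_mul _ hpdf hcomp hDm, ← himage,
    lintegral_image_eq_lintegral_abs_det_fderiv_mul volume hEm hT hinj]
  have hEA : E ⊆ A := fun y hy => hy.1
  -- On `A` but off `E` the data are outside the support and `weight` is zero.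
  have hrhs : ∫⁻ y in A, ENNReal.ofReal (κ * S.σ⁻¹ ^ d * S.weight (x, S.coord I y)) *
      F (S.coord I y) = ∫⁻ y in E, ENNReal.ofReal (κ * S.σ⁻¹ ^ d * S.weight (x, S.coord I y)) *
      F (S.coord I y) := by
    rw [← lintegral_indicator hAm, ← lintegral_indicator hEm]
    refine lintegral_congr fun y => ?_
    by_cases hy : y ∈ E
    · rw [Set.indicator_of_mem hy, Set.indicator_of_mem (hEA hy)]
    · rw [Set.indicator_of_notMem hy]
      by_cases hyA : y ∈ A
      · rw [Set.indicator_of_mem hyA, weight, if_neg fun h => hy ⟨hyA, h⟩]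
        simp
      · rw [Set.indicator_of_notMem hyA]
  rw [hrhs]
  refine setLIntegral_congr_fun hEm fun y hy => ?_
  have h1 := hEspec y hy
  simp only [Pi.mul_apply]
  rw [h1.1, h1.2, ← mul_assoc, ← ENNReal.ofReal_mul (abs_nonneg _), hdet y hy]
  congr 2
  -- The strict second-order condition makes the determinant positive, so the absolute value in the
  -- Jacobian can be dropped.
  have hpd := ((S.mem_support_iff hreg _ _ _).1 hy.2).2.2.2.2
  rw [hy.1] at hpd
  rw [abs_of_pos hpd.det_pos, weight, if_pos hy.2]
  simp only
  rw [hy.1]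
  ring

/-- For fixed `x`, the image of the noise under the solver and its gradient, on the event that the
output is an SSOSP, has a density with respect to `strataMeasure`. -/
theorem lintegral_ssosp (hreg : S.Regular) {κ : ℝ}
    (hnoise : noise d = (volume : Measure (Vec d)).withDensity
      fun w => ENNReal.ofReal (κ * Real.exp (-(d / 2 * ‖w‖ ^ 2))))
    (x : 𝒳) {F : Vec d × Vec d → ℝ≥0∞} (hF : Measurable F) :
    ∫⁻ w in {w | S.IsSSOSP x w (S.thetaHat x w)}, F (S.thetaHat x w, S.gHat x w) ∂(noise d) =
    ∫⁻ t, ENNReal.ofReal (κ * S.σ⁻¹ ^ d * S.weight (x, t)) * F t ∂S.strataMeasure := by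
  have hθm : Measurable fun w => S.thetaHat x w := S.measurable_thetaHat.comp
    (by fun_prop : Measurable fun w => (x, w))
  have hU : {w | S.IsSSOSP x w (S.thetaHat x w)} = ⋃ I : Set (Fin c),
      {w | S.IsSSOSP x w (S.thetaHat x w) ∧ S.active (S.thetaHat x w) = I} := by
    ext w
    simp
  have hwm : Measurable fun t => ENNReal.ofReal (κ * S.σ⁻¹ ^ d * S.weight (x, t)) * F t := by
    have := (S.measurable_weight hreg).comp (by fun_prop : Measurable fun t => (x, t))
    simp only [Function.comp_def] at this
    fun_prop
  rw [hU, lintegral_iUnion (fun I => ?_), strataMeasure, lintegral_sum_measure]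
  · congr 1
    ext1 I
    rw [lintegral_map hwm (S.measurable_coord I), S.lintegral_ssosp_active hreg hnoise x I hF]
  · intro I I' hII'
    refine Set.disjoint_left.2 fun w hw hw' => hII' (hw.2.symm.trans hw'.2)
  · have h1 : MeasurableSet {w | S.IsSSOSP x w (S.thetaHat x w)} :=
      (by fun_prop : Measurable fun w => (x, w)) (S.measurableSet_isSSOSP hreg)
    have h2 : MeasurableSet {w | S.active (S.thetaHat x w) = I} :=
      hθm (S.measurableSet_active_eq I)
    exact h1.inter h2

end ChangeOfVariables

end Setup

/-- The supremum of continuous functions minus an arbitrary function is measurable in a parameter: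
it may be computed on a countable dense subset of the graph of the arbitrary function. -/
theorem measurable_iSup_ofReal_sub {𝒳 E : Type*} [MeasurableSpace 𝒳] [TopologicalSpace E]
    [SecondCountableTopology E] {Z : Set E} (D : E → ℝ) {h : 𝒳 → E → ℝ}
    (hc : ∀ x, ContinuousOn (h x) Z) (hm : ∀ z ∈ Z, Measurable fun x => h x z) :
    Measurable fun x => ⨆ z ∈ Z, ENNReal.ofReal (h x z - D z) := by
  set Γ : Set (E × ℝ) := (fun z => (z, D z)) '' Z with hΓ
  obtain ⟨s, hsc, hsd⟩ := TopologicalSpace.exists_countable_dense Γ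
  have hmem : ∀ γ : Γ, γ.1.1 ∈ Z ∧ γ.1.2 = D γ.1.1 := by
    rintro ⟨_, z, hz, rfl⟩
    exact ⟨hz, rfl⟩
  have key : ∀ x, ⨆ z ∈ Z, ENNReal.ofReal (h x z - D z) =
      ⨆ γ ∈ s, ENNReal.ofReal (h x γ.1.1 - γ.1.2) := by
    intro x
    refine le_antisymm (iSup₂_le fun z hz => ?_) (iSup₂_le fun γ _ => ?_)
    · have hcont : Continuous fun γ : Γ => ENNReal.ofReal (h x γ.1.1 - γ.1.2) := by
        refine ENNReal.continuous_ofReal.comp (Continuous.sub ?_ (by fun_prop))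
        exact (hc x).comp_continuous (by fun_prop) fun γ => (hmem γ).1
      have hcl : IsClosed {γ : Γ | ENNReal.ofReal (h x γ.1.1 - γ.1.2) ≤
          ⨆ γ ∈ s, ENNReal.ofReal (h x γ.1.1 - γ.1.2)} :=
        isClosed_le hcont continuous_const
      have hsub : s ⊆ {γ : Γ | ENNReal.ofReal (h x γ.1.1 - γ.1.2) ≤
          ⨆ γ ∈ s, ENNReal.ofReal (h x γ.1.1 - γ.1.2)} := fun γ hγ =>
        le_iSup₂ (f := fun (γ : Γ) (_ : γ ∈ s) => ENNReal.ofReal (h x γ.1.1 - γ.1.2)) γ hγ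
      exact hcl.closure_subset_iff.2 hsub (hsd ⟨(z, D z), z, hz, rfl⟩)
    · rw [(hmem γ).2]
      exact le_iSup₂ (f := fun z (_ : z ∈ Z) => ENNReal.ofReal (h x z - D z)) γ.1.1 (hmem γ).1
  simp_rw [key]
  exact Measurable.biSup s hsc fun γ _ => ((hm _ (hmem γ).1).sub_const _).ennreal_ofReal

/-- Second-order Taylor bound on `[0, 1]`. -/
theorem taylor_two_le {χ χ' χ'' : ℝ → ℝ} {N : ℝ}
    (h1 : ∀ t ∈ Set.Icc (0 : ℝ) 1, HasDerivAt χ (χ' t) t)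
    (h2 : ∀ t ∈ Set.Icc (0 : ℝ) 1, HasDerivAt χ' (χ'' t) t)
    (hN : ∀ t ∈ Set.Icc (0 : ℝ) 1, χ'' t ≤ N) : χ 1 - χ 0 - χ' 0 ≤ N / 2 := by
  have hint : ∀ t ∈ interior (Set.Icc (0 : ℝ) 1), t ∈ Set.Icc (0 : ℝ) 1 := fun t ht =>
    interior_subset ht
  have a1 : ∀ t ∈ Set.Icc (0 : ℝ) 1, HasDerivAt (fun t => χ' t - N * t) (χ'' t - N) t :=
    fun t ht => ((h2 t ht).sub ((hasDerivAt_id t).const_mul N)).congr_deriv (by simp)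
  have m1 : AntitoneOn (fun t => χ' t - N * t) (Set.Icc 0 1) :=
    antitoneOn_of_hasDerivWithinAt_nonpos (convex_Icc 0 1)
      (fun t ht => (a1 t ht).continuousAt.continuousWithinAt)
      (fun t ht => (a1 t (hint t ht)).hasDerivWithinAt)
      (fun t ht => sub_nonpos.2 (hN t (hint t ht)))
  have a2 : ∀ t ∈ Set.Icc (0 : ℝ) 1, HasDerivAt (fun t => χ t - χ' 0 * t - N / 2 * t ^ 2)
      (χ' t - χ' 0 - N * t) t := fun t ht => by
    have := ((h1 t ht).sub ((hasDerivAt_id t).const_mul (χ' 0))).sub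
      (((hasDerivAt_id t).pow 2).const_mul (N / 2))
    refine this.congr_deriv ?_
    simp
    ring
  have m2 : AntitoneOn (fun t => χ t - χ' 0 * t - N / 2 * t ^ 2) (Set.Icc 0 1) :=
    antitoneOn_of_hasDerivWithinAt_nonpos (convex_Icc 0 1)
      (fun t ht => (a2 t ht).continuousAt.continuousWithinAt)
      (fun t ht => (a2 t (hint t ht)).hasDerivWithinAt) (fun t ht => by
        have := m1 (by simp : (0 : ℝ) ∈ Set.Icc (0 : ℝ) 1) (hint t ht) (hint t ht).1
        simp only [mul_zero, sub_zero] at this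
        linarith)
  have := m2 (by simp : (0 : ℝ) ∈ Set.Icc (0 : ℝ) 1) (by simp : (1 : ℝ) ∈ Set.Icc (0 : ℝ) 1)
    zero_le_one
  simp only [mul_zero, sub_zero, mul_one, one_pow, ne_eq, OfNat.ofNat_ne_zero, not_false_eq_true,
    zero_pow] at this
  linarith

namespace Setup

variable {𝒳 : Type*} [MeasurableSpace 𝒳] {d c : ℕ} {S : Setup 𝒳 d c}

/-! ### The likelihood ratio -/

section LikelihoodRatio

theorem H_eq (hreg : S.Regular) (x : 𝒳) {θ : Vec d} (hθ : θ ∈ S.Θ) :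
    S.H x θ = hessian (S.L x) θ - hessian S.R θ := by
  have h0 : (fun t => -Real.log (S.f x t)) = S.L x - S.R := by
    ext t
    simp [L]
  have h1 : fderiv ℝ (S.L x - S.R) =ᶠ[𝓝 θ] fderiv ℝ (S.L x) - fderiv ℝ S.R :=
    Filter.eventuallyEq_of_mem (hreg.isOpen.mem_nhds hθ) fun t ht =>
      fderiv_sub (hreg.differentiableAt_L x ht) (hreg.differentiable_R t ht).1
  ext i j
  simp only [H, h0, hessian, Matrix.sub_apply, Matrix.of_apply]
  rw [h1.fderiv_eq, fderiv_sub (hreg.differentiableAt_fderiv_L x hθ)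
    (hreg.differentiable_R θ hθ).2]
  rfl

theorem H_isHermitian (hreg : S.Regular) (x : 𝒳) {θ : Vec d} (hθ : θ ∈ S.Θ) :
    (S.H x θ).IsHermitian := by
  rw [H_eq hreg x hθ]
  refine (hessian_isHermitian (hreg.eventually_differentiableAt_L x hθ)
    (hreg.differentiableAt_fderiv_L x hθ)).sub (hessian_isHermitian ?_
    (hreg.differentiable_R θ hθ).2)
  exact Filter.mem_of_superset (hreg.isOpen.mem_nhds hθ) fun t ht => (hreg.differentiable_R t ht).1

theorem Hbar_isHermitian (hreg : S.Regular) (θ₀ : Vec d) {θ : Vec d} (hθ : θ ∈ S.Θ) :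
    (S.Hbar θ₀ θ).IsHermitian := by
  refine Matrix.IsHermitian.ext fun i j => ?_
  simp only [Hbar, Matrix.of_apply, star_trivial]
  refine integral_congr_ae (ae_of_all _ fun x => ?_)
  simpa using (H_isHermitian hreg x hθ).apply i j

/-- Measurable functions below the deviations of the Hessian that still control the second
derivatives of the objective. -/
theorem exists_measurable_dev (hreg : S.Regular) (θ₀ : Vec d) (r : ℝ) :
    ∃ up low : 𝒳 → ℝ≥0∞, Measurable up ∧ Measurable low ∧ (∀ x, up x ≤ S.upperDev θ₀ r x) ∧
      (∀ x, low x ≤ S.lowerDev θ₀ r x) ∧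
      ∀ θ ∈ Metric.closedBall θ₀ r ∩ S.Θ, ∀ v : Vec d, ‖v‖ ≤ r → ∀ x x' : 𝒳,
        ENNReal.ofReal (fderiv ℝ (fderiv ℝ (S.L x)) θ v v - fderiv ℝ (fderiv ℝ (S.L x')) θ v v) ≤
          up x + low x' := by
  set Z : Set (Vec d × Vec d) :=
    (Metric.closedBall θ₀ r ∩ S.Θ) ×ˢ Metric.closedBall (0 : Vec d) r with hZ
  set Q : 𝒳 → Vec d × Vec d → ℝ := fun x z => fderiv ℝ (fderiv ℝ (S.L x)) z.1 z.2 z.2 with hQ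
  -- The part of the quadratic form that does not involve `x`. No continuity in `θ` is available for
  -- it, whereas `Q x` is continuous because `L` is of class `C²`.
  set D : Vec d × Vec d → ℝ := fun z =>
    z.2.ofLp ⬝ᵥ ((S.Hbar θ₀ z.1 + hessian S.R z.1) *ᵥ z.2.ofLp) with hD
  have hQc : ∀ x, ContinuousOn (Q x) Z := by
    rintro x ⟨θ, v⟩ hz
    refine ContinuousAt.continuousWithinAt ?_
    have h1 : ContinuousAt (fun z : Vec d × Vec d => fderiv ℝ (fderiv ℝ (S.L x)) z.1) (θ, v) :=
      ContinuousAt.comp (g := fderiv ℝ (fderiv ℝ (S.L x)))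
        (hreg.continuousAt_fderiv_fderiv_L x hz.1.2) continuousAt_fst
    exact (h1.clm_apply continuousAt_snd).clm_apply continuousAt_snd
  have hQm : ∀ z ∈ Z, Measurable fun x => Q x z := fun z hz =>
    (hreg.measurableParamOn_fderiv_fderiv_L z.2 z.2).measurable_left hz.1.2
  have hQD : ∀ x, ∀ z ∈ Z, Q x z - D z = z.2.ofLp ⬝ᵥ ((S.H x z.1 - S.Hbar θ₀ z.1) *ᵥ z.2.ofLp) := by
    intro x z hz
    simp only [hQ, hD]
    rw [fderiv_fderiv_apply_eq, H_eq hreg x hz.1.2, ← dotProduct_sub, ← Matrix.sub_mulVec]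
    congr 2
    abel
  have hnorm : ∀ z ∈ Z, ‖z.2‖ ≤ r := fun z hz => by simpa using hz.2
  refine ⟨fun x => ⨆ z ∈ Z, ENNReal.ofReal (Q x z - D z),
    fun x => ⨆ z ∈ Z, ENNReal.ofReal (-Q x z - -D z),
    measurable_iSup_ofReal_sub D hQc hQm,
    measurable_iSup_ofReal_sub (fun z => -D z) (fun x => (hQc x).neg) (fun z hz => (hQm z hz).neg),
    fun x => iSup₂_le fun z hz => ?_, fun x => iSup₂_le fun z hz => ?_, ?_⟩
  · refine le_trans (ENNReal.ofReal_le_ofReal ?_) (le_iSup₂ (f := fun θ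
      (_ : θ ∈ Metric.closedBall θ₀ r ∩ S.Θ) => ENNReal.ofReal (r ^ 2 *
        max (lambdaMax (S.H x θ - S.Hbar θ₀ θ)) 0)) z.1 hz.1)
    rw [hQD x z hz]
    exact le_lambdaMax_mul ((H_isHermitian hreg x hz.1.2).sub (Hbar_isHermitian hreg θ₀ hz.1.2))
      (hnorm z hz)
  · refine le_trans (ENNReal.ofReal_le_ofReal ?_) (le_iSup₂ (f := fun θ
      (_ : θ ∈ Metric.closedBall θ₀ r ∩ S.Θ) => ENNReal.ofReal (r ^ 2 *
        max (lambdaMax (S.Hbar θ₀ θ - S.H x θ)) 0)) z.1 hz.1)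
    rw [neg_sub_neg, ← neg_sub, hQD x z hz, ← dotProduct_neg, ← Matrix.neg_mulVec, neg_sub]
    exact le_lambdaMax_mul ((Hbar_isHermitian hreg θ₀ hz.1.2).sub (H_isHermitian hreg x hz.1.2))
      (hnorm z hz)
  · intro θ hθ v hv x x'
    have hz : (θ, v) ∈ Z := ⟨hθ, by simpa using hv⟩
    have e : fderiv ℝ (fderiv ℝ (S.L x)) θ v v - fderiv ℝ (fderiv ℝ (S.L x')) θ v v =
        (Q x (θ, v) - D (θ, v)) + (-Q x' (θ, v) - -D (θ, v)) := by
      simp only [hQ]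
      ring
    rw [e]
    refine ENNReal.ofReal_add_le.trans (add_le_add ?_ ?_)
    · exact le_iSup₂ (f := fun z (_ : z ∈ Z) => ENNReal.ofReal (Q x z - D z)) _ hz
    · exact le_iSup₂ (f := fun z (_ : z ∈ Z) => ENNReal.ofReal (-Q x' z - -D z)) _ hz

variable {θ₀ : Vec d} {r : ℝ}

/-- The Taylor bound is applied to the difference of the objectives for `x` and `x'` along the
segment from `θ` to `θ₀`, which stays in the convex set `B(θ₀, r) ∩ Θ`. Comparing two data points
avoids differentiating under an expectation. -/
theorem taylor_L_sub_le (hreg : S.Regular) (hθ₀ : θ₀ ∈ S.Θ) {θ : Vec d}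
    (hθ : θ ∈ Metric.closedBall θ₀ r ∩ S.Θ) (x x' : 𝒳) {N : ℝ}
    (hN : ∀ t ∈ Metric.closedBall θ₀ r ∩ S.Θ, fderiv ℝ (fderiv ℝ (S.L x)) t (θ₀ - θ) (θ₀ - θ) -
      fderiv ℝ (fderiv ℝ (S.L x')) t (θ₀ - θ) (θ₀ - θ) ≤ N) :
    (S.L x θ₀ - S.L x θ - fderiv ℝ (S.L x) θ (θ₀ - θ)) -
      (S.L x' θ₀ - S.L x' θ - fderiv ℝ (S.L x') θ (θ₀ - θ)) ≤ N / 2 := by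
  set Δ := θ₀ - θ with hΔ
  have hr : 0 ≤ r := dist_nonneg.trans (Metric.mem_closedBall.1 hθ.1)
  have hmem : ∀ t ∈ Set.Icc (0 : ℝ) 1, θ + t • Δ ∈ Metric.closedBall θ₀ r ∩ S.Θ := by
    intro t ht
    have := ((convex_closedBall θ₀ r).inter hreg.convex).add_smul_sub_mem hθ
      ⟨Metric.mem_closedBall_self hr, hθ₀⟩ ht
    exact this
  have hline : ∀ t : ℝ, HasDerivAt (fun t : ℝ => θ + t • Δ) Δ t := fun t => by
    simpa using ((hasDerivAt_id t).smul_const Δ).const_add θ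
  have d1 : ∀ y : 𝒳, ∀ t ∈ Set.Icc (0 : ℝ) 1, HasDerivAt (fun t : ℝ => S.L y (θ + t • Δ))
      (fderiv ℝ (S.L y) (θ + t • Δ) Δ) t := fun y t ht =>
    HasFDerivAt.comp_hasDerivAt (l := S.L y) t
      (hreg.differentiableAt_L y (hmem t ht).2).hasFDerivAt (hline t)
  have d2 : ∀ y : 𝒳, ∀ t ∈ Set.Icc (0 : ℝ) 1,
      HasDerivAt (fun t : ℝ => fderiv ℝ (S.L y) (θ + t • Δ) Δ)
      (fderiv ℝ (fderiv ℝ (S.L y)) (θ + t • Δ) Δ Δ) t := fun y t ht => by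
    have h1 : HasDerivAt (fun t : ℝ => fderiv ℝ (S.L y) (θ + t • Δ))
        (fderiv ℝ (fderiv ℝ (S.L y)) (θ + t • Δ) Δ) t :=
      ((hreg.differentiableAt_fderiv_L y (hmem t ht).2).hasFDerivAt).comp_hasDerivAt t (hline t)
    simpa using h1.clm_apply (hasDerivAt_const t Δ)
  have := taylor_two_le (N := N) (fun t ht => (d1 x t ht).sub (d1 x' t ht))
    (fun t ht => (d2 x t ht).sub (d2 x' t ht)) (fun t ht => hN _ (hmem t ht))
  simp only [Pi.sub_apply, one_smul, zero_smul, add_zero] at this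
  have e : θ + Δ = θ₀ := by simp [hΔ]
  rw [e] at this
  linarith

/-- The Taylor remainders satisfy `B x - up x / 2 ≤ B x' + low x' / 2` for all `x`, `x'`, so one
number `C₀` separates the two families and stands in for an expected remainder. Since `∇L(θ; x) = g
- σ w`, the first-order term splits into a part depending only on `(θ, g)`, which joins `C`, and `σ
⟪w, θ - θ₀⟫`, which sparsity controls. -/
theorem exists_log_ratio_bound (hreg : S.Regular) (hθ₀ : θ₀ ∈ S.Θ) {up low : 𝒳 → ℝ≥0∞}
    (hdev : ∀ θ ∈ Metric.closedBall θ₀ r ∩ S.Θ, ∀ v : Vec d, ‖v‖ ≤ r → ∀ x x' : 𝒳,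
      ENNReal.ofReal (fderiv ℝ (fderiv ℝ (S.L x)) θ v v - fderiv ℝ (fderiv ℝ (S.L x')) θ v v) ≤
        up x + low x')
    {p : ℕ} (v : Fin p → Vec d) (k : ℕ) {θ : Vec d} (hθ : θ ∈ Metric.closedBall θ₀ r ∩ S.Θ)
    (hsp : sparsity v (θ - θ₀) ≤ (k : ℕ∞)) (g : Vec d) :
    ∃ C : ℝ, ∀ x, up x ≠ ∞ → low x ≠ ∞ →
      -(S.σ * r * sparseNorm v k (S.noiseAt (x, θ, g)) + (low x).toReal / 2) ≤
        Real.log (S.f x θ) - Real.log (S.f x θ₀) - C ∧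
      Real.log (S.f x θ) - Real.log (S.f x θ₀) - C ≤
        S.σ * r * sparseNorm v k (S.noiseAt (x, θ, g)) + (up x).toReal / 2 := by
  set B : 𝒳 → ℝ := fun x => S.L x θ₀ - S.L x θ - fderiv ℝ (S.L x) θ (θ₀ - θ) with hB
  have hΔ : ‖θ₀ - θ‖ ≤ r := by
    rw [← dist_eq_norm, dist_comm]
    exact hθ.1
  have hBB : ∀ x x', up x ≠ ∞ → low x ≠ ∞ → up x' ≠ ∞ → low x' ≠ ∞ →
      B x - (up x).toReal / 2 ≤ B x' + (low x').toReal / 2 := by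
    intro x x' hu _ _ hl
    have := taylor_L_sub_le hreg hθ₀ hθ x x' (N := (up x).toReal + (low x').toReal) fun t ht => by
      rw [← ENNReal.toReal_add hu hl]
      exact (ENNReal.ofReal_le_iff_le_toReal (ENNReal.add_ne_top.2 ⟨hu, hl⟩)).1
        (hdev t ht _ hΔ x x')
    simp only [hB]
    linarith
  obtain ⟨C₀, hC₀⟩ : ∃ C₀ : ℝ, ∀ x, up x ≠ ∞ → low x ≠ ∞ →
      B x - (up x).toReal / 2 ≤ C₀ ∧ C₀ ≤ B x + (low x).toReal / 2 := by
    by_cases hne : ∃ x, up x ≠ ∞ ∧ low x ≠ ∞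
    · obtain ⟨x₀, hx₀⟩ := hne
      obtain ⟨C₀, h1, h2⟩ := exists_between_of_forall_le
        (s := (fun x => B x - (up x).toReal / 2) '' {x | up x ≠ ∞ ∧ low x ≠ ∞})
        (t := (fun x => B x + (low x).toReal / 2) '' {x | up x ≠ ∞ ∧ low x ≠ ∞})
        ⟨_, x₀, hx₀, rfl⟩ ⟨_, x₀, hx₀, rfl⟩ (by
          rintro _ ⟨x, hx, rfl⟩ _ ⟨x', hx', rfl⟩
          exact hBB x x' hx.1 hx.2 hx'.1 hx'.2)
      exact ⟨C₀, fun x hu hl => ⟨h1 ⟨x, ⟨hu, hl⟩, rfl⟩, h2 ⟨x, ⟨hu, hl⟩, rfl⟩⟩⟩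
    · exact ⟨0, fun x hu hl => absurd ⟨x, hu, hl⟩ hne⟩
  refine ⟨C₀ + (inner ℝ g (θ₀ - θ) - (S.R θ₀ - S.R θ)), fun x hu hl => ?_⟩
  obtain ⟨h1, h2⟩ := hC₀ x hu hl
  set w := S.noiseAt (x, θ, g) with hw
  have hgrad : fderiv ℝ (S.L x) θ (θ₀ - θ) = inner ℝ g (θ₀ - θ) + S.σ * inner ℝ w (θ - θ₀) := by
    have h3 : g = gradient (S.L x) θ + S.σ • w := by
      rw [← gradient_Lw hreg x w hθ.2]
      exact (S.gradient_Lw_eq_iff hreg x w g hθ.2).2 hw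
    have h4 : gradient (S.L x) θ = g - S.σ • w := by rw [h3]; abel
    rw [← inner_gradient_left, h4, inner_sub_left, inner_smul_left, ← neg_sub θ θ₀, inner_neg_right]
    simp only [conj_trivial]
    ring_nf
    rw [inner_neg_right]
    ring
  have hu' : Real.log (S.f x θ) - Real.log (S.f x θ₀) =
      B x + inner ℝ g (θ₀ - θ) + S.σ * inner ℝ w (θ - θ₀) - (S.R θ₀ - S.R θ) := by
    simp only [hB, hgrad, L]
    ring
  have hlin : |S.σ * inner ℝ w (θ - θ₀)| ≤ S.σ * r * sparseNorm v k w := by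
    rw [abs_mul, abs_of_pos S.σ_pos, mul_assoc]
    refine mul_le_mul_of_nonneg_left ?_ S.σ_pos.le
    refine (abs_inner_le_sparseNorm_mul v k hsp).trans ?_
    rw [mul_comm]
    refine mul_le_mul_of_nonneg_right ?_ (sparseNorm_nonneg v k w)
    rwa [← norm_neg, neg_sub]
  obtain ⟨h5, h6⟩ := abs_le.1 hlin
  rw [hu']
  constructor <;> linarith

end LikelihoodRatio

end Setup

namespace Setup

variable {𝒳 : Type*} [MeasurableSpace 𝒳] {d c : ℕ} {S : Setup 𝒳 d c} {θ₀ : Vec d} {r ε : ℝ}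

/-! ### The joint density near the true parameter -/

/-- The density is positive and finite, so `ν` is recovered from the probability measure `P_{θ₀}` by
the inverse density. -/
theorem Regular.sFinite_ν (hreg : S.Regular) (hθ₀ : θ₀ ∈ S.Θ) : SFinite S.ν := by
  have := hreg.isProbabilityMeasure_P θ₀ hθ₀
  have hm : Measurable fun x => ENNReal.ofReal (S.f x θ₀) := (hreg.measurable_f θ₀ hθ₀).ennreal_ofReal
  have h : (S.P θ₀).withDensity (fun x => ENNReal.ofReal (S.f x θ₀))⁻¹ = S.ν :=
    withDensity_inv_same hm
      (.of_forall fun x => (ENNReal.ofReal_pos.2 (hreg.f_pos x θ₀ hθ₀)).ne')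
      (.of_forall fun x => ENNReal.ofReal_ne_top)
  rw [← h]
  infer_instance

theorem Regular.ae_of_ae_P (hreg : S.Regular) (hθ₀ : θ₀ ∈ S.Θ) {p : 𝒳 → Prop}
    (h : ∀ᵐ x ∂(S.P θ₀), p x) : ∀ᵐ x ∂S.ν, p x := by
  rw [P, ae_withDensity_iff (hreg.measurable_f θ₀ hθ₀).ennreal_ofReal] at h
  exact h.mono fun x hx => hx (ENNReal.ofReal_pos.2 (hreg.f_pos x θ₀ hθ₀)).ne'

section JointDensity

variable (S)

/-- The density of the joint law of the data, the solution and the gradient, on the event that the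
solution is an SSOSP in `G`. -/
def jointDensity (κ : ℝ) (θ₀ : Vec d) (G : Set (Vec d)) (q : 𝒳 × Vec d × Vec d) : ℝ≥0∞ :=
  G.indicator (fun _ => ENNReal.ofReal (κ * S.σ⁻¹ ^ d * S.weight q) *
    ENNReal.ofReal (S.f q.1 θ₀)) q.2.1

theorem measurable_jointDensity (hreg : S.Regular) (κ : ℝ) (hθ₀ : θ₀ ∈ S.Θ) {G : Set (Vec d)}
    (hG : MeasurableSet G) : Measurable (S.jointDensity κ θ₀ G) := by
  have h1 := S.measurable_weight hreg
  have h2 := hreg.measurable_f θ₀ hθ₀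
  have h3 : Measurable fun q : 𝒳 × Vec d × Vec d =>
      ENNReal.ofReal (κ * S.σ⁻¹ ^ d * S.weight q) * ENNReal.ofReal (S.f q.1 θ₀) := by fun_prop
  exact h3.indicator (measurable_snd.fst hG)

theorem setLIntegral_ssosp_eq (hreg : S.Regular) {κ : ℝ}
    (hnoise : noise d = (volume : Measure (Vec d)).withDensity
      fun w => ENNReal.ofReal (κ * Real.exp (-(d / 2 * ‖w‖ ^ 2))))
    (hθ₀ : θ₀ ∈ S.Θ) {G : Set (Vec d)} (hG : MeasurableSet G) {F : 𝒳 × Vec d × Vec d → ℝ≥0∞}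
    (hF : Measurable F) :
    ∫⁻ q in {q : 𝒳 × Vec d | S.IsSSOSP q.1 q.2 (S.thetaHat q.1 q.2) ∧ S.thetaHat q.1 q.2 ∈ G},
      F (q.1, S.thetaHat q.1 q.2, S.gHat q.1 q.2) ∂((S.P θ₀).prod (noise d)) =
    ∫⁻ q, S.jointDensity κ θ₀ G q * F q ∂(S.ν.prod S.strataMeasure) := by
  have := hreg.sFinite_ν hθ₀
  have := hreg.isProbabilityMeasure_P θ₀ hθ₀
  have hSm := S.measurableSet_isSSOSP hreg
  have hGm : MeasurableSet {q : 𝒳 × Vec d | S.thetaHat q.1 q.2 ∈ G} := S.measurable_thetaHat hG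
  have hsol : Measurable fun q : 𝒳 × Vec d => (q.1, S.thetaHat q.1 q.2, S.gHat q.1 q.2) :=
    measurable_fst.prodMk (S.measurable_thetaHat.prodMk (S.measurable_gHat hreg))
  set F' : 𝒳 × Vec d × Vec d → ℝ≥0∞ := fun q => G.indicator (fun _ => F q) q.2.1 with hF'
  have hF'm : Measurable F' := hF.indicator (measurable_snd.fst hG)
  have hF's : Measurable fun q : 𝒳 × Vec d => F' (q.1, S.thetaHat q.1 q.2, S.gHat q.1 q.2) :=
    hF'm.comp hsol
  have h1 : ∫⁻ q in {q : 𝒳 × Vec d | S.IsSSOSP q.1 q.2 (S.thetaHat q.1 q.2) ∧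
      S.thetaHat q.1 q.2 ∈ G}, F (q.1, S.thetaHat q.1 q.2, S.gHat q.1 q.2)
      ∂((S.P θ₀).prod (noise d)) =
      ∫⁻ q, {q : 𝒳 × Vec d | S.IsSSOSP q.1 q.2 (S.thetaHat q.1 q.2)}.indicator
        (fun q => F' (q.1, S.thetaHat q.1 q.2, S.gHat q.1 q.2)) q ∂((S.P θ₀).prod (noise d)) := by
    have hDm : MeasurableSet {q : 𝒳 × Vec d | S.IsSSOSP q.1 q.2 (S.thetaHat q.1 q.2) ∧
        S.thetaHat q.1 q.2 ∈ G} := hSm.inter hGm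
    rw [← lintegral_indicator hDm]
    refine lintegral_congr fun q => ?_
    by_cases h1 : S.IsSSOSP q.1 q.2 (S.thetaHat q.1 q.2) <;>
    by_cases h2 : S.thetaHat q.1 q.2 ∈ G <;> simp [hF', h1, h2]
  have hweight := S.measurable_weight hreg
  have hκm : Measurable fun q : 𝒳 × Vec d × Vec d =>
      ENNReal.ofReal (κ * S.σ⁻¹ ^ d * S.weight q) * F' q := by fun_prop
  have h2 : ∀ x, ∫⁻ w, {q : 𝒳 × Vec d | S.IsSSOSP q.1 q.2 (S.thetaHat q.1 q.2)}.indicator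
        (fun q => F' (q.1, S.thetaHat q.1 q.2, S.gHat q.1 q.2)) (x, w) ∂(noise d) =
      ∫⁻ t, ENNReal.ofReal (κ * S.σ⁻¹ ^ d * S.weight (x, t)) * F' (x, t) ∂S.strataMeasure := by
    intro x
    rw [← S.lintegral_ssosp hreg hnoise x (F := fun t => F' (x, t)) (by fun_prop),
      ← lintegral_indicator]
    · rfl
    · exact (measurable_prodMk_left (x := x)) hSm
  have hjF : Measurable fun q => S.jointDensity κ θ₀ G q * F q :=
    (S.measurable_jointDensity hreg κ hθ₀ hG).mul hF
  rw [h1, lintegral_prod _ (hF's.indicator hSm).aemeasurable]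
  simp_rw [h2]
  rw [P, lintegral_withDensity_eq_lintegral_mul _ (hreg.measurable_f θ₀ hθ₀).ennreal_ofReal
    hκm.lintegral_prod_right',
    lintegral_prod _ hjF.aemeasurable]
  refine lintegral_congr fun x => ?_
  rw [Pi.mul_apply, ← lintegral_const_mul _ (by fun_prop)]
  refine lintegral_congr fun t => ?_
  by_cases ht : t.1 ∈ G
  · simp only [jointDensity, hF', Set.indicator_of_mem ht]
    ring
  · simp [jointDensity, hF', Set.indicator_of_notMem ht]

theorem noiseAt_thetaHat_gHat (hreg : S.Regular) (x : 𝒳) (w : Vec d) :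
    S.noiseAt (x, S.thetaHat x w, S.gHat x w) = w :=
  ((S.gradient_Lw_eq_iff hreg x w _ (S.thetaHat_mem x w)).1 rfl).symm

end JointDensity

/-! ### Consequences of the concentration of the Hessian -/

theorem HessianConcentration.nonneg (hHess : S.HessianConcentration θ₀ r ε)
    [IsProbabilityMeasure (S.P θ₀)] : 0 ≤ ε := by
  have h1 : (0 : EReal) ≤ (ε : EReal) := by
    refine le_trans ?_ hHess.upper
    rw [← ENNReal.log_one, ENNReal.log_le_log_iff]
    calc (1 : ℝ≥0∞) = ∫⁻ _x, 1 ∂(S.P θ₀) := by simp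
      _ ≤ _ := lintegral_mono fun x => by
        rw [EReal.one_le_exp_iff]
        exact EReal.coe_ennreal_nonneg _
  exact_mod_cast h1

/-- Taylor's formula uses only half of the deviation. Its exponential moment is bounded through `a ≤
b / 2 + a² / (2 b)` with `b = e^(ε / 2)`, in place of Cauchy–Schwarz. -/
theorem HessianConcentration.upper_bounds (hHess : S.HessianConcentration θ₀ r ε)
    [IsProbabilityMeasure (S.P θ₀)] {up : 𝒳 → ℝ≥0∞} (hup : Measurable up)
    (hle : ∀ x, up x ≤ S.upperDev θ₀ r x) :
    (∀ᵐ x ∂(S.P θ₀), up x ≠ ∞) ∧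
      ∫⁻ x, ENNReal.ofReal (Real.exp ((up x).toReal / 2)) ∂(S.P θ₀) ≤
        ENNReal.ofReal (Real.exp (ε / 2)) := by
  have hm : Measurable fun x => EReal.exp (up x : EReal) := by fun_prop
  have h1 : ∫⁻ x, EReal.exp (up x : EReal) ∂(S.P θ₀) ≤ ENNReal.ofReal (Real.exp ε) := by
    have h2 : ENNReal.log (∫⁻ x, EReal.exp (up x : EReal) ∂(S.P θ₀)) ≤ (ε : EReal) := by
      refine le_trans (ENNReal.log_le_log_iff.2 (lintegral_mono fun x => ?_)) hHess.upper
      exact EReal.exp_le_exp_iff.2 (by exact_mod_cast hle x)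
    rw [← EReal.exp_coe, ← ENNReal.exp_log (∫⁻ x, EReal.exp (up x : EReal) ∂(S.P θ₀))]
    exact EReal.exp_le_exp_iff.2 h2
  have hfin : ∀ᵐ x ∂(S.P θ₀), up x ≠ ∞ := by
    refine (ae_lt_top hm (ne_top_of_le_ne_top ENNReal.ofReal_ne_top h1)).mono fun x hx htop => ?_
    rw [htop] at hx
    simp at hx
  refine ⟨hfin, ?_⟩
  have h3 : ∀ᵐ x ∂(S.P θ₀), ENNReal.ofReal (Real.exp ((up x).toReal / 2)) ≤
      ENNReal.ofReal (Real.exp (ε / 2) / 2) +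
        ENNReal.ofReal (Real.exp (-(ε / 2)) / 2) * EReal.exp (up x : EReal) := by
    filter_upwards [hfin] with x hx
    have h4 : EReal.exp (up x : EReal) = ENNReal.ofReal (Real.exp (up x).toReal) := by
      rw [← EReal.exp_coe, ← EReal.coe_ennreal_toReal hx]
    rw [h4, ← ENNReal.ofReal_mul (by positivity), ← ENNReal.ofReal_add (by positivity)
      (by positivity)]
    refine ENNReal.ofReal_le_ofReal ?_
    set a := Real.exp ((up x).toReal / 2) with ha
    set b := Real.exp (ε / 2) with hb
    have hbpos : 0 < b := Real.exp_pos _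
    have h5 : Real.exp (up x).toReal = a ^ 2 := by
      rw [ha, sq, ← Real.exp_add]; ring_nf
    rw [h5, Real.exp_neg, ← hb]
    have : b / 2 + b⁻¹ / 2 * a ^ 2 - a = (a - b) ^ 2 * b⁻¹ / 2 := by
      field_simp; ring
    have h6 : 0 ≤ (a - b) ^ 2 * b⁻¹ / 2 := by positivity
    linarith
  calc ∫⁻ x, ENNReal.ofReal (Real.exp ((up x).toReal / 2)) ∂(S.P θ₀)
      ≤ ∫⁻ x, (ENNReal.ofReal (Real.exp (ε / 2) / 2) +
        ENNReal.ofReal (Real.exp (-(ε / 2)) / 2) * EReal.exp (up x : EReal)) ∂(S.P θ₀) :=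
        lintegral_mono_ae h3
    _ = ENNReal.ofReal (Real.exp (ε / 2) / 2) + ENNReal.ofReal (Real.exp (-(ε / 2)) / 2) *
        ∫⁻ x, EReal.exp (up x : EReal) ∂(S.P θ₀) := by
        rw [lintegral_add_left measurable_const, lintegral_const_mul _ hm]
        simp
    _ ≤ ENNReal.ofReal (Real.exp (ε / 2) / 2) + ENNReal.ofReal (Real.exp (-(ε / 2)) / 2) *
        ENNReal.ofReal (Real.exp ε) := by gcongr
    _ = ENNReal.ofReal (Real.exp (ε / 2)) := by
        rw [← ENNReal.ofReal_mul (by positivity), ← ENNReal.ofReal_add (by positivity)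
          (by positivity)]
        congr 1
        rw [div_mul_eq_mul_div, ← Real.exp_add]
        ring_nf

theorem HessianConcentration.lower_bounds (hHess : S.HessianConcentration θ₀ r ε)
    {low : 𝒳 → ℝ≥0∞} (hlow : Measurable low)
    (hle : ∀ x, low x ≤ S.lowerDev θ₀ r x) :
    (∀ᵐ x ∂(S.P θ₀), low x ≠ ∞) ∧
      ∫⁻ x, ENNReal.ofReal ((low x).toReal / 2) ∂(S.P θ₀) ≤ ENNReal.ofReal (ε / 2) := by
  have h1 : ∫⁻ x, low x ∂(S.P θ₀) ≤ ENNReal.ofReal ε :=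
    (lintegral_mono hle).trans hHess.lower
  refine ⟨(ae_lt_top hlow (ne_top_of_le_ne_top ENNReal.ofReal_ne_top h1)).mono fun x hx => hx.ne,
    ?_⟩
  have h2 : ∀ a : ℝ, ENNReal.ofReal (a / 2) = ENNReal.ofReal a / 2 := fun a => by
    rw [ENNReal.ofReal_div_of_pos two_pos]; simp
  simp_rw [h2, ENNReal.div_eq_inv_mul]
  rw [lintegral_const_mul _ (by fun_prop)]
  gcongr
  exact (lintegral_mono fun x => ENNReal.ofReal_toReal_le).trans h1

end Setup

/-! ### Moments of the noise -/

theorem lintegral_exp_sparseNorm_noise_le {d p : ℕ} (v : Fin p → Vec d) (k : ℕ) {a : ℝ}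
    (ha : 0 ≤ a) (hsmall : 3 * (a * √(effDim v k / d)) ≤ 1) :
    ∫⁻ w, ENNReal.ofReal (Real.exp (a * sparseNorm v k w)) ∂(noise d) ≤
      ENNReal.ofReal (Real.exp (2 * (a * √(effDim v k / d)))) := by
  have hY := isUnitSupportFunction_sparseNorm v k
  have hs : a * √(effDim v k / d) = (a * (√d)⁻¹) * √(effDim v k) := by
    rw [Real.sqrt_div (effDim_nonneg v k)]; ring
  rw [hs] at hsmall ⊢
  have hm : Measurable fun w => ENNReal.ofReal (Real.exp (a * sparseNorm v k w)) :=
    (Real.measurable_exp.comp (hY.measurable.const_mul a)).ennreal_ofReal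
  rw [noise, lintegral_map hm (by fun_prop)]
  have h1 : ∀ z : Vec d, a * sparseNorm v k ((√(d : ℝ))⁻¹ • z) =
      a * (√d)⁻¹ * sparseNorm v k z := fun z => by
    rw [sparseNorm_smul, abs_of_nonneg (by positivity), mul_assoc]
  simp_rw [h1]
  rw [← ofReal_integral_eq_lintegral_ofReal (hY.integrable_exp _)
    (.of_forall fun z => (Real.exp_pos _).le)]
  exact ENNReal.ofReal_le_ofReal (integral_exp_sparseNorm_le v k (by positivity) hsmall)

theorem lintegral_sparseNorm_noise_le {d p : ℕ} (v : Fin p → Vec d) (k : ℕ) {a : ℝ}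
    (ha : 0 ≤ a) :
    ∫⁻ w, ENNReal.ofReal (a * sparseNorm v k w) ∂(noise d) ≤
      ENNReal.ofReal (a * √(effDim v k / d)) := by
  have hY := isUnitSupportFunction_sparseNorm v k
  have hs : a * √(effDim v k / d) = (a * (√d)⁻¹) * √(effDim v k) := by
    rw [Real.sqrt_div (effDim_nonneg v k)]; ring
  rw [hs]
  have hm : Measurable fun w => ENNReal.ofReal (a * sparseNorm v k w) :=
    (hY.measurable.const_mul a).ennreal_ofReal
  rw [noise, lintegral_map hm (by fun_prop)]
  have h1 : ∀ z : Vec d, a * sparseNorm v k ((√(d : ℝ))⁻¹ • z) =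
      a * (√d)⁻¹ * sparseNorm v k z := fun z => by
    rw [sparseNorm_smul, abs_of_nonneg (by positivity), mul_assoc]
  simp_rw [h1]
  rw [← ofReal_integral_eq_lintegral_ofReal (hY.integrable.const_mul _)
    (.of_forall fun z => mul_nonneg (by positivity) (sparseNorm_nonneg v k z)),
    integral_const_mul]
  exact ENNReal.ofReal_le_ofReal (mul_le_mul_of_nonneg_left (integral_sparseNorm_le v k)
    (by positivity))

namespace Setup

variable {𝒳 : Type*} [MeasurableSpace 𝒳] {d c : ℕ} {S : Setup 𝒳 d c} {θ₀ : Vec d} {r ε : ℝ}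

/-! ### The exchangeable approximation -/

theorem IsValidSampler.exchangeable_of_smul_unnormLaw {M : ℕ}
    {Pt : Kernel (𝒳 × Vec d × Vec d) (Fin M → 𝒳)} [IsMarkovKernel Pt]
    (hPt : S.IsValidSampler Pt) {θ : Vec d} (hθ : θ ∈ S.Θ) {g : Vec d}
    (hnorm : S.Normalizable θ g) (a : ℝ≥0∞) [SFinite S.ν] :
    Exchangeable (((a • S.unnormLaw θ g) ⊗ₘ
      (Pt.comap (fun x : 𝒳 => (x, θ, g)) (by fun_prop))).map
        (fun q => (Fin.cons q.1 q.2 : Fin (M + 1) → 𝒳))) := by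
  have h1 : a • S.unnormLaw θ g = (a * S.unnormLaw θ g Set.univ) • S.condLaw θ g := by
    rw [condLaw, smul_smul, mul_assoc, ENNReal.mul_inv_cancel hnorm.1 hnorm.2, mul_one]
  have : SFinite (S.unnormLaw θ g) := by unfold unnormLaw; infer_instance
  have : SFinite (S.condLaw θ g) := by unfold condLaw; infer_instance
  rw [h1, Measure.compProd_smul_left, Measure.map_smul]
  exact (hPt θ hθ g hnorm).smul _

/-- The tilt trades `f(x; θ₀)` for `f(x; θ)`, so a slice of the tilted law is a multiple of the
plug-in law, to which the sampler's requirement applies. -/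
theorem jointDensity_mul_exp (hreg : S.Regular) {κ : ℝ} (hκ : 0 < κ) (hθ₀ : θ₀ ∈ S.Θ)
    {G : Set (Vec d)} {θ : Vec d} (hθ : θ ∈ S.Θ) (hθG : θ ∈ G) (g : Vec d) (x : 𝒳) :
    S.jointDensity κ θ₀ G (x, θ, g) *
      ENNReal.ofReal (Real.exp (Real.log (S.f x θ) - Real.log (S.f x θ₀))) =
    ENNReal.ofReal (κ * S.σ⁻¹ ^ d) * ENNReal.ofReal (S.unnormDensity θ g x) := by
  have hσ := S.σ_pos
  have h0 := hreg.f_pos x θ₀ hθ₀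
  have h1 := hreg.f_pos x θ hθ
  have hw := S.weight_nonneg hreg (x, θ, g)
  rw [jointDensity, Set.indicator_of_mem hθG, Real.exp_sub, Real.exp_log h0, Real.exp_log h1,
    S.unnormDensity_eq hreg, ← ENNReal.ofReal_mul (by positivity),
    ← ENNReal.ofReal_mul (by positivity), ← ENNReal.ofReal_mul (by positivity)]
  congr 1
  field_simp

/-- On the event that the solution is an SSOSP near `θ₀` whose difference from `θ₀` is sparse, the
law of the data with copies drawn from `Pt` is close to an exchangeable law. -/
theorem exists_exchangeable_approx (hd : 0 < d) (hreg : S.Regular) {M : ℕ}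
    (Pt : Kernel (𝒳 × Vec d × Vec d) (Fin M → 𝒳)) [IsMarkovKernel Pt] (hPt : S.IsValidSampler Pt)
    (hθ₀ : θ₀ ∈ S.Θ) (hr : 0 ≤ r) (hHess : S.HessianConcentration θ₀ r ε) {p : ℕ}
    (v : Fin p → Vec d) (k : ℕ) (hsmall : 3 * (S.σ * r * √(effDim v k / d)) ≤ 1)
    {G : Set (Vec d)} (hGm : MeasurableSet G) (hGball : G ⊆ Metric.closedBall θ₀ r ∩ S.Θ)
    (hGsp : ∀ θ ∈ G, sparsity v (θ - θ₀) ≤ (k : ℕ∞)) :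
    ∃ Q : Measure (Fin (M + 1) → 𝒳), Exchangeable Q ∧
      Q Set.univ = ((S.P θ₀).prod (noise d))
        {q | S.IsSSOSP q.1 q.2 (S.thetaHat q.1 q.2) ∧ S.thetaHat q.1 q.2 ∈ G} ∧
      ∀ B, MeasurableSet B →
        ∫⁻ q in {q : 𝒳 × Vec d | S.IsSSOSP q.1 q.2 (S.thetaHat q.1 q.2) ∧ S.thetaHat q.1 q.2 ∈ G},
          Pt (q.1, S.thetaHat q.1 q.2, S.gHat q.1 q.2)
            {y | (Fin.cons q.1 y : Fin (M + 1) → 𝒳) ∈ B} ∂((S.P θ₀).prod (noise d)) ≤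
        Q B + ENNReal.ofReal (3 * (S.σ * r * √(effDim v k / d)) + ε) := by
  have hσ := S.σ_pos
  have hσr : 0 ≤ S.σ * r := by positivity
  have := hreg.sFinite_ν hθ₀
  have := hreg.isProbabilityMeasure_P θ₀ hθ₀
  have hε := hHess.nonneg
  obtain ⟨κ, hκ, hnoise⟩ := exists_noise_eq_withDensity hd
  obtain ⟨up, low, hup, hlow, hup', hlow', hdev⟩ := exists_measurable_dev hreg θ₀ r
  obtain ⟨hupfin, hupint⟩ := hHess.upper_bounds hup hup'
  obtain ⟨hlowfin, hlowint⟩ := hHess.lower_bounds hlow hlow'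
  have hY := isUnitSupportFunction_sparseNorm v k
  have hYm : Measurable fun w : Vec d => sparseNorm v k w := hY.measurable
  have hnm := S.measurable_noiseAt hreg
  set τ : ℝ := S.σ * r * √(effDim v k / d) with hτ
  have hτ0 : 0 ≤ τ := by positivity
  set j := S.jointDensity κ θ₀ G with hj
  have hjm : Measurable j := S.measurable_jointDensity hreg κ hθ₀ hGm
  set D : Set (𝒳 × Vec d) :=
    {q | S.IsSSOSP q.1 q.2 (S.thetaHat q.1 q.2) ∧ S.thetaHat q.1 q.2 ∈ G} with hD
  have hDm : MeasurableSet D := by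
    have h1 := S.measurableSet_isSSOSP hreg
    have h2 : MeasurableSet {q : 𝒳 × Vec d | S.thetaHat q.1 q.2 ∈ G} := S.measurable_thetaHat hGm
    exact h1.inter h2
  set μ := (S.P θ₀).prod (noise d) with hμ
  have hjF : ∀ F : 𝒳 × Vec d × Vec d → ℝ≥0∞, Measurable F →
      ∫⁻ q, j q * F q ∂(S.ν.prod S.strataMeasure) =
        ∫⁻ q in D, F (q.1, S.thetaHat q.1 q.2, S.gHat q.1 q.2) ∂μ :=
    fun F hF => (S.setLIntegral_ssosp_eq hreg hnoise hθ₀ hGm hF).symm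
  have hjtot : ∫⁻ q, j q ∂(S.ν.prod S.strataMeasure) = μ D := by
    simpa using hjF (fun _ => 1) measurable_const
  set u : 𝒳 × Vec d × Vec d → ℝ := fun q =>
    Real.log (S.Θ.indicator (S.f q.1) q.2.1) - Real.log (S.f q.1 θ₀) with hu
  have hum : Measurable u := by
    have h1 : Measurable fun q : 𝒳 × Vec d × Vec d => S.Θ.indicator (S.f q.1) q.2.1 :=
      hreg.measurableParamOn_f.comp (measurable_fst.prodMk measurable_snd.fst)
    have h2 := hreg.measurable_f θ₀ hθ₀
    fun_prop
  set α : 𝒳 × Vec d × Vec d → ℝ := fun q =>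
    S.σ * r * sparseNorm v k (S.noiseAt q) + (up q.1).toReal / 2 with hα
  set β : 𝒳 × Vec d × Vec d → ℝ := fun q =>
    S.σ * r * sparseNorm v k (S.noiseAt q) + (low q.1).toReal / 2 with hβ
  have hYn : Measurable fun q => sparseNorm v k (S.noiseAt q) := hYm.comp hnm
  have hαm : Measurable α := by fun_prop
  have hβm : Measurable β := by fun_prop
  have hα0 : ∀ q, 0 ≤ α q := fun q =>
    add_nonneg (mul_nonneg hσr (sparseNorm_nonneg v k _)) (by positivity)
  have hratio : ∀ t : Vec d × Vec d, ∃ c, ∀ᵐ x ∂S.ν, j (x, t) ≠ 0 →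
      -β (x, t) ≤ u (x, t) - c ∧ u (x, t) - c ≤ α (x, t) := by
    rintro ⟨θ, g⟩
    by_cases hθ : θ ∈ G
    · obtain ⟨C, hC⟩ := exists_log_ratio_bound hreg hθ₀ hdev v k (hGball hθ) (hGsp θ hθ) g
      refine ⟨C, ?_⟩
      filter_upwards [hreg.ae_of_ae_P hθ₀ hupfin, hreg.ae_of_ae_P hθ₀ hlowfin] with x h1 h2 _
      have h3 := hC x h1 h2
      simp only [hu, hα, hβ, Set.indicator_of_mem (hGball hθ).2]
      exact h3
    · exact ⟨0, .of_forall fun x hx => (hx (by simp [hj, jointDensity, hθ])).elim⟩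
  have hnoiseAt : ∀ q : 𝒳 × Vec d, S.noiseAt (q.1, S.thetaHat q.1 q.2, S.gHat q.1 q.2) = q.2 :=
    fun q => S.noiseAt_thetaHat_gHat hreg q.1 q.2
  -- Here `K = exp (2 τ + ε / 2)`. The mass missing off `D` is covered by the integral of `e ≥ 1`
  -- over `Dᶜ`; the integral then runs over the whole product space and factorises by independence
  -- of data and noise.
  have hαK : ∫⁻ q, ENNReal.ofReal (Real.exp (α q)) * j q ∂(S.ν.prod S.strataMeasure) +
      (1 - ∫⁻ q, j q ∂(S.ν.prod S.strataMeasure)) ≤ ENNReal.ofReal (Real.exp (2 * τ + ε / 2)) := by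
    set e : 𝒳 × Vec d → ℝ≥0∞ := fun q => ENNReal.ofReal (Real.exp ((up q.1).toReal / 2)) *
      ENNReal.ofReal (Real.exp (S.σ * r * sparseNorm v k q.2)) with he
    have he1 : ∀ q, 1 ≤ e q := fun q => by
      refine one_le_mul ?_ ?_ <;> rw [ENNReal.one_le_ofReal] <;> refine Real.one_le_exp ?_
      · positivity
      · exact mul_nonneg hσr (sparseNorm_nonneg v k _)
    have h1 : ∫⁻ q, ENNReal.ofReal (Real.exp (α q)) * j q ∂(S.ν.prod S.strataMeasure) =
        ∫⁻ q in D, e q ∂μ := by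
      simp_rw [mul_comm _ (j _)]
      rw [hjF _ (by fun_prop)]
      refine lintegral_congr fun q => ?_
      simp only [hα, he, hnoiseAt]
      rw [← ENNReal.ofReal_mul (by positivity), ← Real.exp_add, add_comm]
    have h2 : 1 - μ D ≤ ∫⁻ q in Dᶜ, e q ∂μ := by
      rw [← prob_compl_eq_one_sub hDm]
      calc μ Dᶜ = ∫⁻ _q in Dᶜ, 1 ∂μ := by simp
        _ ≤ _ := lintegral_mono he1
    rw [h1, hjtot]
    refine (add_le_add le_rfl h2).trans ?_
    have h3 : ∫⁻ q, e q ∂μ = (∫⁻ x, ENNReal.ofReal (Real.exp ((up x).toReal / 2)) ∂(S.P θ₀)) *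
        ∫⁻ w, ENNReal.ofReal (Real.exp (S.σ * r * sparseNorm v k w)) ∂(noise d) :=
      lintegral_prod_mul (f := fun x => ENNReal.ofReal (Real.exp ((up x).toReal / 2)))
        (g := fun w => ENNReal.ofReal (Real.exp (S.σ * r * sparseNorm v k w)))
        (by fun_prop) (by fun_prop)
    rw [lintegral_add_compl _ hDm, h3, add_comm (2 * τ), Real.exp_add, ENNReal.ofReal_mul (Real.exp_pos _).le]
    exact mul_le_mul' hupint (lintegral_exp_sparseNorm_noise_le v k hσr hsmall)
  have hβint : ∫⁻ q, ENNReal.ofReal (β q) * j q ∂(S.ν.prod S.strataMeasure) ≤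
      ENNReal.ofReal (τ + ε / 2) := by
    simp_rw [mul_comm _ (j _)]
    rw [hjF _ (by fun_prop)]
    simp only [hβ, hnoiseAt]
    have hl : ∀ q : 𝒳 × Vec d, 0 ≤ S.σ * r * sparseNorm v k q.2 := fun q =>
      mul_nonneg hσr (sparseNorm_nonneg v k _)
    simp_rw [ENNReal.ofReal_add (hl _) (div_nonneg ENNReal.toReal_nonneg zero_le_two)]
    refine (setLIntegral_le_lintegral _ _).trans ?_
    rw [lintegral_add_left (by fun_prop), hμ, lintegral_prod _ (by fun_prop),
      lintegral_prod _ (by fun_prop), ENNReal.ofReal_add hτ0 (by positivity)]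
    simp only [lintegral_const, measure_univ, mul_one]
    exact add_le_add (lintegral_sparseNorm_noise_le v k hσr) hlowint
  obtain ⟨ρ, hρm, hρ, hρtot, hρφ⟩ := exists_tilted_density S.ν S.strataMeasure hjm hum hαm hβm hα0
    hratio (hjtot.trans_le prob_le_one) (Real.one_le_exp (by positivity)) hαK
  rw [Real.log_exp] at hρφ
  have hcons : Measurable fun q : (𝒳 × Vec d × Vec d) × (Fin M → 𝒳) =>
      (Fin.cons q.1.1 q.2 : Fin (M + 1) → 𝒳) :=
    measurable_cons.comp (measurable_fst.fst.prodMk measurable_snd)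
  set Q := (((S.ν.prod S.strataMeasure).withDensity ρ) ⊗ₘ Pt).map fun q =>
    (Fin.cons q.1.1 q.2 : Fin (M + 1) → 𝒳) with hQ
  have hQB : ∀ B, MeasurableSet B → Q B = ∫⁻ q, ρ q *
      Pt q {y | (Fin.cons q.1 y : Fin (M + 1) → 𝒳) ∈ B} ∂(S.ν.prod S.strataMeasure) := by
    intro B hB
    have hm : Measurable fun q : 𝒳 × Vec d × Vec d =>
        Pt q {y | (Fin.cons q.1 y : Fin (M + 1) → 𝒳) ∈ B} :=
      Kernel.measurable_kernel_prodMk_left (hcons hB)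
    rw [hQ, Measure.map_apply hcons hB, Measure.compProd_apply (hcons hB),
      lintegral_withDensity_eq_lintegral_mul _ hρm (Kernel.measurable_kernel_prodMk_left (hcons hB))]
    rfl
  refine ⟨Q, ?_, ?_, fun B hB => ?_⟩
  · refine exchangeable_mixture S.ν S.strataMeasure hρm Pt ?_
    filter_upwards [hρ] with t ht
    obtain ⟨θ, g⟩ := t
    rcases ht with h0 | ⟨C, hC, hZ0, hZ1⟩
    · have h1 : S.ν.withDensity (fun x => ρ (x, θ, g)) = 0 := by
        rw [withDensity_eq_zero_iff (by fun_prop)]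
        exact h0
      rw [h1]
      intro π
      simp
    -- Outside `G` the density `j` vanishes, so a slice of nonzero tilted mass has `θ ∈ G`.
    · have hθ : θ ∈ G := by
        by_contra hθ
        exact hZ0 (by simp [hj, jointDensity, hθ])
      have hθΘ := (hGball hθ).2
      have hdens : ∀ x, j (x, θ, g) * ENNReal.ofReal (Real.exp (u (x, θ, g))) =
          ENNReal.ofReal (κ * S.σ⁻¹ ^ d) * ENNReal.ofReal (S.unnormDensity θ g x) := fun x => by
        simp only [hu, Set.indicator_of_mem hθΘ]
        exact jointDensity_mul_exp hreg hκ hθ₀ hθΘ hθ g x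
      have hum' : Measurable fun x => ENNReal.ofReal (S.unnormDensity θ g x) := by
        have h1 := S.measurable_weight hreg
        have h2 := hreg.measurable_f θ hθΘ
        simp_rw [S.unnormDensity_eq hreg]
        fun_prop
      simp_rw [hdens] at hZ0 hZ1 hC
      rw [lintegral_const_mul _ hum'] at hZ0 hZ1
      have hκ' : ENNReal.ofReal (κ * S.σ⁻¹ ^ d) ≠ 0 :=
        (ENNReal.ofReal_pos.2 (by positivity)).ne'
      -- The tilted slice has mass neither `0` nor `∞`, and it is a positive multiple of the
      -- unnormalised plug-in density.
      have hnorm : S.Normalizable θ g := by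
        have h1 : S.unnormLaw θ g Set.univ = ∫⁻ x, ENNReal.ofReal (S.unnormDensity θ g x) ∂S.ν := by
          rw [unnormLaw, withDensity_apply _ .univ, Measure.restrict_univ]
        rw [Normalizable, h1]
        exact ⟨right_ne_zero_of_mul hZ0, fun h => hZ1 (by rw [h, ENNReal.mul_top hκ'])⟩
      have hlaw : S.ν.withDensity (fun x => ρ (x, θ, g)) =
          (C * ENNReal.ofReal (κ * S.σ⁻¹ ^ d)) • S.unnormLaw θ g := by
        rw [unnormLaw, ← withDensity_smul _ hum']
        congr 1
        ext1 x
        rw [hC, Pi.smul_apply, smul_eq_mul, mul_assoc]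
      rw [hlaw]
      exact hPt.exchangeable_of_smul_unnormLaw hθΘ hnorm _
  · rw [hQB _ .univ]
    simp only [Set.mem_univ, Set.ofPred_true, measure_univ, mul_one]
    rw [hρtot, hjtot]
  · have hm : Measurable fun q : 𝒳 × Vec d × Vec d =>
        Pt q {y | (Fin.cons q.1 y : Fin (M + 1) → 𝒳) ∈ B} :=
      Kernel.measurable_kernel_prodMk_left (hcons hB)
    have h1 := hρφ _ hm fun q => prob_le_one
    rw [hjF _ hm] at h1
    rw [hQB B hB]
    -- The average of `β` contributes `τ + ε / 2` and `log K` contributes `2 τ + ε / 2`.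
    refine h1.trans (add_le_add le_rfl ((add_le_add hβint le_rfl).trans ?_))
    rw [← ENNReal.ofReal_add (by positivity) (by positivity)]
    exact ENNReal.ofReal_le_ofReal (by linarith)

end Setup

namespace Setup

variable {𝒳 : Type*} [MeasurableSpace 𝒳] {d c : ℕ} {S : Setup 𝒳 d c} {θ₀ : Vec d} {r ε : ℝ}

/-! ### The law of the output of the algorithm -/

section Run

variable {M : ℕ} {Pt : Kernel (𝒳 × Vec d × Vec d) (Fin M → 𝒳)} {Ω : Type*} [MeasurableSpace Ω]
  {Pr : Measure Ω} {X : Ω → 𝒳} {W : Ω → Vec d} {Xt : Ω → Fin M → 𝒳}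

/-- Membership of the solution in `G` is an event of the conditioning variables `(X, θ̂, ĝ)`, so
restricting to it commutes with drawing the copies from `Pt`. -/
theorem IsRun.measure_cons_mem_eq (hreg : S.Regular) [IsMarkovKernel Pt] [IsFiniteMeasure Pr]
    (hrun : S.IsRun Pt θ₀ Pr X W Xt) {G : Set (Vec d)} (hG : MeasurableSet G)
    {B : Set (Fin (M + 1) → 𝒳)} (hB : MeasurableSet B) :
    Pr ({ω | (Fin.cons (X ω) (Xt ω) : Fin (M + 1) → 𝒳) ∈ B} ∩
      {ω | S.IsSSOSP (X ω) (W ω) (S.thetaHat (X ω) (W ω)) ∧ S.thetaHat (X ω) (W ω) ∈ G}) =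
    ∫⁻ q in {q : 𝒳 × Vec d | S.IsSSOSP q.1 q.2 (S.thetaHat q.1 q.2) ∧ S.thetaHat q.1 q.2 ∈ G},
      Pt (q.1, S.thetaHat q.1 q.2, S.gHat q.1 q.2)
        {y | (Fin.cons q.1 y : Fin (M + 1) → 𝒳) ∈ B} ∂((S.P θ₀).prod (noise d)) := by
  have hSm := S.measurableSet_isSSOSP hreg
  have hGm : MeasurableSet {q : 𝒳 × Vec d | S.thetaHat q.1 q.2 ∈ G} := S.measurable_thetaHat hG
  have hXW : Measurable fun ω => (X ω, W ω) := hrun.measurable_X.prodMk hrun.measurable_W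
  set E : Set Ω := {ω | S.IsSSOSP (X ω) (W ω) (S.thetaHat (X ω) (W ω))} with hE
  have hEm : MeasurableSet E := hXW hSm
  have hsol : Measurable fun q : 𝒳 × Vec d => (q.1, S.thetaHat q.1 q.2, S.gHat q.1 q.2) :=
    measurable_fst.prodMk (S.measurable_thetaHat.prodMk (S.measurable_gHat hreg))
  set Y : Ω → 𝒳 × Vec d × Vec d :=
    fun ω => (X ω, S.thetaHat (X ω) (W ω), S.gHat (X ω) (W ω)) with hY
  have hYm : Measurable Y := hsol.comp hXW
  have hcons : Measurable fun q : (𝒳 × Vec d × Vec d) × (Fin M → 𝒳) =>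
      (Fin.cons q.1.1 q.2 : Fin (M + 1) → 𝒳) :=
    measurable_cons.comp (measurable_fst.fst.prodMk measurable_snd)
  set φ : 𝒳 × Vec d × Vec d → ℝ≥0∞ := fun q =>
    Pt q {y | (Fin.cons q.1 y : Fin (M + 1) → 𝒳) ∈ B} with hφ
  have hφm : Measurable φ := Kernel.measurable_kernel_prodMk_left (hcons hB)
  set C : Set ((𝒳 × Vec d × Vec d) × (Fin M → 𝒳)) :=
    {q | (Fin.cons q.1.1 q.2 : Fin (M + 1) → 𝒳) ∈ B} ∩ {q | q.1.2.1 ∈ G} with hC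
  have hCG : MeasurableSet {q : (𝒳 × Vec d × Vec d) × (Fin M → 𝒳) | q.1.2.1 ∈ G} :=
    measurable_fst.snd.fst hG
  have hCm : MeasurableSet C := (hcons hB).inter hCG
  have hlaw : (Pr.restrict E).map (fun ω => (Y ω, Xt ω)) = ((Pr.restrict E).map Y) ⊗ₘ Pt :=
    hrun.copies_of_ssosp.map_eq
  have h1 : (Pr.restrict E).map (fun ω => (Y ω, Xt ω)) C =
      Pr ({ω | (Fin.cons (X ω) (Xt ω) : Fin (M + 1) → 𝒳) ∈ B} ∩
        {ω | S.IsSSOSP (X ω) (W ω) (S.thetaHat (X ω) (W ω)) ∧ S.thetaHat (X ω) (W ω) ∈ G}) := by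
    rw [Measure.map_apply (hYm.prodMk hrun.measurable_Xt) hCm, Measure.restrict_apply' hEm]
    congr 1
    ext ω
    simp only [hC, hE, hY, Set.mem_inter_iff, Set.mem_preimage, Set.mem_ofPred_eq]
    tauto
  rw [← h1, hlaw, Measure.compProd_apply hCm,
    lintegral_map (Kernel.measurable_kernel_prodMk_left hCm) hYm]
  set F : 𝒳 × Vec d × Vec d → ℝ≥0∞ := fun q => G.indicator (fun _ => φ q) q.2.1 with hF
  have hFm : Measurable F := hφm.indicator (measurable_snd.fst hG)
  have h2 : ∀ q, Pt q (Prod.mk q ⁻¹' C) = F q := by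
    intro q
    by_cases hq : q.2.1 ∈ G
    · rw [hF]
      simp only [Set.indicator_of_mem hq, hφ]
      congr 1
      ext y
      simp [hC, hq]
    · rw [hF]
      simp only [Set.indicator_of_notMem hq]
      have : Prod.mk q ⁻¹' C = ∅ := by
        ext y
        simp [hC, hq]
      rw [this, measure_empty]
  simp_rw [h2]
  have hFs : Measurable fun q : 𝒳 × Vec d => F (q.1, S.thetaHat q.1 q.2, S.gHat q.1 q.2) :=
    hFm.comp hsol
  have hDm : MeasurableSet {q : 𝒳 × Vec d | S.IsSSOSP q.1 q.2 (S.thetaHat q.1 q.2) ∧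
      S.thetaHat q.1 q.2 ∈ G} := hSm.inter hGm
  rw [← lintegral_indicator hEm, ← lintegral_indicator hDm, ← hrun.law_XW,
    lintegral_map _ hXW]
  · refine lintegral_congr fun ω => ?_
    by_cases h3 : S.IsSSOSP (X ω) (W ω) (S.thetaHat (X ω) (W ω)) <;>
    by_cases h4 : S.thetaHat (X ω) (W ω) ∈ G <;> simp [hE, hF, hY, hφ, h3, h4]
  · exact (hφm.comp hsol).indicator hDm

theorem IsRun.exists_exchangeable_approx (hd : 0 < d) (hreg : S.Regular) [IsMarkovKernel Pt]
    (hPt : S.IsValidSampler Pt) (hθ₀ : θ₀ ∈ S.Θ) (hr : 0 ≤ r) {δ δt : ℝ}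
    (hacc : S.AccurateSSOSP θ₀ r δ) (hHess : S.HessianConcentration θ₀ r ε) {p : ℕ}
    (v : Fin p → Vec d) (k : ℕ)
    (hsparse : 1 - δt ≤ ((S.P θ₀).prod (noise d)).real
      {q | sparsity v (S.thetaHat q.1 q.2 - θ₀) ≤ (k : ℕ∞)})
    [IsProbabilityMeasure Pr] (hrun : S.IsRun Pt θ₀ Pr X W Xt) :
    ∃ ν : Measure (Fin (M + 1) → 𝒳), IsProbabilityMeasure ν ∧ Exchangeable ν ∧
      ∀ B, MeasurableSet B → (Pr.map fun ω => (Fin.cons (X ω) (Xt ω) : Fin (M + 1) → 𝒳)).real B ≤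
        ν.real B + (3 * (S.σ * r * √(effDim v k / d)) + ε + δ + δt) := by
  have := hreg.isProbabilityMeasure_P θ₀ hθ₀
  have hσ := S.σ_pos
  have hε := hHess.nonneg
  have hδ : 0 ≤ δ := by
    have := le_trans hacc measureReal_le_one
    linarith
  have hδt : 0 ≤ δt := by
    have := hsparse.trans measureReal_le_one
    linarith
  have hXm := hrun.measurable_X
  have hcm : Measurable fun ω => (Fin.cons (X ω) (Xt ω) : Fin (M + 1) → 𝒳) :=
    measurable_cons.comp (hXm.prodMk hrun.measurable_Xt)
  have hconst : Measurable fun ω (_ : Fin (M + 1)) => X ω := measurable_pi_lambda _ fun _ => hXm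
  have hmap := Measure.isProbabilityMeasure_map (μ := Pr) hcm.aemeasurable
  set τ := S.σ * r * √(effDim v k / d) with hτ
  have hτ0 : 0 ≤ τ := by positivity
  by_cases hsmall : 3 * τ ≤ 1
  swap
  -- For `3 τ > 1` the bound exceeds one, and any exchangeable law serves; the law of `(X, …, X)` is
  -- one.
  · have := Measure.isProbabilityMeasure_map (μ := Pr) hconst.aemeasurable
    refine ⟨_, this, exchangeable_map_const Pr hXm, fun B _ => ?_⟩
    refine measureReal_le_one.trans ?_
    have : 0 ≤ (Pr.map fun ω (_ : Fin (M + 1)) => X ω).real B := measureReal_nonneg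
    linarith
  set G : Set (Vec d) := (Metric.closedBall θ₀ r ∩ S.Θ) ∩ {θ | sparsity v (θ - θ₀) ≤ (k : ℕ∞)}
    with hG
  have hGm : MeasurableSet G :=
    (Metric.isClosed_closedBall.measurableSet.inter hreg.isOpen.measurableSet).inter
      (measurableSet_sparsity_le v k θ₀)
  obtain ⟨Q, hQ, hQtot, hQB⟩ := Setup.exists_exchangeable_approx hd hreg Pt hPt hθ₀ hr hHess v k hsmall
    hGm Set.inter_subset_left fun θ hθ => hθ.2
  set μ := (S.P θ₀).prod (noise d) with hμ
  set D : Set (𝒳 × Vec d) :=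
    {q | S.IsSSOSP q.1 q.2 (S.thetaHat q.1 q.2) ∧ S.thetaHat q.1 q.2 ∈ G} with hD
  set N : Set Ω := {ω | S.IsSSOSP (X ω) (W ω) (S.thetaHat (X ω) (W ω)) ∧
    S.thetaHat (X ω) (W ω) ∈ G} with hN
  have hXW : Measurable fun ω => (X ω, W ω) := hXm.prodMk hrun.measurable_W
  have hDm : MeasurableSet D := by
    have h1 := S.measurableSet_isSSOSP hreg
    have h2 : MeasurableSet {q : 𝒳 × Vec d | S.thetaHat q.1 q.2 ∈ G} := S.measurable_thetaHat hGm
    exact h1.inter h2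
  have hNm : MeasurableSet N := hXW hDm
  have hND : Pr N = μ D := by
    rw [hμ, ← hrun.law_XW, Measure.map_apply hXW hDm]
    rfl
  have hNc : Pr.real Nᶜ ≤ δ + δt := by
    have hS1 : MeasurableSet {q : 𝒳 × Vec d | S.IsSSOSP q.1 q.2 (S.thetaHat q.1 q.2) ∧
        ‖S.thetaHat q.1 q.2 - θ₀‖ ≤ r} := by
      have h1 := S.measurableSet_isSSOSP hreg
      have h2 : MeasurableSet {q : 𝒳 × Vec d | ‖S.thetaHat q.1 q.2 - θ₀‖ ≤ r} :=
        measurableSet_le (S.measurable_thetaHat.sub_const θ₀).norm measurable_const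
      exact h1.inter h2
    have hS2 : MeasurableSet {q : 𝒳 × Vec d | sparsity v (S.thetaHat q.1 q.2 - θ₀) ≤ (k : ℕ∞)} :=
      S.measurable_thetaHat (measurableSet_sparsity_le v k θ₀)
    have h1 : μ.real Dᶜ ≤ μ.real {q : 𝒳 × Vec d | S.IsSSOSP q.1 q.2 (S.thetaHat q.1 q.2) ∧
        ‖S.thetaHat q.1 q.2 - θ₀‖ ≤ r}ᶜ +
        μ.real {q : 𝒳 × Vec d | sparsity v (S.thetaHat q.1 q.2 - θ₀) ≤ (k : ℕ∞)}ᶜ := by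
      refine (measureReal_mono ?_).trans (measureReal_union_le _ _)
      intro q hq
      by_contra hcon
      simp only [Set.mem_union, Set.mem_compl_iff, Set.mem_ofPred_eq, not_or, not_not] at hcon
      exact hq ⟨hcon.1.1, ⟨by simpa [dist_eq_norm] using hcon.1.2, S.thetaHat_mem _ _⟩, hcon.2⟩
    rw [probReal_compl_eq_one_sub hS1, probReal_compl_eq_one_sub hS2] at h1
    have h2 : Pr.real Nᶜ = μ.real Dᶜ := by
      rw [probReal_compl_eq_one_sub hNm, probReal_compl_eq_one_sub hDm, Measure.real, hND]
      rfl
    have h3 := hacc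
    rw [AccurateSSOSP] at h3
    linarith
  -- `Q` has only the mass of `N`. The law of `(X, …, X)` on the complement is exchangeable and
  -- restores total mass one.
  set Q' : Measure (Fin (M + 1) → 𝒳) := (Pr.restrict Nᶜ).map fun ω _ => X ω with hQ'
  have hprob : IsProbabilityMeasure (Q + Q') := by
    refine ⟨?_⟩
    rw [Measure.add_apply, hQtot, hQ', Measure.map_apply hconst .univ, Set.preimage_univ,
      Measure.restrict_apply_univ, ← hND, measure_add_measure_compl hNm, measure_univ]
  refine ⟨Q + Q', hprob, hQ.add (exchangeable_map_const _ hXm), fun B hB => ?_⟩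
  have h1 := hQB B hB
  rw [← hrun.measure_cons_mem_eq hreg hGm hB] at h1
  have h2 : (Pr.map fun ω => (Fin.cons (X ω) (Xt ω) : Fin (M + 1) → 𝒳)) B ≤
      (Q + Q') B + ENNReal.ofReal (3 * τ + ε + δ + δt) := by
    rw [Measure.map_apply hcm hB]
    have h3 : Pr ((fun ω => (Fin.cons (X ω) (Xt ω) : Fin (M + 1) → 𝒳)) ⁻¹' B) ≤
        Pr ({ω | (Fin.cons (X ω) (Xt ω) : Fin (M + 1) → 𝒳) ∈ B} ∩ N) + Pr Nᶜ := by
      refine (measure_mono fun ω hω => ?_).trans (measure_union_le _ _)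
      by_cases h : ω ∈ N
      · exact Or.inl ⟨hω, h⟩
      · exact Or.inr h
    have h4 : Pr Nᶜ ≤ ENNReal.ofReal (δ + δt) := by
      rw [← ofReal_measureReal]
      exact ENNReal.ofReal_le_ofReal hNc
    calc Pr ((fun ω => (Fin.cons (X ω) (Xt ω) : Fin (M + 1) → 𝒳)) ⁻¹' B)
        ≤ (Q B + ENNReal.ofReal (3 * τ + ε)) + ENNReal.ofReal (δ + δt) :=
          h3.trans (add_le_add h1 h4)
      _ = Q B + ENNReal.ofReal (3 * τ + ε + δ + δt) := by
          rw [add_assoc, ← ENNReal.ofReal_add (by positivity) (by positivity), ← add_assoc]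
      _ ≤ (Q + Q') B + ENNReal.ofReal (3 * τ + ε + δ + δt) := by
          rw [Measure.add_apply]
          exact add_le_add le_self_add le_rfl
  have h3 := ENNReal.toReal_mono
    (ENNReal.add_ne_top.2 ⟨measure_ne_top _ _, ENNReal.ofReal_ne_top⟩) h2
  rwa [ENNReal.toReal_add (measure_ne_top _ _) ENNReal.ofReal_ne_top,
    ENNReal.toReal_ofReal (by positivity)] at h3

end Run

end Setup

end ACSS

end

theorem theorem2 {𝒳 : Type*} [MeasurableSpace 𝒳] {d c p M : ℕ} (hd : 0 < d)
    (S : Setup 𝒳 d c) (hreg : S.Regular)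
    (Pt : Kernel (𝒳 × Vec d × Vec d) (Fin M → 𝒳)) [IsMarkovKernel Pt]
    (hPt : S.IsValidSampler Pt)
    (θ₀ : Vec d) (hθ₀ : θ₀ ∈ S.Θ)
    (r ε δ δt : ℝ) (hr : 0 ≤ r)
    (hacc : S.AccurateSSOSP θ₀ r δ)
    (hHess : S.HessianConcentration θ₀ r ε)
    (v : Fin p → Vec d) (k : ℕ)
    (hsparse : 1 - δt ≤ ((S.P θ₀).prod (noise d)).real
      {q | sparsity v (S.thetaHat q.1 q.2 - θ₀) ≤ (k : ℕ∞)})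
    {Ω : Type*} [MeasurableSpace Ω] (Pr : Measure Ω) [IsProbabilityMeasure Pr]
    (X : Ω → 𝒳) (W : Ω → Vec d) (Xt : Ω → Fin M → 𝒳)
    (hrun : S.IsRun Pt θ₀ Pr X W Xt) :
    dExch (Pr.map fun ω => (Fin.cons (X ω) (Xt ω) : Fin (M + 1) → 𝒳)) ≤
        3 * S.σ * r * Real.sqrt (effDim v k / d) + ε + δ + δt ∧
      ∀ T : 𝒳 → ℝ, Measurable T → ∀ α ∈ Set.Icc (0 : ℝ) 1,
        Pr.real {ω | pval T (X ω) (Xt ω) ≤ α} ≤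
          α + 3 * S.σ * r * Real.sqrt (effDim v k / d) + ε + δ + δt := by
  obtain ⟨ν, hν, hex, hB⟩ :=
    hrun.exists_exchangeable_approx hd hreg hPt hθ₀ hr hacc hHess v k hsparse
  obtain ⟨h1, h2⟩ := dExch_le_and_pval_le Pr hrun.measurable_X hrun.measurable_Xt hex hB
  refine ⟨h1.trans (le_of_eq (by ring)), fun T hT α hα => (h2 T hT α hα).trans (le_of_eq (by ring))⟩
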